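/- Let $E/\mathbb{Q}$ be an elliptic curve of conductor $N$, and let $L(s,E)=\sum_{n\ge 1}\lambda_E(n)n^{-s}$ be its Hasse–Weil $L$-function, normalized so that $\lambda_E(n)=a_E(n)/\sqrt n$, where $\sum_n a_E(n)n^{-s}$ is the usual (unnormalized) $L$-series. For a fundamental discriminant $d$ let $\chi_d=\left(\frac{d}{\cdot}\right)$ be the Kronecker symbol and, for $\mathrm{Re}(s)>1$, let $L(s,E_d)=\sum_{n\ge1}\lambda_E(n)\chi_d(n)n^{-s}$. Let $k,M$ be positive integers and put $$A_{E,M}(s_1,\dots,s_k;w)=\sum_{\substack{d\ge 1\\ (d,N)=1}}^{*}\frac{\chi_d(M)L(s_1,E_d)\cdots L(s_k,E_d)}{d^{w}},$$ where the sum runs over the positive fundamental discriminants $d$ (including $d=1$) coprime to $N$. For $S=\{s_1,\dots,s_k\}$ let $$H_{E,M}(S)=\frac{1}{2\zeta(2)}\sum_{\substack{n_1,\dots,n_k\ge1\\ Mn_1\cdots n_k=\square}}\frac{\lambda_E(n_1)\cdots\lambda_E(n_k)\,a(MNn_1\cdots n_k)}{n_1^{s_1}\cdots n_k^{s_k}},\qquad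 a(n)=\prod_{p\mid n}\frac{p}{p+1}.$$ Then: 1. If $\mathrm{Re}(s_j)>1$ for all $j$ and $\mathrm{Re}(w)>1$, then each series $L(s_j,E_d)$ converges absolutely, and so does the series over $d$ defining $A_{E,M}(s_1,\dots,s_k;w)$. 2. $A_{E,M}(s_1,\dots,s_k;w)$ has a meromorphic extension, in the $k+1$ variables jointly, to the region $\mathrm{Re}(w)>1/2$, $\mathrm{Re}(s_j)>5/4$ for all $j$. It is holomorphic there except for an at most simple pole along $w=1$; that is, $(w-1)A_{E,M}(s_1,\dots,s_k;w)$ extends to a holomorphic function on the whole region. For all $s_1,\dots,s_k$ with real parts greater than $5/4$, the series $H_{E,M}(S)$ converges absolutely and $$\operatorname*{Res}_{w=1}A_{E,M}(s_1,\dots,s_k;w)=\lim_{w\to1}(w-1)A_{E,M}(s_1,\dots,s_k;w)=H_{E,M}(S).$$ -/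

import Mathlib

noncomputable section

namespace EllipticTwists

/-! ### The conductor of an elliptic curve over `ℚ` -/

section Local

open Classical IntermediateField

variable (R : Type*) [CommRing R] [IsDomain R] [IsDiscreteValuationRing R] {K : Type*}
  [Field K] [Algebra R K] [IsFractionRing R K] (W : WeierstrassCurve K)

/-- The `ℓ`-division field `K(W[ℓ])`, generated inside an algebraic closure of `K` by the
coordinates of the points of order dividing `ℓ`. -/
def divisionField (ℓ : ℕ) : IntermediateField K (AlgebraicClosure K) :=
  adjoin K {z | ∃ (x y : AlgebraicClosure K)
    (h : (W.baseChange (AlgebraicClosure K)).toAffine.Nonsingular x y),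
    ℓ • WeierstrassCurve.Affine.Point.some x y h = 0 ∧ (z = x ∨ z = y)}

/-- The `i`-th ramification group, in the lower numbering, of `L / K`, where `K` is the fraction
field of the complete discrete valuation ring `R`: the automorphisms that act trivially on
`O_L / m ^ (i + 1)`. Here `O_L` is the integral closure of `R` in `L` and `m` is its maximal ideal,
which is written as the Jacobson radical because `O_L` is local. -/
def lowerRamificationGroup (L : IntermediateField K (AlgebraicClosure K)) (i : ℕ) :
    Subgroup Gal(L/K) :=
  ((Ideal.jacobson (⊥ : Ideal (integralClosure R L))) ^ (i + 1)).inertia Gal(L/K)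

/-- The `ℓ`-torsion points of `W` over its `ℓ`-division field which are fixed by `H`. -/
def fixedTorsion (ℓ : ℕ) (H : Subgroup Gal(divisionField W ℓ/K)) :
    Set (W.baseChange (divisionField W ℓ)).toAffine.Point :=
  {P | ℓ • P = 0 ∧ ∀ σ ∈ H,
    WeierstrassCurve.Affine.Point.map (W' := W.toAffine) (σ : _ →ₐ[K] _) P = P}

/-- The dimension over `𝔽_ℓ` of `W[ℓ] / W[ℓ]^H`. -/
def codimFixedTorsion (ℓ : ℕ) (H : Subgroup Gal(divisionField W ℓ/K)) : ℕ :=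
  Nat.log ℓ (fixedTorsion W ℓ ⊥).ncard - Nat.log ℓ (fixedTorsion W ℓ H).ncard

/-- A prime different from the residue characteristic. -/
def auxiliaryPrime : ℕ := if ringChar (IsLocalRing.ResidueField R) = 2 then 3 else 2

/-- The wild part `∑_{i ≥ 1} (|G_i| / |G_0|) dim (W[ℓ] / W[ℓ]^{G_i})` of the conductor exponent,
where `G_i` are the ramification groups of `K(W[ℓ]) / K` and `ℓ` is a prime different from the
residue characteristic (the value does not depend on `ℓ`). -/
def wildExponent : ℚ :=
  let ℓ := auxiliaryPrime R
  let G := lowerRamificationGroup R (divisionField W ℓ)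
  ∑ᶠ i : ℕ, (Nat.card (G (i + 1)) : ℚ) / (Nat.card (G 0) : ℚ) * (codimFixedTorsion W ℓ (G (i + 1)))

/-- The conductor exponent: `0` for good, `1` for multiplicative and `2 + δ` for additive
reduction, where `δ` is the wild part, which is an integer and vanishes in the first two cases. -/
def conductorExponent : ℕ :=
  if (W.minimal R).HasGoodReduction R then 0
  else if (W.minimal R).HasMultiplicativeReduction R then 1
  else 2 + ⌊wildExponent R W⌋₊

end Local

open IsDedekindDomain NumberField

/-- The conductor of an elliptic curve over `ℚ`. -/
def ellConductor (E : WeierstrassCurve ℚ) : ℕ :=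
  ∏ᶠ v : HeightOneSpectrum (𝓞 ℚ), Ideal.absNorm v.asIdeal ^
    conductorExponent (v.adicCompletionIntegers ℚ) (E.baseChange (v.adicCompletion ℚ))

/-! ### Twisted `L`-functions and the multiple Dirichlet series -/

/-- The normalized coefficients `λ_E(n) = a_E(n) / √n` of the Hasse–Weil `L`-function of `E`. -/
def lam (E : WeierstrassCurve ℚ) (n : ℕ) : ℂ :=
  (E.LFunction n : ℂ) / (Real.sqrt n : ℂ)

/-- Fundamental discriminants (including `1`). -/
def IsFundamentalDiscriminant (d : ℤ) : Prop :=
  (d % 4 = 1 ∧ Squarefree d) ∨ ∃ m : ℤ, d = 4 * m ∧ (m % 4 = 2 ∨ m % 4 = 3) ∧ Squarefree m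

/-- The Kronecker symbol `χ_d(n) = (d / n)` for `n ≥ 0`. -/
def kroneckerSym (d : ℤ) (n : ℕ) : ℤ :=
  if n = 0 then (if d.natAbs = 1 then 1 else 0)
  else ZMod.χ₈ (d : ZMod 8) ^ n.factorization 2 * jacobiSym d (n / 2 ^ n.factorization 2)

/-- The coefficients `λ_E(n) χ_d(n)` of `L(s, E_d)`. -/
def twistCoeff (E : WeierstrassCurve ℚ) (d : ℤ) (n : ℕ) : ℂ :=
  lam E n * (kroneckerSym d n : ℂ)

/-- `L(s, E_d) = ∑_{n ≥ 1} λ_E(n) χ_d(n) n^{-s}`. -/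
def twistedL (E : WeierstrassCurve ℚ) (d : ℤ) (s : ℂ) : ℂ :=
  LSeries (twistCoeff E d) s

/-- The positive fundamental discriminants coprime to `N`. -/
def Discriminants (N : ℕ) : Set ℕ :=
  {d | 0 < d ∧ IsFundamentalDiscriminant d ∧ d.Coprime N}

/-- The `d`-th term `χ_d(M) L(s_1, E_d) ⋯ L(s_k, E_d) d^{-w}` of the multiple Dirichlet series. -/
def mdsTerm (E : WeierstrassCurve ℚ) (M : ℕ) {k : ℕ} (s : Fin k → ℂ) (w : ℂ) (d : ℕ) : ℂ :=
  (kroneckerSym d M : ℂ) * (∏ j, twistedL E d (s j)) / (d : ℂ) ^ w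

/-- The multiple Dirichlet series `A_{E,M}(s_1, …, s_k; w)`. -/
def mds (E : WeierstrassCurve ℚ) (M : ℕ) {k : ℕ} (s : Fin k → ℂ) (w : ℂ) : ℂ :=
  ∑' d : Discriminants (ellConductor E), mdsTerm E M s w d

/-- `a(n) = ∏_{p ∣ n} p / (p + 1)`. -/
def aFactor (n : ℕ) : ℂ := ∏ p ∈ n.primeFactors, (p : ℂ) / ((p : ℂ) + 1)

/-- The tuples of positive integers `(n_1, …, n_k)` such that `M n_1 ⋯ n_k` is a square. -/
def SquareTuples (M k : ℕ) : Set (Fin k → ℕ) :=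
  {n | (∀ j, 0 < n j) ∧ IsSquare (M * ∏ j, n j)}

/-- The term of `H_{E,M}(S)` at `(n_1, …, n_k)`. -/
def residueTerm (E : WeierstrassCurve ℚ) (M : ℕ) {k : ℕ} (s : Fin k → ℂ) (n : Fin k → ℕ) : ℂ :=
  (∏ j, lam E (n j)) * aFactor (M * ellConductor E * ∏ j, n j) / ∏ j, (n j : ℂ) ^ s j

/-- `H_{E,M}(S)` for `S = {s_1, …, s_k}`. -/
def residueH (E : WeierstrassCurve ℚ) (M : ℕ) {k : ℕ} (s : Fin k → ℂ) : ℂ :=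
  1 / (2 * riemannZeta 2) * ∑' n : SquareTuples M k, residueTerm E M s n

/-- The region `Re w > 1/2`, `Re s_j > 5/4`. -/
def continuationRegion (k : ℕ) : Set ((Fin k → ℂ) × ℂ) :=
  {x | (∀ j, 5 / 4 < (x.1 j).re) ∧ 1 / 2 < x.2.re}

end EllipticTwists

end

open EllipticTwists Filter Topology

/-! Expand every `twistedL` and interchange sums where everything converges absolutely. Since the
Kronecker symbol is multiplicative below, the series becomes a sum over tuples (n_1, …, n_k) of ∏
λ_E(n_j) n_j^{-s_j} times D(w; n) = ∑_d χ_d(n) d^{-w}, with n = M n_1 ⋯ n_k (`mds_eq_tsum`). Three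
facts then suffice: ∑ |λ_E(n)| n^{-σ} converges for σ > 1; (w - 1) D(w; n) continues to Re w > 1/2
with a known value at w = 1; and it is O(n^{1/4 + ε}) there, locally uniformly in w. The last
explains 5/4 = 1 + 1/4: the growth in n uses up 1/4 of each Re s_j. Holomorphy in all variables
follows from normal convergence (`differentiableAt_tsum_of_summable_norm`).

Convergence of the L-series needs |a_p| ≤ C √p with any constant C. Stepanov's method gives this
(`abs_frobeniusTrace_le_sqrt`); the Euler product is then controlled in a submultiplicative weighted
ℓ¹ norm (`summable_natAbs_LFunction`).

For D(w; n), the discriminants are m, 4m or 8m with m odd and squarefree. For fixed n the map m ↦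
χ_m(n) is periodic, so with χ₄ detecting m mod 4 one gets Dirichlet characters ψ modulo 8Nn, without
reciprocity. The squarefree sum of ψ is L(w, ψ) / L(2w, ψ²), whose denominator is harmless for Re w
> 1/2. For ψ nontrivial no functional equation is needed: partial summation with |∑_{m ≤ t} ψ(m)| ≤
√(tB), the geometric mean of the trivial and the Pólya–Vinogradov bound B = O(q^{1/2 + ε}), gives
q^{1/4 + ε} (`norm_continuedL_le`). A pole arises only from a trivial ψ, that is, when n is a
square, and the three classes of d then add up to a(Nn) / (2ζ(2)) (`discSeries_one`). -/

namespace EllipticTwists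

/-! ### Stepanov's method for the equation `y ^ 2 = f x` with `f` a cubic -/

section Stepanov

open Polynomial

variable {K : Type*} [Field K]

/-- The operator `u ↦ a f' u + f u'`, which describes the derivative of `f ^ a * u`. -/
noncomputable def twistedDerivative (f : K[X]) (a : K) : K[X] →ₗ[K] K[X] :=
  LinearMap.mulLeft K (C a * derivative f) + LinearMap.mulLeft K f ∘ₗ derivative

/-- The iterated operator, which describes the `k`-th derivative of `f ^ a * u`. -/
noncomputable def twistedDerivativeIter (f : K[X]) (a : K) : ℕ → (K[X] →ₗ[K] K[X])
  | 0 => LinearMap.id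
  | k + 1 => twistedDerivative f (a - k) ∘ₗ twistedDerivativeIter f a k

/-- Each differentiation of f^b v pulls out f^{b-1} and leaves b f' v + f v'. High-order vanishing
thus reduces to the vanishing of cofactors of small degree. -/
lemma iterate_derivative_pow_mul (f u : K[X]) (n : ℕ) :
    ∀ k ≤ n, derivative^[k] (f ^ n * u) = f ^ (n - k) * twistedDerivativeIter f (n : K) k u := by
  intro k
  induction k with
  | zero => intro _; simp [twistedDerivativeIter]
  | succ k ih =>
    intro hk
    obtain ⟨t, rfl⟩ := Nat.exists_eq_add_of_le hk
    have e1 : k + 1 + t - k = t + 1 := by omega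
    have e2 : k + 1 + t - (k + 1) = t := by omega
    have e3 : ((k + 1 + t : ℕ) : K) - (k : K) = ((t + 1 : ℕ) : K) := by push_cast; ring
    rw [Function.iterate_succ_apply', ih (by omega), e1, e2, derivative_mul, derivative_pow_succ,
      twistedDerivativeIter, LinearMap.comp_apply, twistedDerivative, e3]
    simp only [LinearMap.add_apply, LinearMap.mulLeft_apply, LinearMap.comp_apply]
    push_cast
    simp only [map_add, map_one, map_natCast]
    ring

lemma degree_twistedDerivative_lt {f u : K[X]} {m n : ℕ} (hf : f.natDegree ≤ m + 1) (a : K)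
    (hu : u.degree < n) : (twistedDerivative f a u).degree < ((n + m : ℕ) : WithBot ℕ) := by
  rcases eq_or_ne u 0 with rfl | hu0
  · simp [twistedDerivative]
  have hu' : u.natDegree < n := (natDegree_lt_iff_degree_lt hu0).2 hu
  have key : (twistedDerivative f a u).natDegree ≤ u.natDegree + m := by
    simp only [twistedDerivative, LinearMap.add_apply, LinearMap.mulLeft_apply,
      LinearMap.comp_apply]
    refine (natDegree_add_le _ _).trans (max_le ?_ ?_)
    · refine natDegree_mul_le.trans ?_
      have h1 := natDegree_C_mul_le a (derivative f)
      have h2 := natDegree_derivative_le f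
      omega
    · rcases Nat.eq_zero_or_pos u.natDegree with h0 | h0
      · rw [eq_C_of_natDegree_eq_zero h0]; simp
      · refine natDegree_mul_le.trans ?_
        have h2 := natDegree_derivative_le u
        omega
  refine degree_le_natDegree.trans_lt ?_
  exact_mod_cast (by omega : (twistedDerivative f a u).natDegree < n + m)

lemma degree_twistedDerivativeIter_lt {f u : K[X]} {m n : ℕ} (hf : f.natDegree ≤ m + 1) (a : K)
    (hu : u.degree < n) (k : ℕ) :
    (twistedDerivativeIter f a k u).degree < ((n + k * m : ℕ) : WithBot ℕ) := by
  induction k with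
  | zero => simpa [twistedDerivativeIter] using hu
  | succ k ih =>
    have := degree_twistedDerivative_lt hf (a - k) ih
    rw [twistedDerivativeIter, LinearMap.comp_apply]
    convert this using 2
    ring

/-- In characteristic p the powers X^{jp} are constants for the derivation: they raise the degree of
the auxiliary polynomial at no cost. -/
lemma iterate_derivative_mul_X_pow_char {p : ℕ} [CharP K p] (u : K[X]) (j k : ℕ) :
    derivative^[k] (u * X ^ (j * p)) = derivative^[k] u * X ^ (j * p) := by
  induction k with
  | zero => rfl
  | succ k ih =>
    rw [Function.iterate_succ_apply', ih, Function.iterate_succ_apply', derivative_mul,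
      derivative_X_pow]
    simp

/-- Modulo X^p the relation says r_0 ≡ -f^h s_0. Squaring, multiplying by f and using f^p ≡ f(0)^p
gives r_0² f ≡ f(0)^p s_0², an equality because both degrees are below p. The left degree is odd and
the right one even, so r_0 = s_0 = 0; divide by X^p and induct on J. This is what makes the
auxiliary polynomial nonzero. -/
lemma eq_zero_of_sum_eq_zero {p : ℕ} [Fact p.Prime] [CharP K p] {f : K[X]} {h c : ℕ}
    (hp : p = 2 * h + 1) (hc : 2 * c + 1 < p) (hf : f.natDegree = 3) (hf0 : f.coeff 0 ≠ 0)
    (J : ℕ) : ∀ r s : ℕ → K[X], (∀ j, (r j).degree < c) → (∀ j, (s j).degree < c) →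
      ∑ j ∈ Finset.range J, (r j + f ^ h * s j) * X ^ (j * p) = 0 →
      ∀ j < J, r j = 0 ∧ s j = 0 := by
  induction J with
  | zero => intro r s _ _ _ j hj; omega
  | succ J ih =>
    intro r s hr hs hsum
    set U := ∑ j ∈ Finset.range J, r (j + 1) * X ^ (j * p)
    set V := ∑ j ∈ Finset.range J, s (j + 1) * X ^ (j * p)
    have hshift : ∑ j ∈ Finset.range J, (r (j + 1) + f ^ h * s (j + 1)) * X ^ (j * p)
        = U + f ^ h * V := by
      simp only [U, V, Finset.mul_sum, ← Finset.sum_add_distrib]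
      exact Finset.sum_congr rfl fun j _ => by ring
    have hsplit : (r 0 + X ^ p * U) + f ^ h * (s 0 + X ^ p * V) = 0 := by
      rw [← hsum, Finset.sum_range_succ']
      have : ∑ j ∈ Finset.range J, (r (j + 1) + f ^ h * s (j + 1)) * X ^ ((j + 1) * p)
          = X ^ p * (U + f ^ h * V) := by
        rw [← hshift, Finset.mul_sum]
        exact Finset.sum_congr rfl fun j _ => by ring
      rw [this]; ring
    have hsq : (r 0 + X ^ p * U) ^ 2 * f = f ^ p * (s 0 + X ^ p * V) ^ 2 := by
      rw [eq_neg_of_add_eq_zero_left hsplit, hp]; ring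
    obtain ⟨g, hg⟩ : ∃ g, f = C (f.coeff 0) + X * g :=
      ⟨f.divX, by rw [add_comm, mul_comm]; exact (divX_mul_X_add f).symm⟩
    have hfp : f ^ p = C (f.coeff 0) ^ p + X ^ p * g ^ p := by
      conv_lhs => rw [hg]
      rw [add_pow_char, mul_pow]
    have hdvd : X ^ p ∣ r 0 ^ 2 * f - C (f.coeff 0 ^ p) * s 0 ^ 2 := by
      refine ⟨f ^ p * (2 * s 0 * V + X ^ p * V ^ 2) + g ^ p * s 0 ^ 2
        - (2 * r 0 * U + X ^ p * U ^ 2) * f, ?_⟩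
      have : C (f.coeff 0 ^ p) = f ^ p - X ^ p * g ^ p := by rw [hfp, C_pow]; ring
      rw [this]
      linear_combination hsq
    have hdeg : (r 0 ^ 2 * f - C (f.coeff 0 ^ p) * s 0 ^ 2).degree < (p : WithBot ℕ) := by
      have hrn : r 0 = 0 ∨ (r 0).natDegree < c := by
        rcases eq_or_ne (r 0) 0 with h | h
        · exact Or.inl h
        · exact Or.inr ((natDegree_lt_iff_degree_lt h).2 (hr 0))
      have hsn : s 0 = 0 ∨ (s 0).natDegree < c := by
        rcases eq_or_ne (s 0) 0 with h | h
        · exact Or.inl h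
        · exact Or.inr ((natDegree_lt_iff_degree_lt h).2 (hs 0))
      have h1 : (r 0 ^ 2 * f).natDegree < p := by
        rcases hrn with h | h
        · rw [h]; simp; omega
        · refine natDegree_mul_le.trans_lt ?_
          have := natDegree_pow_le (p := r 0) (n := 2)
          omega
      have h2 : (C (f.coeff 0 ^ p) * s 0 ^ 2).natDegree < p := by
        rcases hsn with h | h
        · rw [h]; simp; omega
        · refine (natDegree_C_mul_le _ _).trans_lt ?_
          have := natDegree_pow_le (p := s 0) (n := 2)
          omega
      refine degree_le_natDegree.trans_lt ?_
      exact_mod_cast (natDegree_sub_le _ _).trans_lt (max_lt h1 h2)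
    have hzero : r 0 ^ 2 * f - C (f.coeff 0 ^ p) * s 0 ^ 2 = 0 := by
      by_contra hne
      have := degree_le_of_dvd hdvd hne
      rw [degree_X_pow] at this
      exact absurd hdeg (not_lt.2 this)
    have hc0 : C (f.coeff 0 ^ p) ≠ 0 := by simpa using pow_ne_zero p hf0
    have hf1 : f ≠ 0 := by rintro rfl; simp at hf0
    have hr0 : r 0 = 0 := by
      by_contra hr0
      have heq := sub_eq_zero.1 hzero
      have hs0 : s 0 ≠ 0 := by
        intro h
        rw [h] at heq
        simp [hr0, hf1] at heq
      have := congrArg natDegree heq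
      rw [natDegree_mul (pow_ne_zero 2 hr0) hf1, natDegree_mul hc0 (pow_ne_zero 2 hs0),
        natDegree_pow, natDegree_pow, natDegree_C, hf] at this
      omega
    have hs0 : s 0 = 0 := by
      rw [hr0] at hzero
      simpa [hf0] using hzero
    have hUV : U + f ^ h * V = 0 := by
      rw [hr0, hs0] at hsplit
      have : X ^ p * (U + f ^ h * V) = 0 := by rw [← hsplit]; ring
      exact (mul_eq_zero.1 this).resolve_left (pow_ne_zero _ X_ne_zero)
    have := ih (fun j => r (j + 1)) (fun j => s (j + 1)) (fun j => hr _) (fun j => hs _)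
      (by rw [hshift]; exact hUV)
    rintro (_ | j) hj
    · exact ⟨hr0, hs0⟩
    · exact this j (by omega)

/-- The auxiliary polynomials of Stepanov's method, constructed by counting dimensions. -/
lemma exists_auxiliary_polynomials {f : K[X]} (hf : f.natDegree = 3) (a : K) (h : ℕ)
    {c J l : ℕ} (hdim : l * (c + J + 2 * l) < 2 * c * J) :
    ∃ r s : ℕ → K[X], (∀ j, (r j).degree < c) ∧ (∀ j, (s j).degree < c) ∧
      (∃ j < J, r j ≠ 0 ∨ s j ≠ 0) ∧
      ∀ k < l, ∑ j ∈ Finset.range J, (twistedDerivativeIter f (l : K) k (r j) +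
        C a * twistedDerivativeIter f ((l + h : ℕ) : K) k (s j)) * X ^ j = 0 := by
  classical
  let pol : (Fin c → K) →ₗ[K] K[X] :=
    (degreeLT K c).subtype ∘ₗ (degreeLTEquiv K c).symm.toLinearMap
  have hpol : ∀ v, (pol v).degree < c := fun v =>
    mem_degreeLT.1 ((degreeLTEquiv K c).symm v).2
  have hpol0 : ∀ v, pol v = 0 → v = 0 := by
    intro v hv
    simpa [pol] using hv
  let T : ℕ → (Fin J × Bool → Fin c → K) →ₗ[K] K[X] := fun k =>
    ∑ j : Fin J, LinearMap.mulRight K (X ^ (j : ℕ)) ∘ₗ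
      (twistedDerivativeIter f (l : K) k ∘ₗ pol ∘ₗ LinearMap.proj (j, false) +
        LinearMap.mulLeft K (C a) ∘ₗ
          twistedDerivativeIter f ((l + h : ℕ) : K) k ∘ₗ pol ∘ₗ LinearMap.proj (j, true))
  -- There are 2cJ unknown coefficients. Each of the l conditions concerns a polynomial of degree
  -- below c + J + 2l, since a twisted derivative of a cubic raises the degree by at most 2.
  let Φ : (Fin J × Bool → Fin c → K) →ₗ[K] (Fin l × Fin (c + J + 2 * l) → K) :=
    LinearMap.pi fun ki => lcoeff K (ki.2 : ℕ) ∘ₗ T ki.1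
  have hker : LinearMap.ker Φ ≠ ⊥ := by
    apply LinearMap.ker_ne_bot_of_finrank_lt
    rw [Module.finrank_fintype_fun_eq_card, Module.finrank_pi_fintype]
    simp only [Module.finrank_fintype_fun_eq_card, Fintype.card_fin, Finset.sum_const,
      Finset.card_univ, Fintype.card_prod, Fintype.card_bool, smul_eq_mul]
    linarith [hdim, show J * 2 * c = 2 * c * J by ring]
  obtain ⟨v, hv, hv0⟩ := (Submodule.ne_bot_iff _).1 hker
  let r : ℕ → K[X] := fun j => if hj : j < J then pol (v (⟨j, hj⟩, false)) else 0
  let s : ℕ → K[X] := fun j => if hj : j < J then pol (v (⟨j, hj⟩, true)) else 0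
  have hr : ∀ j, (r j).degree < c := by
    intro j
    simp only [r]
    split_ifs
    · exact hpol _
    · simp
  have hs : ∀ j, (s j).degree < c := by
    intro j
    simp only [s]
    split_ifs
    · exact hpol _
    · simp
  refine ⟨r, s, hr, hs, ?_, ?_⟩
  · by_contra hcon
    push Not at hcon
    apply hv0
    funext ⟨j, b⟩
    obtain ⟨h1, h2⟩ := hcon j j.2
    cases b
    · exact hpol0 _ (by simpa [r] using h1)
    · exact hpol0 _ (by simpa [s] using h2)
  · intro k hk
    have hT : ∑ j ∈ Finset.range J, (twistedDerivativeIter f (l : K) k (r j) +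
        C a * twistedDerivativeIter f ((l + h : ℕ) : K) k (s j)) * X ^ j = T k v := by
      rw [Finset.sum_range]
      simp [T, r, s]
    ext i
    rw [coeff_zero]
    by_cases hi : i < c + J + 2 * l
    · have := congrFun (LinearMap.mem_ker.1 hv) (⟨k, hk⟩, ⟨i, hi⟩)
      rw [hT]
      simpa [Φ] using this
    · apply coeff_eq_zero_of_degree_lt
      refine lt_of_lt_of_le (b := ((c + J + 2 * l : ℕ) : WithBot ℕ)) ?_
        (by exact_mod_cast not_lt.1 hi)
      rw [← mem_degreeLT]
      refine Submodule.sum_mem _ fun j hj => ?_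
      rw [mem_degreeLT]
      have hb : ∀ u : K[X], ∀ b : K, u.degree < c →
          (twistedDerivativeIter f b k u).degree < ((c + 2 * l : ℕ) : WithBot ℕ) := fun u b hu =>
        (degree_twistedDerivativeIter_lt (m := 2) hf.le b hu k).trans_le
          (by exact_mod_cast (by omega))
      have hq : (twistedDerivativeIter f (l : K) k (r j) +
          C a * twistedDerivativeIter f ((l + h : ℕ) : K) k (s j)).degree
            < ((c + 2 * l : ℕ) : WithBot ℕ) := by
        refine (degree_add_le _ _).trans_lt (max_lt (hb _ _ (hr j)) ?_)
        rw [← smul_eq_C_mul]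
        exact (degree_smul_le _ _).trans_lt (hb _ _ (hs j))
      rcases eq_or_ne (twistedDerivativeIter f (l : K) k (r j) +
          C a * twistedDerivativeIter f ((l + h : ℕ) : K) k (s j)) 0 with h0 | h0
      · rw [h0, zero_mul, degree_zero]
        exact WithBot.bot_lt_coe _
      · have h1 := (natDegree_lt_iff_degree_lt h0).2 hq
        refine degree_le_natDegree.trans_lt ?_
        rw [natDegree_mul_X_pow j h0]
        have := Finset.mem_range.1 hj
        exact_mod_cast (by omega)

-- At a counted x with f(x) ≠ 0, the relations x^p = x and f(x)^h = a turn the k-th derivative of P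
-- into f(x)^{l-k} times a polynomial that was made to vanish; at zeros of f the prefactor itself
-- vanishes, as k < l. So each such x is a root of multiplicity at least l, and the degree of P
-- bounds their number.
open Classical in
lemma stepanov_count [Fintype K] {p : ℕ} [Fact p.Prime] [CharP K p] (hcard : Fintype.card K = p)
    {f : K[X]} {h c J l : ℕ} (hp : p = 2 * h + 1) (hc : 2 * c + 1 < p) (hl : l ≤ p)
    (hf : f.natDegree = 3) (hf0 : f.coeff 0 ≠ 0) (hdim : l * (c + J + 2 * l) < 2 * c * J) (a : K) :
    l * (Finset.univ.filter fun x : K => f.eval x ^ h = a ∨ f.eval x = 0).card ≤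
      3 * l + 3 * h + c + (J - 1) * p := by
  set S := Finset.univ.filter fun x : K => f.eval x ^ h = a ∨ f.eval x = 0 with hS
  obtain ⟨r, s, hr, hs, ⟨j₀, hj₀, hne⟩, hzero⟩ := exists_auxiliary_polynomials hf a h hdim
  have hf1 : f ≠ 0 := by rintro rfl; simp at hf0
  set P : K[X] := ∑ j ∈ Finset.range J, (f ^ l * r j + f ^ (l + h) * s j) * X ^ (j * p) with hP
  have hP0 : P ≠ 0 := by
    intro hP0
    have : f ^ l * ∑ j ∈ Finset.range J, (r j + f ^ h * s j) * X ^ (j * p) = 0 := by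
      rw [← hP0, hP, Finset.mul_sum]
      exact Finset.sum_congr rfl fun j _ => by ring
    have h2 := (mul_eq_zero.1 this).resolve_left (pow_ne_zero _ hf1)
    obtain ⟨h3, h4⟩ := eq_zero_of_sum_eq_zero hp hc hf hf0 J r s hr hs h2 j₀ hj₀
    exact hne.elim (absurd h3) (absurd h4)
  have hroot : ∀ x ∈ S, ∀ k < l, (derivative^[k] P).IsRoot x := by
    intro x hx k hk
    have hxp : ∀ j : ℕ, x ^ (j * p) = x ^ j := by
      intro j
      rw [mul_comm, pow_mul, ← hcard, FiniteField.pow_card]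
    have hz := congrArg (eval x) (hzero k hk)
    simp only [eval_finsetSum, eval_mul, eval_add, eval_C, eval_pow, eval_X, eval_zero] at hz
    rw [IsRoot.def, hP, iterate_derivative_sum, eval_finsetSum]
    have hterm : ∀ j ∈ Finset.range J,
        eval x (derivative^[k] ((f ^ l * r j + f ^ (l + h) * s j) * X ^ (j * p))) =
        eval x f ^ (l - k) * ((eval x (twistedDerivativeIter f (l : K) k (r j)) +
          a * eval x (twistedDerivativeIter f ((l + h : ℕ) : K) k (s j))) * x ^ j) := by
      intro j _
      rw [iterate_derivative_mul_X_pow_char, iterate_map_add derivative,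
        iterate_derivative_pow_mul _ _ _ k hk.le, iterate_derivative_pow_mul _ _ _ k (by omega),
        show l + h - k = (l - k) + h by omega]
      simp only [eval_mul, eval_add, eval_pow, eval_X, hxp, pow_add]
      rcases (Finset.mem_filter.1 hx).2 with hx | hx
      · rw [hx]; ring
      · rw [hx, zero_pow (by omega : l - k ≠ 0)]; ring
    rw [Finset.sum_congr rfl hterm, ← Finset.mul_sum, hz, mul_zero]
  have hmult : ∀ x ∈ S, l ≤ P.rootMultiplicity x := by
    intro x hx
    rcases Nat.eq_zero_or_pos l with h0 | h0
    · omega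
    · have : l - 1 < P.rootMultiplicity x := by
        apply lt_rootMultiplicity_of_isRoot_iterate_derivative_of_mem_nonZeroDivisors hP0
        · intro m hm
          exact hroot x hx m (by omega)
        -- Derivatives detect multiplicity l only if (l - 1)! is nonzero in K, which is where l ≤ p
        -- enters.
        · apply mem_nonZeroDivisors_of_ne_zero
          rw [Ne, CharP.cast_eq_zero_iff K p, (Fact.out : p.Prime).dvd_factorial]
          omega
      omega
  have hcount : l * S.card ≤ P.natDegree := by
    calc l * S.card = ∑ x ∈ S, l := by rw [Finset.sum_const, smul_eq_mul, mul_comm]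
      _ ≤ ∑ x ∈ S, P.roots.count x := Finset.sum_le_sum fun x hx => by
          rw [count_roots]; exact hmult x hx
      _ ≤ ∑ x, P.roots.count x := Finset.sum_le_univ_sum_of_nonneg fun _ => Nat.zero_le _
      _ = Multiset.card P.roots := Multiset.sum_count_eq_card fun x _ => Finset.mem_univ x
      _ ≤ P.natDegree := card_roots' P
  refine hcount.trans ?_
  have hnd : ∀ u : K[X], u.degree < c → u.natDegree ≤ c := by
    intro u hu
    rcases eq_or_ne u 0 with rfl | h0
    · simp
    · exact ((natDegree_lt_iff_degree_lt h0).2 hu).le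
  rw [hP]
  refine natDegree_sum_le_of_forall_le _ _ fun j hj => ?_
  have hfn : ∀ n, (f ^ n).natDegree ≤ n * 3 := fun n => by
    have := natDegree_pow_le (p := f) (n := n); rwa [hf] at this
  refine natDegree_mul_le.trans ?_
  rw [natDegree_X_pow]
  have hj' : j * p ≤ (J - 1) * p := Nat.mul_le_mul_right _ (by have := Finset.mem_range.1 hj; omega)
  have h1 : (f ^ l * r j + f ^ (l + h) * s j).natDegree ≤ 3 * l + 3 * h + c := by
    refine (natDegree_add_le _ _).trans (max_le ?_ ?_)
    · refine natDegree_mul_le.trans ?_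
      have := hfn l; have := hnd _ (hr j); omega
    · refine natDegree_mul_le.trans ?_
      have := hfn (l + h); have := hnd _ (hs j); omega
  omega

open Classical in
/-- Stepanov's bound for the number of points on one half of the curve `y ^ 2 = f x`. -/
lemma card_filter_pow_eq_le [Fintype K] {p : ℕ} [Fact p.Prime] [CharP K p]
    (hcard : Fintype.card K = p) {f : K[X]} {h : ℕ} (hp : p = 2 * h + 1) (hp' : 400 ≤ p)
    (hf : f.natDegree = 3) (a : K) :
    ((Finset.univ.filter fun x : K => f.eval x ^ h = a ∨ f.eval x = 0).card : ℝ) ≤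
      p / 2 + 10 * √p + 3 := by
  -- A cubic cannot vanish at all p > 3 points; translating by t arranges a nonzero constant
  -- coefficient.
  obtain ⟨t, ht⟩ : ∃ t : K, f.eval t ≠ 0 := by
    by_contra hcon
    push Not at hcon
    have hf1 : f ≠ 0 := by rintro rfl; simp at hf
    have h1 : (Finset.univ : Finset K).card ≤ f.natDegree := by
      refine (Finset.card_le_card (t := f.roots.toFinset) fun x _ => ?_).trans
        ((Multiset.toFinset_card_le _).trans (card_roots' f))
      simp [hf1, hcon x]
    rw [Finset.card_univ, hcard, hf] at h1
    omega
  have hcomp : (f.comp (X + C t)).natDegree = 3 := by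
    rw [natDegree_comp, natDegree_X_add_C, hf]
  have hcomp0 : (f.comp (X + C t)).coeff 0 ≠ 0 := by
    rw [coeff_zero_eq_eval_zero, eval_comp]; simpa using ht
  set l := p.sqrt with hl
  have hl1 : l * l ≤ p := Nat.sqrt_le p
  have hl2 : p < (l + 1) * (l + 1) := Nat.lt_succ_sqrt p
  have hl20 : 20 ≤ l := by
    by_contra hcon
    have : (l + 1) * (l + 1) ≤ 20 * 20 := Nat.mul_le_mul (by omega) (by omega)
    omega
  -- With J = l/2 the main terms l c and 2cJ of the dimension count cancel; the surplus 8 pays for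
  -- l(J + 2l), which is of order p because l ≈ √p. The choice c = h - 1 is the largest with 2c + 1
  -- < p.
  set J := l / 2 + 8 with hJ
  have hcount := stepanov_count hcard (f := f.comp (X + C t)) (h := h) (c := h - 1) (J := J)
    (l := l) hp (by omega) (by nlinarith) hcomp hcomp0 (by
      obtain ⟨c, rfl⟩ : ∃ c, h = c + 1 := ⟨h - 1, by omega⟩
      simp only [Nat.add_sub_cancel]
      have h1 : l + 15 ≤ 2 * J := by omega
      have h2 : 2 * J ≤ l + 16 := by omega
      nlinarith) a
  have hbij : (Finset.univ.filter fun x : K => (f.comp (X + C t)).eval x ^ h = a ∨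
      (f.comp (X + C t)).eval x = 0).card =
      (Finset.univ.filter fun x : K => f.eval x ^ h = a ∨ f.eval x = 0).card := by
    refine Finset.card_bij (fun x _ => x + t) ?_ ?_ ?_
    · intro x hx; simpa [eval_comp] using hx
    · intro x _ y _ hxy; simpa using hxy
    · intro y hy
      exact ⟨y - t, by simpa [eval_comp] using hy, by simp⟩
  rw [hbij] at hcount
  set n := (Finset.univ.filter fun x : K => f.eval x ^ h = a ∨ f.eval x = 0).card
  have hlr : √(p : ℝ) ≤ l + 1 := by
    rw [Real.sqrt_le_left (by positivity)]
    exact_mod_cast (by nlinarith : p ≤ (l + 1) ^ 2)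
  have hsq : √(p : ℝ) * √p = p := Real.mul_self_sqrt (by positivity)
  have hs20 : 20 ≤ √(p : ℝ) := by
    rw [Real.le_sqrt (by norm_num) (by positivity)]
    norm_num
    exact_mod_cast hp'
  have hcr : (l : ℝ) * n ≤ 3 * l + 9 * p + l * p / 2 := by
    have h1 : 2 * (l * n) ≤ 2 * (3 * l) + 18 * p + l * p := by
      have h2 : 2 * (J - 1) ≤ l + 14 := by omega
      have h3 : 2 * (J - 1) * p ≤ (l + 14) * p := Nat.mul_le_mul_right _ h2
      have h4 : 2 * (3 * h + (h - 1)) ≤ 4 * p := by omega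
      nlinarith
    have h5 : (2 * (l * n) : ℝ) ≤ 2 * (3 * l) + 18 * p + l * p := by exact_mod_cast h1
    linarith
  have hl0 : (0 : ℝ) < l := by exact_mod_cast (by omega : 0 < l)
  have key : (9 : ℝ) * p ≤ l * (10 * √p) := by
    have h6 : (9 : ℝ) * √p ≤ l * 10 := by linarith
    have h7 := mul_le_mul_of_nonneg_right h6 (Real.sqrt_nonneg (p : ℝ))
    linarith
  refine le_of_mul_le_mul_left ?_ hl0
  linarith

end Stepanov

end EllipticTwists

namespace EllipticTwists

/-! ### Point counts over prime fields -/

section PointCount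

open Polynomial

variable {K : Type*} [Field K] [Fintype K]

open Classical in
lemma natCard_point_eq (W : WeierstrassCurve K) [W.IsElliptic] :
    (Nat.card W.toAffine.Point : ℤ) =
      1 + ∑ x : K, ((Finset.univ.filter fun y : K => W.toAffine.Equation x y).card : ℤ) := by
  rw [Nat.card_congr W.toAffine.pointEquiv]
  have h1 : Nat.card (WithZero {xy : K × K // W.toAffine.Equation xy.1 xy.2}) =
      Nat.card {xy : K × K // W.toAffine.Equation xy.1 xy.2} + 1 := Finite.card_option
  rw [h1, Nat.card_eq_fintype_card, Fintype.card_subtype, Finset.card_filter,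
    Fintype.sum_prod_type]
  simp only [Finset.card_filter]
  push_cast
  ring

open Classical in
lemma card_filter_equation_le (W : WeierstrassCurve K) (x : K) :
    (Finset.univ.filter fun y : K => W.toAffine.Equation x y).card ≤ 2 := by
  set P : K[X] := X ^ 2 + C (W.a₁ * x + W.a₃) * X +
    C (-(x ^ 3 + W.a₂ * x ^ 2 + W.a₄ * x + W.a₆)) with hP
  have hdeg : P.natDegree = 2 := by
    have := natDegree_quadratic (a := (1 : K)) (b := W.a₁ * x + W.a₃)
      (c := -(x ^ 3 + W.a₂ * x ^ 2 + W.a₄ * x + W.a₆)) one_ne_zero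
    rwa [C_1, one_mul] at this
  have hP0 : P ≠ 0 := by rintro h; rw [h] at hdeg; simp at hdeg
  refine (Finset.card_le_card (t := P.roots.toFinset) fun y hy => ?_).trans
    ((Multiset.toFinset_card_le _).trans ((card_roots' P).trans hdeg.le))
  have hy' := (W.toAffine.equation_iff' x y).1 (Finset.mem_filter.1 hy).2
  rw [Multiset.mem_toFinset, mem_roots hP0, IsRoot.def, hP]
  simp only [eval_add, eval_mul, eval_pow, eval_X, eval_C]
  linear_combination hy'

/-- The trace of Frobenius `q + 1 - |W(K)|`. -/
noncomputable def frobeniusTrace (W : WeierstrassCurve K) : ℤ :=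
  Nat.card K + 1 - Nat.card W.toAffine.Point

lemma abs_frobeniusTrace_le_card (W : WeierstrassCurve K) [W.IsElliptic] :
    |frobeniusTrace W| ≤ Nat.card K := by
  classical
  rw [frobeniusTrace, natCard_point_eq]
  have h1 : ∑ x : K, ((Finset.univ.filter fun y : K => W.toAffine.Equation x y).card : ℤ) ≤
      ∑ _x : K, 2 := Finset.sum_le_sum fun x _ => by exact_mod_cast card_filter_equation_le W x
  have h2 : 0 ≤ ∑ x : K, ((Finset.univ.filter fun y : K => W.toAffine.Equation x y).card : ℤ) :=
    Finset.sum_nonneg fun x _ => by positivity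
  rw [Finset.sum_const, Finset.card_univ, nsmul_eq_mul] at h1
  rw [Nat.card_eq_fintype_card, abs_le]
  constructor <;> linarith

/-- The cubic `4 X ^ 3 + b₂ X ^ 2 + 2 b₄ X + b₆`. -/
noncomputable def twoTorsionCubic (W : WeierstrassCurve K) : K[X] :=
  C 4 * X ^ 3 + C W.b₂ * X ^ 2 + C (2 * W.b₄) * X + C W.b₆

/-- Completing the square by z = 2y + a₁x + a₃ turns the equation into z² = 4x³ + b₂x² + 2b₄x + b₆,
and an element u has 1 + χ(u) square roots. -/
lemma frobeniusTrace_eq_sum [DecidableEq K] (W : WeierstrassCurve K) [W.IsElliptic]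
    (h2 : ringChar K ≠ 2) :
    frobeniusTrace W = - ∑ x : K, quadraticChar K ((twoTorsionCubic W).eval x) := by
  classical
  have h20 : (2 : K) ≠ 0 := Ring.two_ne_zero h2
  rw [frobeniusTrace, natCard_point_eq]
  have hx : ∀ x : K, ((Finset.univ.filter fun y : K => W.toAffine.Equation x y).card : ℤ) =
      quadraticChar K ((twoTorsionCubic W).eval x) + 1 := by
    intro x
    rw [← quadraticChar_card_sqrts h2]
    congr 1
    refine Finset.card_bij (fun y _ => 2 * y + W.a₁ * x + W.a₃) ?_ ?_ ?_
    · intro y hy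
      have hy' := (W.toAffine.equation_iff x y).1 (Finset.mem_filter.1 hy).2
      simp only [Set.mem_toFinset, Set.mem_ofPred_eq, twoTorsionCubic, eval_add, eval_mul,
        eval_pow, eval_X, eval_C, WeierstrassCurve.b₂, WeierstrassCurve.b₄, WeierstrassCurve.b₆]
      linear_combination 4 * hy'
    · intro y _ y' _ h
      have : (2 : K) * y = 2 * y' := by linear_combination h
      exact mul_left_cancel₀ h20 this
    · intro z hz
      refine ⟨(z - W.a₁ * x - W.a₃) / 2, ?_, by field_simp; ring⟩
      simp only [Set.mem_toFinset, Set.mem_ofPred_eq, twoTorsionCubic, eval_add, eval_mul,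
        eval_pow, eval_X, eval_C, WeierstrassCurve.b₂, WeierstrassCurve.b₄,
        WeierstrassCurve.b₆] at hz
      rw [Finset.mem_filter, W.toAffine.equation_iff]
      refine ⟨Finset.mem_univ _, ?_⟩
      have h4 : (4 : K) ≠ 0 := by
        have : (4 : K) = 2 * 2 := by norm_num
        rw [this]; exact mul_ne_zero h20 h20
      apply mul_left_cancel₀ h4
      have hz2 : ∀ t : K, 2 * (t / 2) = t := fun t => by field_simp
      have e1 := hz2 (z - W.a₁ * x - W.a₃)
      linear_combination hz + (2 * ((z - W.a₁ * x - W.a₃) / 2) + (z - W.a₁ * x - W.a₃)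
        + 2 * (W.a₁ * x + W.a₃)) * e1
  simp only [hx, Finset.sum_add_distrib, Finset.sum_const, Finset.card_univ,
    Nat.card_eq_fintype_card]
  ring

/-- By Euler's criterion e χ(f(x)) ≤ 2·1_S(x) - 1 for each sign e, where S consists of the x with
f(x)^h = e or f(x) = 0. Stepanov's upper bound for both signs therefore bounds the sum from both
sides. -/
lemma abs_sum_quadraticChar_le [DecidableEq K] {p : ℕ} [Fact p.Prime] (hcard : Fintype.card K = p)
    (hp : 400 ≤ p) {f : K[X]} (hf : f.natDegree = 3) :
    |(∑ x : K, quadraticChar K (f.eval x) : ℤ)| ≤ (20 * √p + 6 : ℝ) := by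
  classical
  have hpp : p.Prime := Fact.out
  have : CharP K p := by
    obtain ⟨n, hn, hn'⟩ := FiniteField.card K (ringChar K)
    have h1 : ringChar K ∣ p := by
      rw [← hcard, hn']; exact dvd_pow_self _ n.pos.ne'
    rw [← (Nat.prime_dvd_prime_iff_eq hn hpp).1 h1]
    infer_instance
  have hchar : ringChar K = p := ringChar.eq K p ▸ rfl
  have h2 : ringChar K ≠ 2 := by omega
  obtain ⟨h, hh⟩ := hpp.odd_of_ne_two (by omega)
  have hdiv : Fintype.card K / 2 = h := by omega
  have hS : ∀ a : K, ((Finset.univ.filter fun x : K => f.eval x ^ h = a ∨ f.eval x = 0).card : ℝ)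
      ≤ p / 2 + 10 * √p + 3 := fun a => by
    convert card_filter_pow_eq_le hcard hh hp hf a
  have key : ∀ (e : ℤ) (a : K), (e : K) = a → (e = 1 ∨ e = -1) →
      (∑ x : K, e * quadraticChar K (f.eval x) : ℤ) ≤
      2 * ((Finset.univ.filter fun x : K => f.eval x ^ h = a ∨ f.eval x = 0).card : ℤ) - p := by
    intro e a hea he
    have : 2 * ((Finset.univ.filter fun x : K => f.eval x ^ h = a ∨ f.eval x = 0).card : ℤ) - p =
        ∑ x : K, (2 * (if f.eval x ^ h = a ∨ f.eval x = 0 then 1 else 0) - 1 : ℤ) := by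
      rw [Finset.sum_sub_distrib, ← Finset.mul_sum, Finset.sum_boole, Finset.sum_const,
        Finset.card_univ, hcard]
      simp
    rw [this]
    refine Finset.sum_le_sum fun x _ => ?_
    by_cases hx0 : f.eval x = 0
    · simp [hx0]
    · have hq := quadraticChar_dichotomy hx0
      have hpow := quadraticChar_eq_pow_of_char_ne_two' h2 (f.eval x)
      rw [hdiv] at hpow
      by_cases hxa : f.eval x ^ h = a
      · simp only [hxa, true_or, if_true]
        rcases he with rfl | rfl <;> rcases hq with hq | hq <;> rw [hq] <;> norm_num
      · simp only [hxa, hx0, or_self, if_false]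
        have hne : quadraticChar K (f.eval x) ≠ e := by
          intro heq
          rw [heq, hea] at hpow
          exact hxa hpow.symm
        rcases he with rfl | rfl <;> rcases hq with hq | hq <;> rw [hq] at hne ⊢ <;>
          first | exact absurd rfl hne | norm_num
  have k1 := key 1 1 (by simp) (Or.inl rfl)
  have k2 := key (-1) (-1) (by simp) (Or.inr rfl)
  simp only [one_mul, neg_mul, Finset.sum_neg_distrib] at k1 k2
  set T := ∑ x : K, quadraticChar K (f.eval x)
  have k1' : (T : ℝ) ≤ 2 * ((Finset.univ.filter fun x : K => f.eval x ^ h = 1 ∨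
    f.eval x = 0).card : ℝ) - p := by exact_mod_cast k1
  have k2' : -(T : ℝ) ≤ 2 * ((Finset.univ.filter fun x : K => f.eval x ^ h = -1 ∨
    f.eval x = 0).card : ℝ) - p := by exact_mod_cast k2
  rw [Int.cast_abs, abs_le]
  constructor
  · linarith [hS (-1)]
  · linarith [hS 1]

/-- The Hasse bound for curves over prime fields, with a weaker constant. -/
lemma abs_frobeniusTrace_le_sqrt {p : ℕ} [Fact p.Prime] (hcard : Nat.card K = p)
    (W : WeierstrassCurve K) [W.IsElliptic] : (|frobeniusTrace W| : ℝ) ≤ 21 * √p := by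
  classical
  have hsq : √(p : ℝ) * √p = p := Real.mul_self_sqrt (by positivity)
  -- For p < 400 the trivial bound gives p ≤ 20√p; for p ≥ 400 one has 20√p + 6 ≤ 21√p.
  rcases lt_or_ge p 400 with hp | hp
  · have h1 : (|frobeniusTrace W| : ℝ) ≤ p := by
      rw [← hcard]; exact_mod_cast abs_frobeniusTrace_le_card W
    have h2 : √(p : ℝ) ≤ 20 := by
      rw [Real.sqrt_le_left (by norm_num)]
      norm_num
      exact_mod_cast hp.le
    nlinarith [Real.sqrt_nonneg (p : ℝ)]
  · have hcard' : Fintype.card K = p := by rw [← Nat.card_eq_fintype_card, hcard]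
    have hodd : ringChar K ≠ 2 := by
      intro h
      have := FiniteField.even_card_of_char_two (F := K) h
      have h3 := (Fact.out : p.Prime).eq_two_or_odd
      omega
    have h20 : (2 : K) ≠ 0 := Ring.two_ne_zero hodd
    have hdeg : (twoTorsionCubic W).natDegree = 3 := by
      apply natDegree_cubic
      have : (4 : K) = 2 * 2 := by norm_num
      rw [this]; exact mul_ne_zero h20 h20
    have h1 := abs_sum_quadraticChar_le hcard' hp hdeg
    have h2 : 20 ≤ √(p : ℝ) := by
      rw [Real.le_sqrt (by norm_num) (by positivity)]
      norm_num
      exact_mod_cast hp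
    rw [frobeniusTrace_eq_sum W hodd]
    push_cast at h1 ⊢
    rw [abs_neg]
    linarith

end PointCount

/-! ### Local Euler factors -/

section LocalFactor

open Polynomial

/-- The coefficients of the inverse of `1 - a T + b T ^ 2` satisfy a linear recurrence. -/
lemma coeff_invOfUnit_quadratic (a b : ℤ) {P : ℤ[X]} (hP : P = 1 - C a * X + C b * X ^ 2) :
    let c := fun k => PowerSeries.coeff k (PowerSeries.invOfUnit (P : PowerSeries ℤ) 1)
    c 0 = 1 ∧ c 1 = a ∧ ∀ k, c (k + 2) = a * c (k + 1) - b * c k := by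
  intro c
  set Q := PowerSeries.invOfUnit (P : PowerSeries ℤ) 1 with hQ
  have hmul : (P : PowerSeries ℤ) * Q = 1 := by
    rw [hQ]
    apply PowerSeries.mul_invOfUnit
    simp [hP]
  have hPps : (P : PowerSeries ℤ) = 1 - PowerSeries.C a * PowerSeries.X +
      PowerSeries.C b * PowerSeries.X ^ 2 := by
    rw [hP, Polynomial.coe_add, Polynomial.coe_sub, Polynomial.coe_mul, Polynomial.coe_mul,
      Polynomial.coe_pow, Polynomial.coe_C, Polynomial.coe_C, Polynomial.coe_X, Polynomial.coe_one]
  have hexp : Q - PowerSeries.C a * (PowerSeries.X * Q)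
      + PowerSeries.C b * (PowerSeries.X ^ 2 * Q) = 1 := by
    rw [← hmul, hPps]; ring
  have h0 : c 0 = 1 := by
    have := congrArg (PowerSeries.coeff 0) hexp
    simpa [c, PowerSeries.coeff_zero_eq_constantCoeff, ← hQ] using this
  have h1 : c 1 = a := by
    have := congrArg (PowerSeries.coeff 1) hexp
    rw [map_add, map_sub, PowerSeries.coeff_C_mul, PowerSeries.coeff_C_mul,
      show (1 : ℕ) = 0 + 1 from rfl, PowerSeries.coeff_succ_X_mul,
      PowerSeries.coeff_X_pow_mul', PowerSeries.coeff_one] at this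
    change c 1 - a * c 0 + _ = _ at this
    rw [h0] at this
    simp at this
    linarith
  refine ⟨h0, h1, fun k => ?_⟩
  have := congrArg (PowerSeries.coeff (k + 2)) hexp
  rw [map_add, map_sub, PowerSeries.coeff_C_mul, PowerSeries.coeff_C_mul,
    PowerSeries.coeff_succ_X_mul, PowerSeries.coeff_X_pow_mul, PowerSeries.coeff_one] at this
  change c (k + 2) - a * c (k + 1) + b * c k = _ at this
  simp at this
  linarith

lemma abs_le_pow_of_recurrence {a b : ℤ} {c : ℕ → ℤ} {r : ℝ} (h0 : c 0 = 1) (h1 : c 1 = a)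
    (hrec : ∀ k, c (k + 2) = a * c (k + 1) - b * c k) (hr : 0 ≤ r) (har : |(a : ℝ)| ≤ r)
    (hab : |(a : ℝ)| * r + |(b : ℝ)| ≤ r ^ 2) (k : ℕ) : |(c k : ℝ)| ≤ r ^ k := by
  suffices |(c k : ℝ)| ≤ r ^ k ∧ |(c (k + 1) : ℝ)| ≤ r ^ (k + 1) from this.1
  induction k with
  | zero => simp [h0, h1, har]
  | succ k ih =>
    refine ⟨ih.2, ?_⟩
    rw [hrec k]
    push_cast
    calc |(a : ℝ) * c (k + 1) - b * c k| ≤ |(a : ℝ)| * |(c (k + 1) : ℝ)| + |(b : ℝ)| * |(c k : ℝ)| :=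
          (abs_sub _ _).trans (by rw [abs_mul, abs_mul])
      _ ≤ |(a : ℝ)| * r ^ (k + 1) + |(b : ℝ)| * r ^ k := by
          gcongr
          · exact ih.2
          · exact ih.1
      _ = (|(a : ℝ)| * r + |(b : ℝ)|) * r ^ k := by ring
      _ ≤ r ^ 2 * r ^ k := by gcongr
      _ = r ^ (k + 1 + 1) := by ring

/-- A single step of the recurrence loses, since |a|q + q may exceed q². Applying it twice works:
|a² - q| ≤ q² - q and (q² - q)q + q² = q³. This bound serves the small primes, where 22√p is
useless. -/
lemma abs_le_pow_of_recurrence_of_abs_le {a : ℤ} {q : ℕ} {c : ℕ → ℤ} (h0 : c 0 = 1) (h1 : c 1 = a)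
    (hrec : ∀ k, c (k + 2) = a * c (k + 1) - q * c k) (hq : 2 ≤ q) (haq : |a| ≤ q) (k : ℕ) :
    |c k| ≤ (q : ℤ) ^ k := by
  suffices |c k| ≤ (q : ℤ) ^ k ∧ |c (k + 1)| ≤ (q : ℤ) ^ (k + 1) ∧
    |c (k + 2)| ≤ (q : ℤ) ^ (k + 2) from this.1
  have hq' : (2 : ℤ) ≤ q := by exact_mod_cast hq
  have ha2 : |a ^ 2 - q| ≤ (q : ℤ) ^ 2 - q := by
    have h3 : a ^ 2 ≤ (q : ℤ) ^ 2 := by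
      rw [← sq_abs]; exact pow_le_pow_left₀ (abs_nonneg a) haq 2
    rw [abs_le]
    constructor
    · nlinarith [sq_nonneg a]
    · linarith
  induction k with
  | zero =>
    refine ⟨by simp [h0], by simpa [h1] using haq, ?_⟩
    rw [hrec 0, h0, h1]
    calc |a * a - q * 1| = |a ^ 2 - q| := by ring_nf
      _ ≤ (q : ℤ) ^ 2 - q := ha2
      _ ≤ (q : ℤ) ^ (0 + 2) := by norm_num
  | succ k ih =>
    refine ⟨ih.2.1, ih.2.2, ?_⟩
    have : c (k + 1 + 2) = (a ^ 2 - q) * c (k + 1) - q * a * c k := by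
      rw [hrec (k + 1), hrec k]; ring
    rw [this]
    calc |(a ^ 2 - q) * c (k + 1) - q * a * c k|
        ≤ |a ^ 2 - q| * |c (k + 1)| + q * |a| * |c k| :=
          (abs_sub _ _).trans (by rw [abs_mul, abs_mul, abs_mul, Nat.abs_cast])
      _ ≤ ((q : ℤ) ^ 2 - q) * (q : ℤ) ^ (k + 1) + q * q * (q : ℤ) ^ k := by
          gcongr
          · exact (abs_nonneg _).trans ha2
          · exact ih.2.1
          · exact ih.1
      _ = (q : ℤ) ^ (k + 1 + 2) := by ring

variable (R : Type*) [CommRing R] [IsDomain R] [IsDiscreteValuationRing R] {F : Type*}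
  [Field F] [Algebra R F] [IsFractionRing R F] (W : WeierstrassCurve F)

lemma constantCoeff_localPowerSeries :
    PowerSeries.constantCoeff (W.localPowerSeries R) = 1 := by
  rw [WeierstrassCurve.localPowerSeries, PowerSeries.constantCoeff_invOfUnit]
  simp

/-- Bounds for the coefficients of the local Euler factors at primes of degree one. -/
lemma abs_coeff_localPowerSeries_le {p : ℕ} [hp : Fact p.Prime]
    (hcard : Nat.card (IsLocalRing.ResidueField R) = p) (k : ℕ) :
    |((PowerSeries.coeff k (W.localPowerSeries R) : ℤ) : ℝ)| ≤ (22 * √p) ^ k ∧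
    |((PowerSeries.coeff k (W.localPowerSeries R) : ℤ) : ℝ)| ≤ (p : ℝ) ^ k := by
  have hp1 : (1 : ℝ) ≤ p := by exact_mod_cast hp.out.one_lt.le
  have hs1 : (1 : ℝ) ≤ √p := by rw [Real.one_le_sqrt]; exact hp1
  have hsq : √(p : ℝ) * √p = p := Real.mul_self_sqrt (by positivity)
  have bad : ∀ a : ℤ, |(a : ℝ)| ≤ 1 → W.localPolynomial R = 1 - C a * X →
      |((PowerSeries.coeff k (W.localPowerSeries R) : ℤ) : ℝ)| ≤ (22 * √p) ^ k ∧
      |((PowerSeries.coeff k (W.localPowerSeries R) : ℤ) : ℝ)| ≤ (p : ℝ) ^ k := by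
    intro a ha hpol
    obtain ⟨h0, h1, hrec⟩ := coeff_invOfUnit_quadratic a 0 (P := W.localPolynomial R)
      (by rw [hpol]; simp)
    have := abs_le_pow_of_recurrence (b := 0)
      (c := fun k => PowerSeries.coeff k (W.localPowerSeries R)) h0 h1 hrec zero_le_one ha (by simpa using ha) k
    rw [one_pow] at this
    exact ⟨this.trans (one_le_pow₀ (by linarith)), this.trans (one_le_pow₀ hp1)⟩
  by_cases hgood : (W.minimal R).HasGoodReduction R
  · have : Finite (IsLocalRing.ResidueField R) :=
      Nat.finite_of_card_ne_zero (by rw [hcard]; exact hp.out.ne_zero)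
    have : Fintype (IsLocalRing.ResidueField R) := Fintype.ofFinite _
    have := (WeierstrassCurve.hasGoodReduction_iff_isElliptic_reduction R).1 hgood
    set a := frobeniusTrace ((W.minimal R).reduction R) with ha
    have hpol : W.localPolynomial R = 1 - C a * X + C (p : ℤ) * X ^ 2 := by
      rw [WeierstrassCurve.localPolynomial, if_pos hgood, ha, frobeniusTrace, hcard]
    obtain ⟨h0, h1, hrec⟩ := coeff_invOfUnit_quadratic a p hpol
    have hb1 := abs_frobeniusTrace_le_sqrt hcard ((W.minimal R).reduction R)
    have hb2 := abs_frobeniusTrace_le_card ((W.minimal R).reduction R)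
    rw [hcard] at hb2
    rw [← ha] at hb1 hb2
    refine ⟨abs_le_pow_of_recurrence (b := p)
      (c := fun k => PowerSeries.coeff k (W.localPowerSeries R)) h0 h1 hrec (by positivity) (by linarith) ?_ k, ?_⟩
    -- The ratio 22√p is admissible because 21·22 + 1 ≤ 22².
    · have : |(a : ℝ)| * (22 * √p) ≤ 21 * √p * (22 * √p) := by gcongr
      have h5 : |((p : ℤ) : ℝ)| = p := by simp
      rw [h5]
      nlinarith
    · have := abs_le_pow_of_recurrence_of_abs_le (q := p)
          (c := fun k => PowerSeries.coeff k (W.localPowerSeries R)) h0 h1 hrec hp.out.two_le hb2 k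
      exact_mod_cast this
  · by_cases hsplit : (W.minimal R).HasSplitMultiplicativeReduction R
    · exact bad 1 (by simp) (by
        rw [WeierstrassCurve.localPolynomial, if_neg hgood, if_pos hsplit]; simp)
    · by_cases hmult : (W.minimal R).HasMultiplicativeReduction R
      · exact bad (-1) (by simp) (by
          rw [WeierstrassCurve.localPolynomial, if_neg hgood, if_neg hsplit, if_pos hmult]; simp)
      · exact bad 0 (by simp) (by
          rw [WeierstrassCurve.localPolynomial, if_neg hgood, if_neg hsplit, if_neg hmult]; simp)

end LocalFactor

end EllipticTwists

namespace EllipticTwists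

/-! ### Absolute convergence of the `L`-series -/

section WeightedNorm

open ENNReal

/-- The weight `n ^ (-τ)`. -/
noncomputable def dirichletWeight (τ : ℝ) (n : ℕ) : ℝ≥0∞ := ENNReal.ofReal ((n : ℝ) ^ (-τ))

lemma dirichletWeight_mul (τ : ℝ) (m n : ℕ) :
    dirichletWeight τ (m * n) = dirichletWeight τ m * dirichletWeight τ n := by
  rw [dirichletWeight, dirichletWeight, dirichletWeight, ← ENNReal.ofReal_mul (by positivity)]
  push_cast
  rw [Real.mul_rpow (by positivity) (by positivity)]

/-- The weighted `ℓ¹`-norm `∑ |f n| n ^ (-τ)`. -/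
noncomputable def dirichletNorm (τ : ℝ) (f : ArithmeticFunction ℤ) : ℝ≥0∞ :=
  ∑' n : ℕ, ((f n).natAbs : ℝ≥0∞) * dirichletWeight τ n

/-- The weight is completely multiplicative, so this is the ℓ¹ inequality for a convolution; with
values in `ℝ≥0∞` no summability has to be known beforehand. -/
lemma dirichletNorm_mul_le (τ : ℝ) (f g : ArithmeticFunction ℤ) :
    dirichletNorm τ (f * g) ≤ dirichletNorm τ f * dirichletNorm τ g := by
  classical
  set u : ℕ → ℝ≥0∞ := fun n => ((f n).natAbs : ℝ≥0∞) * dirichletWeight τ n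
  set v : ℕ → ℝ≥0∞ := fun n => ((g n).natAbs : ℝ≥0∞) * dirichletWeight τ n
  have h1 : ∀ n : ℕ, (((f * g) n).natAbs : ℝ≥0∞) * dirichletWeight τ n ≤
      ∑' x : ℕ × ℕ, if x ∈ n.divisorsAntidiagonal then u x.1 * v x.2 else 0 := by
    intro n
    rw [tsum_eq_sum (s := n.divisorsAntidiagonal) (fun x hx => if_neg hx),
      ArithmeticFunction.mul_apply]
    have h2 : (∑ x ∈ n.divisorsAntidiagonal, f x.1 * g x.2).natAbs ≤
        ∑ x ∈ n.divisorsAntidiagonal, (f x.1).natAbs * (g x.2).natAbs := by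
      refine (Int.natAbs_sum_le _ _).trans_eq (Finset.sum_congr rfl fun x _ => ?_)
      rw [Int.natAbs_mul]
    calc _ ≤ ((∑ x ∈ n.divisorsAntidiagonal, (f x.1).natAbs * (g x.2).natAbs : ℕ) : ℝ≥0∞) *
          dirichletWeight τ n := by gcongr
      _ = _ := by
          push_cast
          rw [Finset.sum_mul]
          refine Finset.sum_congr rfl fun x hx => ?_
          rw [if_pos hx, ← (Nat.mem_divisorsAntidiagonal.1 hx).1, dirichletWeight_mul]
          simp only [u, v]
          ring
  calc dirichletNorm τ (f * g)
      ≤ ∑' n : ℕ, ∑' x : ℕ × ℕ, if x ∈ n.divisorsAntidiagonal then u x.1 * v x.2 else 0 :=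
        ENNReal.tsum_le_tsum h1
    _ = ∑' x : ℕ × ℕ, ∑' n : ℕ, if x ∈ n.divisorsAntidiagonal then u x.1 * v x.2 else 0 :=
        ENNReal.tsum_comm
    _ ≤ ∑' x : ℕ × ℕ, u x.1 * v x.2 := by
        refine ENNReal.tsum_le_tsum fun x => ?_
        rw [tsum_eq_single (x.1 * x.2)]
        · split_ifs
          · exact le_rfl
          · exact zero_le
        · intro n hn
          rw [if_neg]
          intro hx
          exact hn (Nat.mem_divisorsAntidiagonal.1 hx).1.symm
    _ = dirichletNorm τ f * dirichletNorm τ g := by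
        rw [ENNReal.tsum_prod', dirichletNorm, dirichletNorm, ← ENNReal.tsum_mul_right]
        refine tsum_congr fun a => ?_
        exact ENNReal.tsum_mul_left (a := u a) (f := v)

lemma dirichletNorm_one (τ : ℝ) : dirichletNorm τ 1 = 1 := by
  rw [dirichletNorm, tsum_eq_single 1]
  · simp [dirichletWeight]
  · intro n hn
    simp [ArithmeticFunction.one_apply_ne hn]

lemma dirichletNorm_prod_le {ι : Type*} (τ : ℝ) (f : ι → ArithmeticFunction ℤ) (s : Finset ι) :
    dirichletNorm τ (∏ i ∈ s, f i) ≤ ∏ i ∈ s, dirichletNorm τ (f i) := by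
  classical
  induction s using Finset.induction_on with
  | empty => simp [dirichletNorm_one]
  | insert i s hi ih =>
    rw [Finset.prod_insert hi, Finset.prod_insert hi]
    exact (dirichletNorm_mul_le _ _ _).trans (by gcongr)

lemma dirichletNorm_ofPowerSeries_le {q : ℕ} (hq : 1 < q) (τ : ℝ) (F : PowerSeries ℤ) {r : ℝ}
    (hr : 0 ≤ r) (hF : ∀ k, |((PowerSeries.coeff k F : ℤ) : ℝ)| ≤ r ^ k)
    (hr1 : r * (q : ℝ) ^ (-τ) < 1) :
    dirichletNorm τ (ArithmeticFunction.ofPowerSeries q F) ≤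
      ENNReal.ofReal (1 - r * (q : ℝ) ^ (-τ))⁻¹ := by
  set x := r * (q : ℝ) ^ (-τ) with hx
  have hx0 : 0 ≤ x := by positivity
  have hinj := Nat.pow_right_injective hq
  rw [dirichletNorm, ← hinj.tsum_eq]
  · calc _ ≤ ∑' k : ℕ, ENNReal.ofReal (x ^ k) := by
          refine ENNReal.tsum_le_tsum fun k => ?_
          rw [ArithmeticFunction.ofPowerSeries_apply_pow hq, dirichletWeight]
          have h1 : (((PowerSeries.coeff k F).natAbs : ℕ) : ℝ≥0∞) =
              ENNReal.ofReal |((PowerSeries.coeff k F : ℤ) : ℝ)| := by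
            rw [← Int.cast_abs, ← Nat.cast_natAbs, ENNReal.ofReal_natCast]
          rw [h1, ← ENNReal.ofReal_mul (abs_nonneg _)]
          apply ENNReal.ofReal_le_ofReal
          rw [hx, mul_pow]
          push_cast
          rw [← Real.rpow_natCast (q : ℝ) k, ← Real.rpow_mul (by positivity),
            ← Real.rpow_natCast ((q : ℝ) ^ (-τ)) k, ← Real.rpow_mul (by positivity),
            mul_comm (k : ℝ) (-τ)]
          gcongr
          exact hF k
      _ = ENNReal.ofReal (1 - x)⁻¹ := by
          rw [← ENNReal.ofReal_tsum_of_nonneg (fun k => by positivity)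
            (summable_geometric_of_lt_one hx0 hr1), tsum_geometric_of_lt_one hx0 hr1]
  · intro n hn
    by_contra hn'
    apply hn
    have : ArithmeticFunction.ofPowerSeries q F n = 0 := by
      rw [ArithmeticFunction.ofPowerSeries_apply hq, Function.extend_apply' _ _ _ (by
        simpa using hn')]
      rfl
    simp [this]

end WeightedNorm

/-! ### The Euler product over all primes -/

section Global

open IsDedekindDomain NumberField Rat.HeightOneSpectrum

lemma natCard_residueField (v : HeightOneSpectrum (𝓞 ℚ)) :
    Nat.card (IsLocalRing.ResidueField (v.adicCompletionIntegers ℚ)) = (primesEquiv v : ℕ) := by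
  have : Fact (Nat.Prime (primesEquiv v : ℕ)) := ⟨(primesEquiv v).2⟩
  have e1 := IsLocalRing.ResidueField.mapEquiv
    (adicCompletionIntegers.padicIntEquiv v).toRingEquiv
  rw [Nat.card_congr (e1.trans PadicInt.residueField).toEquiv, Nat.card_zmod]

/-- The local Euler factors are uniformly close to `1` in the weighted norm. -/
lemma exists_dirichletNorm_localEulerFactor_le (E : WeierstrassCurve ℚ) {σ : ℝ} (hσ : 1 < σ) :
    ∃ B : ℝ, 0 ≤ B ∧ ∀ v : HeightOneSpectrum (𝓞 ℚ),
      dirichletNorm (σ + 1 / 2) ((E.baseChange (v.adicCompletion ℚ)).localEulerFactor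
        (v.adicCompletionIntegers ℚ)) ≤
      ENNReal.ofReal (1 + B * ((primesEquiv v : ℕ) : ℝ) ^ (-σ)) := by
  set b := (1 - (2 : ℝ) ^ (1 - (σ + 1 / 2)))⁻¹ with hb
  have hx2 : (2 : ℝ) ^ (1 - (σ + 1 / 2)) < 1 :=
    Real.rpow_lt_one_of_one_lt_of_neg (by norm_num) (by linarith)
  have hb0 : 0 < b := by rw [hb]; exact inv_pos.2 (by linarith)
  refine ⟨44 * (b + 1), by positivity, fun v => ?_⟩
  set p : ℕ := (primesEquiv v : ℕ) with hpdef
  have hpp : Fact p.Prime := ⟨(primesEquiv v).2⟩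
  have hcard := natCard_residueField v
  have hcoeff := abs_coeff_localPowerSeries_le (v.adicCompletionIntegers ℚ)
    (E.baseChange (v.adicCompletion ℚ)) hcard
  have hp0 : (0 : ℝ) < p := by exact_mod_cast hpp.out.pos
  have hp2 : (2 : ℝ) ≤ p := by exact_mod_cast hpp.out.two_le
  rw [WeierstrassCurve.localEulerFactor, hcard]
  have hy0 : 0 < (p : ℝ) ^ (-σ) := Real.rpow_pos_of_pos hp0 _
  -- For large p the √p bound gives a geometric series with sum at most 1 + 44 p^{-σ}. For the
  -- remaining p that series may diverge, so the ratio p is used; its sum is at most b, absorbed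
  -- because 44 p^{-σ} > 1.
  rcases le_or_gt (22 * (p : ℝ) ^ (-σ)) (1 / 2) with hsmall | hlarge
  · have hr : 22 * √p * (p : ℝ) ^ (-(σ + 1 / 2)) = 22 * (p : ℝ) ^ (-σ) := by
      rw [Real.sqrt_eq_rpow, mul_assoc, ← Real.rpow_add hp0]
      congr 2
      ring
    refine (dirichletNorm_ofPowerSeries_le hpp.out.one_lt _ _ (r := 22 * √p) (by positivity)
      (fun k => (hcoeff k).1) (by rw [hr]; linarith)).trans (ENNReal.ofReal_le_ofReal ?_)
    rw [hr, inv_le_iff_one_le_mul₀ (by linarith)]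
    nlinarith [mul_nonneg (mul_nonneg hy0.le hb0.le) (sub_nonneg.2 hsmall),
      mul_nonneg hy0.le (sub_nonneg.2 hsmall), mul_nonneg hy0.le hb0.le]
  · have hr : (p : ℝ) * (p : ℝ) ^ (-(σ + 1 / 2)) = (p : ℝ) ^ (1 - (σ + 1 / 2)) := by
      rw [sub_eq_add_neg, Real.rpow_add hp0, Real.rpow_one]
    have hle : (p : ℝ) ^ (1 - (σ + 1 / 2)) ≤ (2 : ℝ) ^ (1 - (σ + 1 / 2)) :=
      Real.rpow_le_rpow_of_nonpos (by norm_num) hp2 (by linarith)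
    refine (dirichletNorm_ofPowerSeries_le hpp.out.one_lt _ _ (r := p) (by positivity)
      (fun k => (hcoeff k).2) (by rw [hr]; linarith)).trans (ENNReal.ofReal_le_ofReal ?_)
    rw [hr]
    have : (1 - (p : ℝ) ^ (1 - (σ + 1 / 2)))⁻¹ ≤ b := by
      rw [hb]
      apply inv_anti₀ (by linarith)
      linarith
    nlinarith

/-- All finite Euler products have weighted norm at most ∏ (1 + B p^{-σ}) ≤ exp(∑ B p^{-σ}), and
every coefficient of the L-function is eventually that of the finite products. -/
lemma summable_natAbs_LFunction (E : WeierstrassCurve ℚ) {σ : ℝ} (hσ : 1 < σ) :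
    Summable fun n : ℕ => ((E.LFunction n).natAbs : ℝ) * (n : ℝ) ^ (-(σ + 1 / 2)) := by
  classical
  obtain ⟨B, hB, hloc⟩ := exists_dirichletNorm_localEulerFactor_le E hσ
  set y : HeightOneSpectrum (𝓞 ℚ) → ℝ := fun v => B * ((primesEquiv v : ℕ) : ℝ) ^ (-σ) with hy
  have hy0 : ∀ v, 0 ≤ y v := fun v => by positivity
  have hinj : Function.Injective fun v : HeightOneSpectrum (𝓞 ℚ) => (primesEquiv v : ℕ) :=
    Subtype.val_injective.comp primesEquiv.injective
  have hysum : Summable y :=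
    (((Real.summable_nat_rpow (p := -σ)).2 (by linarith)).comp_injective hinj).mul_left B
  set f : HeightOneSpectrum (𝓞 ℚ) → ArithmeticFunction ℤ := fun v =>
    (E.baseChange (v.adicCompletion ℚ)).localEulerFactor (v.adicCompletionIntegers ℚ) with hf
  have hprod : ∀ s : Finset (HeightOneSpectrum (𝓞 ℚ)),
      dirichletNorm (σ + 1 / 2) (∏ v ∈ s, f v) ≤ ENNReal.ofReal (Real.exp (∑' v, y v)) := by
    intro s
    calc _ ≤ ∏ v ∈ s, dirichletNorm (σ + 1 / 2) (f v) := dirichletNorm_prod_le _ _ _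
      _ ≤ ∏ v ∈ s, ENNReal.ofReal (1 + y v) := Finset.prod_le_prod' fun v _ => hloc v
      _ = ENNReal.ofReal (∏ v ∈ s, (1 + y v)) :=
          (ENNReal.ofReal_prod_of_nonneg fun v _ => by linarith [hy0 v]).symm
      _ ≤ _ := by
          apply ENNReal.ofReal_le_ofReal
          calc ∏ v ∈ s, (1 + y v) ≤ ∏ v ∈ s, Real.exp (y v) :=
                Finset.prod_le_prod (fun v _ => by linarith [hy0 v]) fun v _ => by
                  linarith [Real.add_one_le_exp (y v)]
            _ = Real.exp (∑ v ∈ s, y v) := (Real.exp_sum _ _).symm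
            _ ≤ _ := Real.exp_le_exp.2 (hysum.sum_le_tsum s fun v _ => hy0 v)
  have hnorth : Northcott fun v : HeightOneSpectrum (𝓞 ℚ) =>
      Nat.card (IsLocalRing.ResidueField (v.adicCompletionIntegers ℚ)) := by
    rw [northcott_iff_tendsto]
    simp only [natCard_residueField]
    rw [← Nat.cofinite_eq_atTop]
    exact hinj.tendsto_cofinite
  have hlim : ∀ n : ℕ, ∀ᶠ s in Filter.atTop, (∏ v ∈ s, f v) n = E.LFunction n := fun n =>
    ArithmeticFunction.tendsTo_eulerProduct_ofPowerSeries _ _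
      (fun v => constantCoeff_localPowerSeries _ _) n
  have hfin : dirichletNorm (σ + 1 / 2) E.LFunction ≤ ENNReal.ofReal (Real.exp (∑' v, y v)) := by
    rw [dirichletNorm, ENNReal.tsum_eq_iSup_sum]
    refine iSup_le fun T => ?_
    -- One finite Euler product matches all coefficients in the finite set T, so its norm bounds the
    -- partial sum.
    obtain ⟨s, hs⟩ := ((Filter.eventually_all_finset T).2 fun n _ => hlim n).exists
    rw [← Finset.sum_congr rfl fun n hn => by rw [← hs n hn]]
    exact (ENNReal.sum_le_tsum T).trans (hprod s)
  have hne : dirichletNorm (σ + 1 / 2) E.LFunction ≠ ⊤ :=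
    (hfin.trans_lt ENNReal.ofReal_lt_top).ne
  have := ENNReal.summable_toReal hne
  refine this.congr fun n => ?_
  rw [ENNReal.toReal_mul, dirichletWeight, ENNReal.toReal_ofReal (by positivity),
    ENNReal.toReal_natCast]

/-- The normalized `L`-series converges absolutely for `Re s > 1`. -/
lemma summable_norm_lam_mul_rpow (E : WeierstrassCurve ℚ) {σ : ℝ} (hσ : 1 < σ) :
    Summable fun n : ℕ => ‖lam E n‖ * (n : ℝ) ^ (-σ) := by
  refine (summable_natAbs_LFunction E hσ).congr fun n => ?_
  rcases Nat.eq_zero_or_pos n with rfl | hn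
  · simp [lam]
  have hn0 : (0 : ℝ) < n := by exact_mod_cast hn
  have hsplit : (n : ℝ) ^ (-(σ + 1 / 2)) = (√(n : ℝ))⁻¹ * (n : ℝ) ^ (-σ) := by
    rw [Real.sqrt_eq_rpow, ← Real.rpow_neg hn0.le, ← Real.rpow_add hn0]
    congr 1
    ring
  rw [lam, norm_div, Complex.norm_intCast, Complex.norm_real, Real.norm_of_nonneg (by positivity),
    hsplit, Nat.cast_natAbs, Int.cast_abs]
  ring

end Global

end EllipticTwists

namespace EllipticTwists

/-! ### The divisor bound and the Pólya–Vinogradov inequality -/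

section DivisorBound

/-- Compare a + 1 with p^{aε} prime by prime. If p ≥ 2^{1/ε}, then p^{aε} ≥ 2^a ≥ a + 1 with no
loss; each of the finitely many smaller primes costs at most a factor c. -/
lemma exists_card_divisors_le {ε : ℝ} (hε : 0 < ε) :
    ∃ C : ℝ, 0 < C ∧ ∀ n : ℕ, n ≠ 0 → (n.divisors.card : ℝ) ≤ C * (n : ℝ) ^ ε := by
  have hlog2 : 0 < Real.log 2 := Real.log_pos (by norm_num)
  set c : ℝ := max 1 (1 / (ε * Real.log 2)) with hc
  have hc1 : 1 ≤ c := le_max_left _ _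
  have hc2 : 1 ≤ c * (ε * Real.log 2) := by
    have := le_max_right 1 (1 / (ε * Real.log 2))
    rwa [div_le_iff₀ (by positivity)] at this
  obtain ⟨P, hP⟩ := exists_nat_gt ((2 : ℝ) ^ (1 / ε))
  refine ⟨c ^ P, by positivity, fun n hn => ?_⟩
  have hlocal : ∀ p ∈ n.primeFactors, ((n.factorization p + 1 : ℕ) : ℝ) ≤
      (if p < P then c else 1) * ((p : ℝ) ^ n.factorization p) ^ ε := by
    intro p hp
    have hpp := Nat.prime_of_mem_primeFactors hp
    have hp2 : (2 : ℝ) ≤ p := by exact_mod_cast hpp.two_le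
    have hp0 : (0 : ℝ) ≤ p := by positivity
    set a := n.factorization p
    have hcomm : ((p : ℝ) ^ a) ^ ε = ((p : ℝ) ^ ε) ^ a := by
      rw [← Real.rpow_natCast, ← Real.rpow_natCast, ← Real.rpow_mul hp0, ← Real.rpow_mul hp0,
        mul_comm]
    push_cast
    split_ifs with hpP
    · have h1 : (2 : ℝ) ^ (ε * a) ≤ ((p : ℝ) ^ a) ^ ε := by
        rw [hcomm, ← Real.rpow_natCast, ← Real.rpow_mul hp0]
        exact Real.rpow_le_rpow (by norm_num) hp2 (by positivity)
      have h2 : 1 + ε * a * Real.log 2 ≤ (2 : ℝ) ^ (ε * a) := by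
        rw [Real.rpow_def_of_pos (by norm_num)]
        have := Real.add_one_le_exp (Real.log 2 * (ε * a))
        linarith
      have h3 : (a : ℝ) + 1 ≤ c * (1 + ε * a * Real.log 2) := by
        have := mul_le_mul_of_nonneg_right hc2 (Nat.cast_nonneg (α := ℝ) a)
        nlinarith
      calc (a : ℝ) + 1 ≤ c * (1 + ε * a * Real.log 2) := h3
        _ ≤ c * ((p : ℝ) ^ a) ^ ε := by gcongr; exact h2.trans h1
    · rw [one_mul, hcomm]
      have h1 : (2 : ℝ) ≤ (p : ℝ) ^ ε := by
        have h2 : (2 : ℝ) ^ (1 / ε) ≤ p := hP.le.trans (by exact_mod_cast not_lt.1 hpP)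
        calc (2 : ℝ) = ((2 : ℝ) ^ (1 / ε)) ^ ε := by
              rw [← Real.rpow_mul (by norm_num), one_div_mul_cancel hε.ne', Real.rpow_one]
          _ ≤ _ := Real.rpow_le_rpow (by positivity) h2 hε.le
      calc (a : ℝ) + 1 ≤ 2 ^ a := by exact_mod_cast Nat.lt_two_pow_self
        _ ≤ _ := pow_le_pow_left₀ (by norm_num) h1 a
  rw [Nat.card_divisors hn]
  push_cast
  have hnprod : (n : ℝ) = ∏ p ∈ n.primeFactors, (p : ℝ) ^ n.factorization p := by
    conv_lhs => rw [← Nat.prod_factorization_pow_eq_self hn, Finsupp.prod]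
    push_cast
    rfl
  calc ∏ p ∈ n.primeFactors, ((n.factorization p : ℝ) + 1)
      ≤ ∏ p ∈ n.primeFactors, (if p < P then c else 1) * ((p : ℝ) ^ n.factorization p) ^ ε :=
        Finset.prod_le_prod (fun p _ => by positivity) fun p hp => by
          have := hlocal p hp; push_cast at this; exact this
    _ = (∏ p ∈ n.primeFactors, if p < P then c else 1) * (n : ℝ) ^ ε := by
        rw [Finset.prod_mul_distrib, Real.finsetProd_rpow _ _ fun p _ => by positivity, ← hnprod]
    _ ≤ c ^ P * (n : ℝ) ^ ε := by
        gcongr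
        rw [← Finset.prod_filter, Finset.prod_const]
        refine pow_le_pow_right₀ hc1 ?_
        refine (Finset.card_le_card (t := Finset.range P) fun p hp => ?_).trans_eq (by simp)
        exact Finset.mem_range.2 (Finset.mem_filter.1 hp).2

end DivisorBound

/-! ### The Pólya–Vinogradov inequality -/

section PolyaVinogradov

open ZMod

lemma norm_sum_pow_le {z : ℂ} (hz : ‖z‖ = 1) (hz1 : z ≠ 1) (M : ℕ) :
    ‖∑ m ∈ Finset.Icc 1 M, z ^ m‖ ≤ 2 / ‖z - 1‖ := by
  have h1 : ∑ m ∈ Finset.Icc 1 M, z ^ m = z * ((z ^ M - 1) / (z - 1)) := by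
    rw [← geom_sum_eq hz1, Finset.mul_sum, Finset.range_eq_Ico, ← Finset.Ico_add_one_right_eq_Icc,
      Finset.sum_Ico_add' (fun m => z ^ m) 0 M 1 |>.symm]
    refine Finset.sum_congr rfl fun m _ => by ring
  rw [h1, norm_mul, hz, one_mul, norm_div]
  gcongr
  calc ‖z ^ M - 1‖ ≤ ‖z ^ M‖ + ‖(1 : ℂ)‖ := norm_sub_le _ _
    _ = 2 := by rw [norm_pow, hz]; norm_num

lemma norm_stdAddChar {f : ℕ} [NeZero f] (x : ZMod f) : ‖stdAddChar x‖ = 1 := by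
  exact Circle.norm_coe _

/-- Here |e(j/f) - 1| = 2 sin(πj/f), and Jordan's inequality applies to j or f - j, whichever is
smaller. Adding both reciprocals avoids a case split when summing over j. -/
lemma two_div_norm_stdAddChar_sub_one_le {f : ℕ} [NeZero f] {x : ZMod f} (hx : x ≠ 0) :
    2 / ‖stdAddChar x - 1‖ ≤ f / 2 * (1 / (x.val : ℝ) + 1 / ((f : ℝ) - x.val)) := by
  have hf0 : (0 : ℝ) < f := by exact_mod_cast Nat.pos_of_ne_zero (NeZero.ne f)
  set j := x.val with hj
  have hj0 : (0 : ℝ) < j := by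
    have : j ≠ 0 := by rwa [hj, Ne, ZMod.val_eq_zero]
    exact_mod_cast Nat.pos_of_ne_zero this
  have hjf : (j : ℝ) < f := by exact_mod_cast ZMod.val_lt x
  have hchar : stdAddChar x = Complex.exp (Complex.I * ((2 * Real.pi * j / f : ℝ) : ℂ)) := by
    have h1 : x = ((j : ℤ) : ZMod f) := by
      rw [hj, Int.cast_natCast, ZMod.natCast_zmod_val]
    rw [h1, stdAddChar_coe]
    congr 1
    push_cast
    ring
  rw [hchar, Complex.norm_exp_I_mul_ofReal_sub_one, norm_mul,
    show 2 * Real.pi * j / f / 2 = Real.pi * j / f by ring]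
  have hpi := Real.pi_pos
  have hsin : 0 < Real.sin (Real.pi * j / f) := by
    apply Real.sin_pos_of_pos_of_lt_pi (by positivity)
    rw [div_lt_iff₀ hf0]
    gcongr
  rw [Real.norm_of_nonneg hsin.le, Real.norm_of_nonneg (by norm_num), ← div_div, div_self two_ne_zero]
  have hfj : 0 < (f : ℝ) - j := by linarith
  rcases le_total (2 * (j : ℝ)) f with h | h
  · have hb : 2 * j / f ≤ Real.sin (Real.pi * j / f) := by
      have := Real.mul_le_sin (x := Real.pi * j / f) (by positivity) (by
        rw [div_le_div_iff₀ hf0 (by norm_num)]; nlinarith)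
      calc 2 * (j : ℝ) / f = 2 / Real.pi * (Real.pi * j / f) := by field_simp
        _ ≤ _ := this
    calc 1 / Real.sin (Real.pi * j / f) ≤ 1 / (2 * j / f) :=
          one_div_le_one_div_of_le (by positivity) hb
      _ = f / 2 * (1 / j) := by field_simp
      _ ≤ _ := by
          gcongr
          have : 0 < 1 / ((f : ℝ) - j) := by positivity
          linarith
  · have hb : 2 * (f - j) / f ≤ Real.sin (Real.pi * j / f) := by
      have := Real.mul_le_sin (x := Real.pi * (f - j) / f) (by positivity) (by
        rw [div_le_div_iff₀ hf0 (by norm_num)]; nlinarith)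
      rw [← Real.sin_pi_sub, show Real.pi - Real.pi * j / f = Real.pi * (f - j) / f by field_simp]
      calc 2 * ((f : ℝ) - j) / f = 2 / Real.pi * (Real.pi * (f - j) / f) := by field_simp
        _ ≤ _ := this
    calc 1 / Real.sin (Real.pi * j / f) ≤ 1 / (2 * (f - j) / f) :=
          one_div_le_one_div_of_le (by positivity) hb
      _ = f / 2 * (1 / (f - j)) := by field_simp
      _ ≤ _ := by
          gcongr
          have : 0 < 1 / (j : ℝ) := by positivity
          linarith

lemma sum_zmod_val {f : ℕ} [NeZero f] (g : ℕ → ℝ) :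
    ∑ x : ZMod f, g x.val = ∑ j ∈ Finset.range f, g j := by
  obtain ⟨n, rfl⟩ : ∃ n, f = n + 1 := ⟨f - 1, (Nat.succ_pred (NeZero.ne f)).symm⟩
  exact Fin.sum_univ_eq_sum_range g (n + 1)

lemma sum_range_reciprocal_le {f : ℕ} (hf : f ≠ 0) :
    ∑ j ∈ Finset.range f, (f / 2 * (1 / (j : ℝ) + 1 / ((f : ℝ) - j))) ≤ f * (1 + Real.log f) := by
  have hH : ∑ i ∈ Finset.range f, 1 / ((i : ℝ) + 1) ≤ 1 + Real.log f := by
    have := harmonic_le_one_add_log f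
    rw [harmonic] at this
    push_cast at this
    simpa [one_div] using this
  have h1 : ∑ j ∈ Finset.range f, 1 / (j : ℝ) ≤ ∑ i ∈ Finset.range f, 1 / ((i : ℝ) + 1) := by
    obtain ⟨n, rfl⟩ := Nat.exists_eq_succ_of_ne_zero hf
    rw [Finset.sum_range_succ', Finset.sum_range_succ]
    push_cast
    have : (0 : ℝ) ≤ 1 / ((n : ℝ) + 1) := by positivity
    simp only [div_zero]
    linarith
  have h2 : ∑ j ∈ Finset.range f, 1 / ((f : ℝ) - j) = ∑ i ∈ Finset.range f, 1 / ((i : ℝ) + 1) := by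
    rw [← Finset.sum_range_reflect]
    refine Finset.sum_congr rfl fun j hj => ?_
    have hj' := Finset.mem_range.1 hj
    rw [Nat.sub_sub, Nat.cast_sub (by omega)]
    push_cast
    congr 1
    ring
  rw [← Finset.mul_sum, Finset.sum_add_distrib, h2]
  have hf0 : (0 : ℝ) ≤ f := by positivity
  nlinarith

/-- Applying the discrete Fourier transform twice gives τ(χ) τ(χ⁻¹) = χ(-1) f, and the two Gauss
sums have equal modulus because they are conjugate up to a sign. -/
lemma norm_gaussSum_of_isPrimitive {f : ℕ} [NeZero f] {χ : DirichletCharacter ℂ f}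
    (hχ : χ.IsPrimitive) : ‖gaussSum χ (stdAddChar (N := f))‖ = √f := by
  have hχ' : χ⁻¹.IsPrimitive := by
    rw [DirichletCharacter.isPrimitive_def, DirichletCharacter.conductor_inv]; exact hχ
  have hunit : ∀ ψ : DirichletCharacter ℂ f, ‖ψ (-1)‖ = 1 := fun ψ => by
    have := ψ.unit_norm_eq_one (-1); simpa using this
  have hprod : gaussSum χ stdAddChar * gaussSum χ⁻¹ stdAddChar = (f : ℂ) * χ (-1) := by
    have h1 := congrFun (ZMod.dft_dft (χ : ZMod f → ℂ)) 1
    have h2 : ZMod.dft (χ : ZMod f → ℂ) =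
        fun k => (fun j => χ⁻¹ (-j)) k * gaussSum χ stdAddChar := by
      funext k
      exact hχ.fourierTransform_eq_inv_mul_gaussSum k
    rw [h2, ZMod.dft_mul_const, ZMod.dft_comp_neg] at h1
    simp only [hχ'.fourierTransform_eq_inv_mul_gaussSum, neg_neg, inv_inv, map_one, one_mul,
      smul_eq_mul] at h1
    rw [mul_comm, h1]
  have hnorm : ‖gaussSum χ⁻¹ (stdAddChar (N := f))‖ = ‖gaussSum χ (stdAddChar (N := f))‖ := by
    rw [← norm_star (gaussSum χ _), star_gaussSum_eq, AddChar.inv_mulShift,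
      gaussSum_mulShift_of_isPrimitive _ hχ', norm_mul, inv_inv, hunit, one_mul]
  have hsq : ‖gaussSum χ (stdAddChar (N := f))‖ ^ 2 = f := by
    have := congrArg norm hprod
    rw [norm_mul, norm_mul, hnorm, hunit, mul_one, Complex.norm_natCast] at this
    rw [sq, this]
  rw [← hsq, Real.sqrt_sq (norm_nonneg _)]

/-- The Pólya–Vinogradov inequality for primitive characters. -/
lemma norm_sum_le_of_isPrimitive {f : ℕ} [NeZero f] (hf : f ≠ 1) {χ : DirichletCharacter ℂ f}
    (hχ : χ.IsPrimitive) (M : ℕ) :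
    ‖∑ m ∈ Finset.Icc 1 M, χ (m : ZMod f)‖ ≤ √f * (1 + Real.log f) := by
  have hχ' : χ⁻¹.IsPrimitive := by
    rw [DirichletCharacter.isPrimitive_def, DirichletCharacter.conductor_inv]; exact hχ
  have hf0 : (0 : ℝ) < f := by exact_mod_cast Nat.pos_of_ne_zero (NeZero.ne f)
  set τ := gaussSum χ⁻¹ (stdAddChar (N := f)) with hτ
  have hτn : ‖τ‖ = √f := norm_gaussSum_of_isPrimitive hχ'
  -- Gauss sums write χ(m) through additive characters, so the incomplete sum becomes a combination
  -- of geometric sums.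
  have hexp : (∑ m ∈ Finset.Icc 1 M, χ (m : ZMod f)) * τ =
      ∑ x : ZMod f, χ⁻¹ x * ∑ m ∈ Finset.Icc 1 M, stdAddChar x ^ m := by
    rw [Finset.sum_mul]
    have h1 : ∀ m ∈ Finset.Icc 1 M, χ (m : ZMod f) * τ =
        ∑ x : ZMod f, χ⁻¹ x * stdAddChar x ^ m := by
      intro m _
      have h2 := gaussSum_mulShift_of_isPrimitive (stdAddChar (N := f)) hχ' (m : ZMod f)
      rw [inv_inv] at h2
      rw [← h2, gaussSum]
      refine Finset.sum_congr rfl fun x _ => ?_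
      rw [AddChar.mulShift_apply, ← nsmul_eq_mul, AddChar.map_nsmul_eq_pow]
    rw [Finset.sum_congr rfl h1, Finset.sum_comm]
    exact Finset.sum_congr rfl fun x _ => by rw [Finset.mul_sum]
  have hbound : ‖(∑ m ∈ Finset.Icc 1 M, χ (m : ZMod f)) * τ‖ ≤ f * (1 + Real.log f) := by
    rw [hexp]
    refine (norm_sum_le _ _).trans ?_
    calc _ ≤ ∑ x : ZMod f, (f / 2 * (1 / (x.val : ℝ) + 1 / ((f : ℝ) - x.val))) := by
          refine Finset.sum_le_sum fun x _ => ?_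
          rcases eq_or_ne x 0 with rfl | hx
          · rw [DirichletCharacter.map_zero' _ hf, zero_mul, norm_zero, ZMod.val_zero]
            simp only [CharP.cast_eq_zero, div_zero, zero_add, sub_zero]
            positivity
          · rw [norm_mul]
            have hne : stdAddChar x ≠ 1 := by
              rw [← AddChar.map_zero_eq_one (stdAddChar (N := f))]
              exact fun h => hx (ZMod.injective_stdAddChar h)
            calc _ ≤ 1 * (2 / ‖stdAddChar x - 1‖) := by
                  gcongr
                  · exact DirichletCharacter.norm_le_one _ _
                  · exact norm_sum_pow_le (norm_stdAddChar x) hne M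
              _ ≤ _ := by rw [one_mul]; exact two_div_norm_stdAddChar_sub_one_le hx
      _ = _ := sum_zmod_val fun j : ℕ => (f / 2 * (1 / (j : ℝ) + 1 / ((f : ℝ) - j)))
      _ ≤ _ := sum_range_reciprocal_le (NeZero.ne f)
  rw [norm_mul, hτn] at hbound
  have hs : 0 < √(f : ℝ) := Real.sqrt_pos.2 hf0
  have hsq : √(f : ℝ) * √f = f := Real.mul_self_sqrt hf0.le
  refine le_of_mul_le_mul_right ?_ hs
  calc _ ≤ _ := hbound
    _ = √f * (1 + Real.log f) * √f := by linear_combination (-(1 + Real.log f)) * hsq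

/-- The Pólya–Vinogradov inequality for nontrivial characters. -/
lemma norm_sum_le_of_ne_one {q : ℕ} [NeZero q] {ψ : DirichletCharacter ℂ q} (hψ : ψ ≠ 1) (M : ℕ) :
    ‖∑ m ∈ Finset.Icc 1 M, ψ (m : ZMod q)‖ ≤ q.divisors.card * (√q * (1 + Real.log q)) := by
  classical
  have hq0 : q ≠ 0 := NeZero.ne q
  set f := ψ.conductor with hf
  have hfq : f ∣ q := ψ.conductor_dvd_level
  have hfne : NeZero f := ⟨ψ.conductor_ne_zero⟩
  have hf1 : f ≠ 1 := fun h => hψ (DirichletCharacter.eq_one_iff_conductor_eq_one.2 h)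
  set χ : DirichletCharacter ℂ f := ψ.primitiveCharacter with hχ
  have hprim : χ.IsPrimitive := ψ.primitiveCharacter_isPrimitive
  -- ψ is its primitive character restricted to m prime to q. Detecting coprimality by Möbius splits
  -- the sum over the divisors e of q, each giving χ(e) times a shorter primitive sum.
  have hval : ∀ m : ℕ, ψ (m : ZMod q) =
      ∑ e ∈ q.divisors, if e ∣ m then (ArithmeticFunction.moebius e : ℂ) * χ (m : ZMod f) else 0 := by
    intro m
    have h1 : ∑ e ∈ q.divisors, (if e ∣ m then (ArithmeticFunction.moebius e : ℂ) * χ (m : ZMod f)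
        else 0) = (if m.gcd q = 1 then 1 else 0) * χ (m : ZMod f) := by
      rw [← Finset.sum_filter, ← Finset.sum_mul]
      congr 1
      have h2 : q.divisors.filter (· ∣ m) = (m.gcd q).divisors := by
        ext e
        simp only [Finset.mem_filter, Nat.mem_divisors, Nat.dvd_gcd_iff]
        refine ⟨fun h => ⟨⟨h.2, h.1.1⟩, Nat.gcd_ne_zero_right hq0⟩, fun h => ⟨⟨h.1.2, hq0⟩, h.1.1⟩⟩
      rw [h2]
      have h3 : ∑ e ∈ (m.gcd q).divisors, ArithmeticFunction.moebius e =
          if m.gcd q = 1 then 1 else 0 := by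
        rw [← ArithmeticFunction.coe_mul_zeta_apply, ArithmeticFunction.moebius_mul_coe_zeta,
          ArithmeticFunction.one_apply]
      exact_mod_cast h3
    rw [h1]
    split_ifs with h
    · have hco : IsCoprime (m : ℤ) (q : ℤ) := Nat.isCoprime_iff_coprime.2 h
      have := ψ.primitiveCharacter_apply_of_isCoprime hco
      simp only [Int.cast_natCast] at this
      rw [one_mul, hχ, this]
    · rw [zero_mul]
      apply MulChar.map_nonunit
      rw [ZMod.isUnit_iff_coprime]
      exact h
  have hsum : ∑ m ∈ Finset.Icc 1 M, ψ (m : ZMod q) = ∑ e ∈ q.divisors,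
      (ArithmeticFunction.moebius e : ℂ) * χ (e : ZMod f) *
        ∑ m ∈ Finset.Icc 1 (M / e), χ (m : ZMod f) := by
    rw [Finset.sum_congr rfl fun m _ => hval m, Finset.sum_comm]
    refine Finset.sum_congr rfl fun e he => ?_
    have he0 : 0 < e := Nat.pos_of_mem_divisors he
    rw [← Finset.sum_filter, Finset.mul_sum]
    symm
    refine Finset.sum_bij (fun m _ => e * m) ?_ ?_ ?_ ?_
    · intro m hm
      rw [Finset.mem_Icc] at hm
      rw [Finset.mem_filter, Finset.mem_Icc]
      refine ⟨⟨Nat.mul_pos he0 hm.1, ?_⟩, dvd_mul_right e m⟩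
      rw [mul_comm]
      exact (Nat.le_div_iff_mul_le he0).1 hm.2
    · intro m _ m' _ h
      exact Nat.eq_of_mul_eq_mul_left he0 h
    · intro n hn
      rw [Finset.mem_filter, Finset.mem_Icc] at hn
      obtain ⟨m, rfl⟩ := hn.2
      refine ⟨m, ?_, rfl⟩
      rw [Finset.mem_Icc]
      refine ⟨Nat.pos_of_mul_pos_left hn.1.1, (Nat.le_div_iff_mul_le he0).2 ?_⟩
      rw [mul_comm]
      exact hn.1.2
    · intro m _
      push_cast
      rw [map_mul]
      ring
  rw [hsum]
  refine (norm_sum_le _ _).trans ?_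
  rw [← nsmul_eq_mul]
  refine Finset.sum_le_card_nsmul _ _ _ fun e _ => ?_
  have hfle : (f : ℝ) ≤ q := by exact_mod_cast Nat.le_of_dvd (Nat.pos_of_ne_zero hq0) hfq
  have hf0 : (1 : ℝ) ≤ f := by exact_mod_cast Nat.pos_of_ne_zero (NeZero.ne f)
  rw [norm_mul, norm_mul]
  have hmu : ‖(ArithmeticFunction.moebius e : ℂ)‖ ≤ 1 := by
    rw [Complex.norm_intCast]
    exact_mod_cast ArithmeticFunction.abs_moebius_le_one
  have hlog : 0 ≤ Real.log f := Real.log_nonneg hf0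
  calc _ ≤ 1 * 1 * (√f * (1 + Real.log f)) := by
        gcongr
        · exact DirichletCharacter.norm_le_one _ _
        · exact norm_sum_le_of_isPrimitive hf1 hprim _
    _ ≤ √q * (1 + Real.log q) := by
        rw [one_mul, one_mul]
        gcongr

lemma exists_norm_sum_le_rpow {ε : ℝ} (hε : 0 < ε) : ∃ C : ℝ, 0 < C ∧
    ∀ (q : ℕ) [NeZero q] (ψ : DirichletCharacter ℂ q), ψ ≠ 1 → ∀ M : ℕ,
      ‖∑ m ∈ Finset.Icc 1 M, ψ (m : ZMod q)‖ ≤ C * (q : ℝ) ^ (1 / 2 + ε) := by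
  obtain ⟨C, hC, hdiv⟩ := exists_card_divisors_le (half_pos hε)
  refine ⟨C * (1 + 1 / (ε / 2)), by positivity, fun q _ ψ hψ M => ?_⟩
  have hq1 : (1 : ℝ) ≤ q := by exact_mod_cast Nat.pos_of_ne_zero (NeZero.ne q)
  have hq0 : (0 : ℝ) < q := by linarith
  have hlog : 1 + Real.log q ≤ (1 + 1 / (ε / 2)) * (q : ℝ) ^ (ε / 2) := by
    have h1 := Real.log_le_rpow_div hq0.le (half_pos hε)
    have h2 : 1 ≤ (q : ℝ) ^ (ε / 2) := Real.one_le_rpow hq1 (by positivity)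
    have : (q : ℝ) ^ (ε / 2) / (ε / 2) = 1 / (ε / 2) * (q : ℝ) ^ (ε / 2) := by ring
    linarith
  have hlog0 : 0 ≤ Real.log q := Real.log_nonneg hq1
  calc _ ≤ _ := norm_sum_le_of_ne_one hψ M
    _ ≤ (C * (q : ℝ) ^ (ε / 2)) * (√q * ((1 + 1 / (ε / 2)) * (q : ℝ) ^ (ε / 2))) := by
        gcongr
        exact hdiv q (NeZero.ne q)
    _ = C * (1 + 1 / (ε / 2)) * ((q : ℝ) ^ (1 / 2 : ℝ) * (q : ℝ) ^ (ε / 2) * (q : ℝ) ^ (ε / 2)) := by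
        rw [Real.sqrt_eq_rpow]; ring
    _ = _ := by
        rw [← Real.rpow_add hq0, ← Real.rpow_add hq0]
        congr 2
        ring

end PolyaVinogradov

end EllipticTwists

namespace EllipticTwists

/-! ### Dirichlet series over squarefree numbers -/

section DirichletSeries

open MeasureTheory Filter Topology Asymptotics

variable {q : ℕ}

/-- The partial sums of a Dirichlet character. -/
noncomputable def charSum (ψ : DirichletCharacter ℂ q) (t : ℝ) : ℂ :=
  ∑ m ∈ Finset.Icc 1 ⌊t⌋₊, ψ (m : ZMod q)

/-- The continuation of `L(w, ψ)` to the half-plane `Re w > 0` by partial summation, for a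
nontrivial character. -/
noncomputable def continuedL (ψ : DirichletCharacter ℂ q) (w : ℂ) : ℂ :=
  w * mellin (charSum ψ) (-w)

lemma charSum_of_lt_one (ψ : DirichletCharacter ℂ q) {t : ℝ} (ht : t < 1) : charSum ψ t = 0 := by
  rw [charSum, Nat.floor_eq_zero.2 ht]; simp

lemma norm_charSum_le_self (ψ : DirichletCharacter ℂ q) {t : ℝ} (ht : 0 ≤ t) :
    ‖charSum ψ t‖ ≤ t := by
  refine (norm_sum_le _ _).trans ?_
  refine (Finset.sum_le_card_nsmul _ _ 1 fun m _ => ψ.norm_le_one _).trans ?_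
  simpa using Nat.floor_le ht

lemma mellin_charSum (ψ : DirichletCharacter ℂ q) (w : ℂ) :
    mellin (charSum ψ) (-w) = ∫ t in Set.Ioi (1 : ℝ), charSum ψ t * (t : ℂ) ^ (-(w + 1)) := by
  rw [← integral_Ici_eq_integral_Ioi (x := (1 : ℝ)), mellin,
    setIntegral_eq_of_subset_of_forall_sdiff_eq_zero (s := Set.Ici (1 : ℝ))
      (t := Set.Ioi (0 : ℝ)) measurableSet_Ioi]
  · refine setIntegral_congr_fun measurableSet_Ici fun t _ => ?_
    simp only [smul_eq_mul]
    rw [mul_comm, neg_add']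
  · intro t ht
    exact lt_of_lt_of_le one_pos (Set.mem_Ici.1 ht)
  · intro t ht
    rw [charSum_of_lt_one ψ (not_le.1 ht.2), smul_zero]

lemma continuedL_eq_LSeries {ψ : DirichletCharacter ℂ q} {w : ℂ} (hw : 1 < w.re) :
    continuedL ψ w = LSeries (fun n => ψ (n : ZMod q)) w := by
  rw [LSeries_eq_mul_integral _ zero_le_one hw (ψ.LSeriesSummable_of_one_lt_re hw), continuedL,
    mellin_charSum]
  · rfl
  · refine IsBigO.of_bound 1 (Eventually.of_forall fun n => ?_)
    have := norm_charSum_le_self ψ (Nat.cast_nonneg (α := ℝ) n)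
    rw [charSum, Nat.floor_natCast] at this
    simpa using this

/-- The partial sums vanish near 0 and are bounded at infinity, so their Mellin transform is
holomorphic at -w for Re w > 0. -/
lemma differentiableAt_continuedL {ψ : DirichletCharacter ℂ q} {B : ℝ}
    (hB : ∀ M : ℕ, ‖∑ m ∈ Finset.Icc 1 M, ψ (m : ZMod q)‖ ≤ B) {w : ℂ} (hw : 0 < w.re) :
    DifferentiableAt ℂ (continuedL ψ) w := by
  have hmeas : Measurable (charSum ψ) :=
    (measurable_from_nat (f := fun M : ℕ => ∑ m ∈ Finset.Icc 1 M, ψ (m : ZMod q))).comp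
      Nat.measurable_floor
  have hloc : LocallyIntegrableOn (charSum ψ) (Set.Ioi 0) := by
    refine LocallyIntegrable.locallyIntegrableOn ?_ _
    refine (locallyIntegrable_const B).mono hmeas.aestronglyMeasurable
      (Eventually.of_forall fun t => ?_)
    exact (hB _).trans (le_abs_self B)
  have hd : DifferentiableAt ℂ (mellin (charSum ψ)) (-w) := by
    refine mellin_differentiableAt_of_isBigO_rpow (a := 0) (b := -w.re - 1) hloc ?_ (by simpa) ?_
      (by simp)
    · refine IsBigO.of_bound B (Eventually.of_forall fun t => ?_)
      simpa [charSum] using hB ⌊t⌋₊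
    · refine (EventuallyEq.trans_isBigO (f₂ := fun _ => (0 : ℂ)) ?_ (isBigO_zero _ _))
      filter_upwards [Ioo_mem_nhdsGT (zero_lt_one' ℝ)] with t ht
      exact charSum_of_lt_one ψ ht.2
  exact differentiableAt_id.mul (hd.comp w differentiableAt_id.neg)

/-- Both t and B bound the partial sum at t, hence so does √(tB), whose integral against t^{-Re w -
1} converges for Re w > 1/2. The factor √B halves the Pólya–Vinogradov exponent, from 1/2 to 1/4. -/
lemma norm_continuedL_le {ψ : DirichletCharacter ℂ q} {B : ℝ}
    (hB : ∀ M : ℕ, ‖∑ m ∈ Finset.Icc 1 M, ψ (m : ZMod q)‖ ≤ B) {δ : ℝ} (hδ : 0 < δ) {w : ℂ}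
    (hw : 1 / 2 + δ ≤ w.re) : ‖continuedL ψ w‖ ≤ ‖w‖ * (√B / δ) := by
  have hB0 : 0 ≤ B := (norm_nonneg _).trans (hB 0)
  rw [continuedL, norm_mul, mellin_charSum]
  gcongr
  have hint : ∫ t in Set.Ioi (1 : ℝ), √B * t ^ (-δ - 1) = √B / δ := by
    rw [integral_const_mul, integral_Ioi_rpow_of_lt (by linarith) one_pos]
    simp only [Real.one_rpow, sub_add_cancel]
    field_simp
  rw [← hint]
  refine norm_integral_le_of_norm_le
    ((integrableOn_Ioi_rpow_of_lt (by linarith) one_pos).const_mul _) ?_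
  refine (ae_restrict_iff' measurableSet_Ioi).2 (Eventually.of_forall fun t ht => ?_)
  have ht1 : (1 : ℝ) < t := ht
  have ht0 : 0 < t := by linarith
  rw [norm_mul, Complex.norm_cpow_eq_rpow_re_of_pos ht0]
  have h1 : ‖charSum ψ t‖ ≤ √B * t ^ (1 / 2 : ℝ) := by
    rw [← Real.sqrt_eq_rpow, ← Real.sqrt_mul hB0]
    refine Real.le_sqrt_of_sq_le ?_
    rw [sq]
    exact mul_le_mul (hB _) (norm_charSum_le_self ψ ht0.le) (norm_nonneg _) hB0
  calc _ ≤ √B * t ^ (1 / 2 : ℝ) * t ^ (-(w + 1)).re := by gcongr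
    _ = √B * t ^ (1 / 2 + (-(w + 1)).re) := by rw [mul_assoc, ← Real.rpow_add ht0]
    _ ≤ √B * t ^ (-δ - 1) := by
        gcongr
        · exact ht1.le
        · simp only [Complex.neg_re, Complex.add_re, Complex.one_re]
          linarith

/-- The restriction of a Dirichlet character to squarefree numbers. -/
noncomputable def squarefreeCoeff (ψ : DirichletCharacter ℂ q) (n : ℕ) : ℂ :=
  open Classical in if Squarefree n then ψ (n : ZMod q) else 0

lemma norm_squarefreeCoeff_le (ψ : DirichletCharacter ℂ q) (n : ℕ) :
    ‖squarefreeCoeff ψ n‖ ≤ 1 := by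
  rw [squarefreeCoeff]
  split_ifs
  · exact ψ.norm_le_one _
  · simp

lemma LSeriesSummable_squarefreeCoeff (ψ : DirichletCharacter ℂ q) {w : ℂ} (hw : 1 < w.re) :
    LSeriesSummable (squarefreeCoeff ψ) w :=
  LSeriesSummable_of_bounded_of_one_lt_re (fun n _ => norm_squarefreeCoeff_le ψ n) hw

/-- The inverse `1 / L(2 w, ψ ^ 2)` as a Dirichlet series. -/
noncomputable def inverseSquareL (ψ : DirichletCharacter ℂ q) (w : ℂ) : ℂ :=
  LSeries ((fun n : ℕ => (ψ ^ 2) (n : ZMod q)) *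
    fun n : ℕ => (ArithmeticFunction.moebius n : ℂ)) (2 * w)

lemma hasProd_squarefreeCoeff (ψ : DirichletCharacter ℂ q) {w : ℂ} (hw : 1 < w.re) :
    HasProd (fun p : Nat.Primes => 1 + ψ (p : ℕ) * ((p : ℕ) : ℂ) ^ (-w))
      (LSeries (squarefreeCoeff ψ) w) := by
  have hone : LSeries.term (squarefreeCoeff ψ) w 1 = 1 := by
    simp [LSeries.term, squarefreeCoeff]
  have hmul : ∀ {m n : ℕ}, m.Coprime n → LSeries.term (squarefreeCoeff ψ) w (m * n) =
      LSeries.term (squarefreeCoeff ψ) w m * LSeries.term (squarefreeCoeff ψ) w n := by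
    intro m n hmn
    rcases eq_or_ne m 0 with rfl | hm
    · simp
    rcases eq_or_ne n 0 with rfl | hn
    · simp
    rw [LSeries.term_of_ne_zero (mul_ne_zero hm hn), LSeries.term_of_ne_zero hm,
      LSeries.term_of_ne_zero hn, Nat.cast_mul, Complex.natCast_mul_natCast_cpow]
    simp only [squarefreeCoeff, Nat.squarefree_mul hmn]
    by_cases h1 : Squarefree m <;> by_cases h2 : Squarefree n <;> simp [h1, h2]
    field_simp
  have h := EulerProduct.eulerProduct_hasProd hone hmul
    (LSeriesSummable_squarefreeCoeff ψ hw).norm (LSeries.term_zero _ _)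
  convert! h using 2 with p
  rw [tsum_eq_sum (s := Finset.range 2)]
  · rw [Finset.sum_range_succ, Finset.sum_range_one, pow_zero, pow_one, hone,
      LSeries.term_of_ne_zero p.2.ne_zero, squarefreeCoeff,
      if_pos (Irreducible.squarefree p.2), Complex.cpow_neg, div_eq_mul_inv]
  · intro e he
    have he2 : 1 < e := by simpa using he
    rw [LSeries.term_of_ne_zero (pow_ne_zero _ p.2.ne_zero), squarefreeCoeff, if_neg, zero_div]
    rw [Nat.squarefree_pow_iff p.2.ne_one (by omega)]
    omega

/-- Compare Euler factors: 1 + x = (1 - x²) / (1 - x) with x = ψ(p) p^{-w}. -/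
lemma LSeries_squarefreeCoeff (ψ : DirichletCharacter ℂ q) {w : ℂ} (hw : 1 < w.re) :
    LSeries (squarefreeCoeff ψ) w =
      LSeries (fun n => ψ (n : ZMod q)) w * inverseSquareL ψ w := by
  have hw2 : 1 < (2 * w).re := by simp; linarith
  have h1 := (hasProd_squarefreeCoeff ψ hw).mul
    (DirichletCharacter.LSeries_eulerProduct_hasProd (ψ ^ 2) hw2)
  have h2 := DirichletCharacter.LSeries_eulerProduct_hasProd ψ hw
  have hfun : (fun p : Nat.Primes => (1 + ψ (p : ℕ) * ((p : ℕ) : ℂ) ^ (-w)) *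
      (1 - (ψ ^ 2) (p : ℕ) * ((p : ℕ) : ℂ) ^ (-(2 * w)))⁻¹) =
      fun p : Nat.Primes => (1 - ψ (p : ℕ) * ((p : ℕ) : ℂ) ^ (-w))⁻¹ := by
    funext p
    have hp0 : (p : ℕ) ≠ 0 := p.2.ne_zero
    set x := ψ (p : ℕ) * ((p : ℕ) : ℂ) ^ (-w) with hx
    have hx2 : (ψ ^ 2) (p : ℕ) * ((p : ℕ) : ℂ) ^ (-(2 * w)) = x ^ 2 := by
      rw [hx, mul_pow, MulChar.pow_apply' _ two_ne_zero, ← Complex.cpow_nat_mul]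
      congr 2
      push_cast
      ring
    have hxn : ‖x‖ < 1 := by
      rw [hx, norm_mul, Complex.norm_natCast_cpow_of_pos p.2.pos]
      calc _ ≤ 1 * ((p : ℕ) : ℝ) ^ (-w).re := by
            gcongr
            exact ψ.norm_le_one _
        _ < 1 := by
            rw [one_mul]
            apply Real.rpow_lt_one_of_one_lt_of_neg
            · exact_mod_cast p.2.one_lt
            · simp; linarith
    have h1x : 1 - x ≠ 0 := fun h => by
      have : x = 1 := (sub_eq_zero.1 h).symm
      rw [this] at hxn; simp at hxn
    have h2x : 1 + x ≠ 0 := fun h => by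
      have : x = -1 := (neg_eq_of_add_eq_zero_right h).symm
      rw [this] at hxn; simp at hxn
    rw [hx2, show 1 - x ^ 2 = (1 + x) * (1 - x) by ring]
    field_simp
  rw [hfun] at h1
  have h3 := h1.unique h2
  have h4 := DirichletCharacter.LSeries.mul_mu_eq_one (ψ ^ 2) hw2
  rw [← h3, inverseSquareL, mul_assoc, h4, mul_one]

lemma LSeriesSummable_inverseSquareL (ψ : DirichletCharacter ℂ q) {s : ℂ} (hs : 1 < s.re) :
    LSeriesSummable ((fun n : ℕ => (ψ ^ 2) (n : ZMod q)) *
      fun n : ℕ => (ArithmeticFunction.moebius n : ℂ)) s :=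
  DirichletCharacter.LSeriesSummable_mul _ (ArithmeticFunction.LSeriesSummable_moebius_iff.2 hs)

lemma differentiableAt_inverseSquareL (ψ : DirichletCharacter ℂ q) {w : ℂ} (hw : 1 / 2 < w.re) :
    DifferentiableAt ℂ (inverseSquareL ψ) w := by
  have habs : LSeries.abscissaOfAbsConv ((fun n : ℕ => (ψ ^ 2) (n : ZMod q)) *
      fun n : ℕ => (ArithmeticFunction.moebius n : ℂ)) ≤ (1 : ℝ) :=
    LSeries.abscissaOfAbsConv_le_of_forall_lt_LSeriesSummable fun y hy =>
      LSeriesSummable_inverseSquareL ψ (by simpa using hy)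
  have h1 : 1 < (2 * w).re := by simp; linarith
  have hd := (LSeries_hasDerivAt (habs.trans_lt (by exact_mod_cast h1))).differentiableAt
  exact hd.comp w (differentiableAt_id.const_mul 2)

lemma norm_inverseSquareL_le (ψ : DirichletCharacter ℂ q) {δ : ℝ} (hδ : 0 < δ) {w : ℂ}
    (hw : 1 / 2 + δ ≤ w.re) :
    ‖inverseSquareL ψ w‖ ≤ ∑' n : ℕ, (n : ℝ) ^ (-(1 + 2 * δ)) := by
  have hsum : Summable fun n : ℕ => (n : ℝ) ^ (-(1 + 2 * δ)) :=
    Real.summable_nat_rpow.2 (by linarith)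
  rw [inverseSquareL, LSeries]
  refine tsum_of_norm_bounded hsum.hasSum fun n => ?_
  rcases Nat.eq_zero_or_pos n with rfl | hn
  · simp [Real.rpow_nonneg]
  rw [LSeries.term_of_ne_zero hn.ne', norm_div, Complex.norm_natCast_cpow_of_pos hn,
    Real.rpow_neg (by positivity), Pi.mul_apply, norm_mul, div_eq_mul_inv]
  have hmu : ‖(ArithmeticFunction.moebius n : ℂ)‖ ≤ 1 := by
    rw [Complex.norm_intCast]
    exact_mod_cast ArithmeticFunction.abs_moebius_le_one
  have hn1 : (1 : ℝ) ≤ n := by exact_mod_cast hn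
  calc _ ≤ 1 * 1 * ((n : ℝ) ^ (2 * w).re)⁻¹ := by
        gcongr
        exact (ψ ^ 2).norm_le_one _
    _ ≤ ((n : ℝ) ^ (1 + 2 * δ))⁻¹ := by
        rw [one_mul, one_mul]
        apply inv_anti₀ (by positivity)
        apply Real.rpow_le_rpow_of_exponent_le hn1
        simp
        linarith

lemma norm_prod_one_sub_le (hq : q ≠ 0) {w : ℂ} (hw : 0 ≤ w.re) :
    ‖∏ p ∈ q.primeFactors, (1 - (p : ℂ) ^ (-w))‖ ≤ q.divisors.card := by
  rw [norm_prod, Nat.card_divisors hq]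
  push_cast
  refine Finset.prod_le_prod (fun _ _ => norm_nonneg _) fun p hp => ?_
  have hpp := Nat.prime_of_mem_primeFactors hp
  have h1 : ‖(p : ℂ) ^ (-w)‖ ≤ 1 := by
    rw [Complex.norm_natCast_cpow_of_pos hpp.pos]
    exact Real.rpow_le_one_of_one_le_of_nonpos (by exact_mod_cast hpp.one_lt.le) (by simpa)
  have h2 : (1 : ℝ) ≤ q.factorization p := by
    exact_mod_cast (hpp.dvd_iff_one_le_factorization hq).1 (Nat.dvd_of_mem_primeFactors hp)
  calc ‖1 - (p : ℂ) ^ (-w)‖ ≤ ‖(1 : ℂ)‖ + ‖(p : ℂ) ^ (-w)‖ := norm_sub_le _ _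
    _ ≤ _ := by rw [norm_one]; linarith

variable [NeZero q]

/-- The continuation of `(w - 1) ∑ ψ(m) m ^ (-w)`, the sum over squarefree `m`, to the half-plane
`Re w > 1 / 2`. -/
noncomputable def squarefreeSeries (ψ : DirichletCharacter ℂ q) (w : ℂ) : ℂ :=
  open Classical in
  (if ψ = 1 then DirichletCharacter.LFunctionTrivChar₁ q w else (w - 1) * continuedL ψ w) *
    inverseSquareL ψ w

lemma squarefreeSeries_eq (ψ : DirichletCharacter ℂ q) {w : ℂ} (hw : 1 < w.re) :
    squarefreeSeries ψ w = (w - 1) * LSeries (squarefreeCoeff ψ) w := by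
  have hw1 : w ≠ 1 := by rintro rfl; simp at hw
  rw [squarefreeSeries, LSeries_squarefreeCoeff ψ hw, ← mul_assoc]
  congr 1
  split_ifs with h
  · rw [DirichletCharacter.LFunctionTrivChar₁, Function.update_of_ne hw1, h,
      DirichletCharacter.LFunctionTrivChar, DirichletCharacter.LFunction_eq_LSeries _ hw]
  · rw [continuedL_eq_LSeries hw]

lemma differentiableAt_squarefreeSeries (ψ : DirichletCharacter ℂ q) {w : ℂ}
    (hw : 1 / 2 < w.re) : DifferentiableAt ℂ (squarefreeSeries ψ) w := by
  unfold squarefreeSeries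
  refine DifferentiableAt.mul ?_ (differentiableAt_inverseSquareL ψ hw)
  by_cases h : ψ = 1
  · simp only [h, if_true]
    exact DirichletCharacter.differentiable_LFunctionTrivChar₁ q w
  · simp only [h, if_false]
    exact (differentiableAt_id.sub_const 1).mul
      (differentiableAt_continuedL (norm_sum_le_of_ne_one h) (by linarith))

lemma squarefreeSeries_one_of_ne_one {ψ : DirichletCharacter ℂ q} (hψ : ψ ≠ 1) :
    squarefreeSeries ψ 1 = 0 := by
  simp [squarefreeSeries, hψ]

/-- The residue ∏ (1 - p^{-1}) of the principal L-function is divided by its value ζ(2) ∏ (1 -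
p^{-2}) at 2, which leaves p / (p + 1) for each p dividing q. -/
lemma squarefreeSeries_one_one :
    squarefreeSeries (1 : DirichletCharacter ℂ q) 1 = aFactor q / riemannZeta 2 := by
  have h2 : 1 < (2 * 1 : ℂ).re := by simp
  have hinv := DirichletCharacter.LSeries.mul_mu_eq_one ((1 : DirichletCharacter ℂ q) ^ 2) h2
  rw [one_pow] at hinv
  have hL : LSeries (fun n => (1 : DirichletCharacter ℂ q) (n : ZMod q)) (2 * 1) =
      (∏ p ∈ q.primeFactors, (1 - (p : ℂ) ^ (-(2 * 1) : ℂ))) * riemannZeta (2 * 1) := by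
    rw [← DirichletCharacter.LFunction_eq_LSeries _ h2]
    exact DirichletCharacter.LFunctionTrivChar_eq_mul_riemannZeta (by norm_num)
  rw [squarefreeSeries, if_pos rfl, DirichletCharacter.LFunctionTrivChar₁, Function.update_self,
    inverseSquareL, one_pow, eq_div_iff (riemannZeta_ne_zero_of_one_lt_re (by simp))]
  rw [hL, mul_one] at hinv
  rw [mul_one, aFactor]
  set M := LSeries ((fun n : ℕ => (1 : DirichletCharacter ℂ q) (n : ZMod q)) *
    fun n : ℕ => (ArithmeticFunction.moebius n : ℂ)) 2 with hM
  have hsplit : ∏ p ∈ q.primeFactors, (1 - (p : ℂ)⁻¹) =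
      (∏ p ∈ q.primeFactors, (p : ℂ) / ((p : ℂ) + 1)) *
        ∏ p ∈ q.primeFactors, (1 - (p : ℂ) ^ (-2 : ℂ)) := by
    rw [← Finset.prod_mul_distrib]
    refine Finset.prod_congr rfl fun p hp => ?_
    have hp0 : (p : ℂ) ≠ 0 := by exact_mod_cast (Nat.prime_of_mem_primeFactors hp).ne_zero
    have hp1 : (p : ℂ) + 1 ≠ 0 := by exact_mod_cast Nat.succ_ne_zero p
    rw [Complex.cpow_neg, show (2 : ℂ) = ((2 : ℕ) : ℂ) by norm_num, Complex.cpow_natCast]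
    field_simp
    ring
  rw [hsplit]
  linear_combination (∏ p ∈ q.primeFactors, (p : ℂ) / ((p : ℂ) + 1)) * hinv

/-- All dependence on q sits in a finite product, bounded by the number of divisors of q; the other
factor is a fixed entire function. -/
lemma LFunctionTrivChar₁_eq_mul (w : ℂ) :
    DirichletCharacter.LFunctionTrivChar₁ q w =
      DirichletCharacter.LFunctionTrivChar₁ 1 w * ∏ p ∈ q.primeFactors, (1 - (p : ℂ) ^ (-w)) := by
  rcases eq_or_ne w 1 with rfl | hw
  · rw [DirichletCharacter.LFunctionTrivChar₁, DirichletCharacter.LFunctionTrivChar₁,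
      Function.update_self, Function.update_self]
    simp [Complex.cpow_neg_one]
  · rw [DirichletCharacter.LFunctionTrivChar₁, DirichletCharacter.LFunctionTrivChar₁,
      Function.update_of_ne hw, Function.update_of_ne hw,
      DirichletCharacter.LFunctionTrivChar_eq_mul_riemannZeta hw,
      DirichletCharacter.LFunctionTrivChar_eq_mul_riemannZeta hw]
    simp
    ring

/-- The convexity bound for the squarefree series. -/
lemma exists_norm_squarefreeSeries_le {ε δ : ℝ} (hε : 0 < ε) (hδ : 0 < δ) (R : ℝ) :
    ∃ C : ℝ, 0 ≤ C ∧ ∀ (q : ℕ) [NeZero q] (ψ : DirichletCharacter ℂ q) (w : ℂ),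
      1 / 2 + δ ≤ w.re → ‖w‖ ≤ R → ‖squarefreeSeries ψ w‖ ≤ C * (q : ℝ) ^ (1 / 4 + ε) := by
  obtain ⟨C₁, hC₁, hdiv⟩ := exists_card_divisors_le hε
  obtain ⟨C₂, hC₂, hpv⟩ := exists_norm_sum_le_rpow hε
  obtain ⟨C₃, hC₃⟩ := (isCompact_closedBall (0 : ℂ) R).exists_bound_of_continuousOn
    (DirichletCharacter.differentiable_LFunctionTrivChar₁ 1).continuous.continuousOn
  set Z := ∑' n : ℕ, (n : ℝ) ^ (-(1 + 2 * δ)) with hZ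
  have hZ0 : 0 ≤ Z := tsum_nonneg fun n => by positivity
  refine ⟨(|C₃| * C₁ + (|R| + 1) * (|R| * (√C₂ / δ))) * Z, by positivity,
    fun q _ ψ w hw hwR => ?_⟩
  have hq1 : (1 : ℝ) ≤ q := by exact_mod_cast Nat.pos_of_ne_zero (NeZero.ne q)
  have hwR' : ‖w‖ ≤ |R| := hwR.trans (le_abs_self R)
  rw [squarefreeSeries, norm_mul]
  have hmain : ‖(open Classical in if ψ = 1 then DirichletCharacter.LFunctionTrivChar₁ q w
      else (w - 1) * continuedL ψ w)‖ ≤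
      (|C₃| * C₁ + (|R| + 1) * (|R| * (√C₂ / δ))) * (q : ℝ) ^ (1 / 4 + ε) := by
    split_ifs with h
    · rw [LFunctionTrivChar₁_eq_mul, norm_mul]
      have hd : ‖DirichletCharacter.LFunctionTrivChar₁ 1 w‖ ≤ |C₃| :=
        (hC₃ w (by simpa using hwR)).trans (le_abs_self _)
      calc _ ≤ |C₃| * (C₁ * (q : ℝ) ^ ε) := by
            gcongr
            exact (norm_prod_one_sub_le (NeZero.ne q) (by linarith)).trans
              (hdiv q (NeZero.ne q))
        _ ≤ |C₃| * (C₁ * (q : ℝ) ^ (1 / 4 + ε)) := by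
            gcongr
            linarith
        _ = |C₃| * C₁ * (q : ℝ) ^ (1 / 4 + ε) := by ring
        _ ≤ _ := by
            gcongr
            have : 0 ≤ (|R| + 1) * (|R| * (√C₂ / δ)) := by positivity
            linarith
    · rw [norm_mul]
      have hsub : ‖w - 1‖ ≤ |R| + 1 := (norm_sub_le _ _).trans (by rw [norm_one]; linarith)
      have hL := norm_continuedL_le (hpv q ψ h) hδ hw
      have hsqrt : √(C₂ * (q : ℝ) ^ (1 / 2 + ε)) ≤ √C₂ * (q : ℝ) ^ (1 / 4 + ε) := by
        rw [Real.sqrt_mul hC₂.le]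
        gcongr
        rw [Real.sqrt_eq_rpow, ← Real.rpow_mul (by positivity)]
        apply Real.rpow_le_rpow_of_exponent_le hq1
        linarith
      calc _ ≤ (|R| + 1) * (|R| * (√C₂ * (q : ℝ) ^ (1 / 4 + ε) / δ)) := by
            gcongr
            exact hL.trans (by gcongr)
        _ = (|R| + 1) * (|R| * (√C₂ / δ)) * (q : ℝ) ^ (1 / 4 + ε) := by ring
        _ ≤ _ := by
            gcongr
            have : 0 ≤ |C₃| * C₁ := by positivity
            linarith
  calc _ ≤ ((|C₃| * C₁ + (|R| + 1) * (|R| * (√C₂ / δ))) * (q : ℝ) ^ (1 / 4 + ε)) * Z := by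
        gcongr
        exact norm_inverseSquareL_le ψ hδ hw
    _ = _ := by ring

end DirichletSeries

end EllipticTwists

namespace EllipticTwists

/-! ### The Kronecker symbol -/

section Kronecker

open Classical

lemma kroneckerSym_of_ne_zero (d : ℤ) {n : ℕ} (hn : n ≠ 0) :
    kroneckerSym d n =
      ZMod.χ₈ (d : ZMod 8) ^ n.factorization 2 * jacobiSym d (n / 2 ^ n.factorization 2) := by
  rw [kroneckerSym, if_neg hn]

lemma kroneckerSym_mul_right (d : ℤ) {a b : ℕ} (ha : a ≠ 0) (hb : b ≠ 0) :
    kroneckerSym d (a * b) = kroneckerSym d a * kroneckerSym d b := by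
  have : NeZero (a / 2 ^ a.factorization 2) := ⟨(Nat.ordCompl_pos 2 ha).ne'⟩
  have : NeZero (b / 2 ^ b.factorization 2) := ⟨(Nat.ordCompl_pos 2 hb).ne'⟩
  rw [kroneckerSym_of_ne_zero d (mul_ne_zero ha hb), kroneckerSym_of_ne_zero d ha,
    kroneckerSym_of_ne_zero d hb, Nat.ordCompl_mul, jacobiSym.mul_right,
    Nat.factorization_mul ha hb, Finsupp.add_apply, pow_add]
  ring

lemma kroneckerSym_mul_left (a b : ℤ) {n : ℕ} (hn : n ≠ 0) :
    kroneckerSym (a * b) n = kroneckerSym a n * kroneckerSym b n := by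
  rw [kroneckerSym_of_ne_zero _ hn, kroneckerSym_of_ne_zero _ hn, kroneckerSym_of_ne_zero _ hn,
    jacobiSym.mul_left, Int.cast_mul, map_mul, mul_pow]
  ring

lemma kroneckerSym_one_left {n : ℕ} (hn : n ≠ 0) : kroneckerSym 1 n = 1 := by
  rw [kroneckerSym_of_ne_zero _ hn, jacobiSym.one_left, Int.cast_one, map_one, one_pow, one_mul]

lemma kroneckerSym_one_right (d : ℤ) : kroneckerSym d 1 = 1 := by
  rw [kroneckerSym_of_ne_zero _ one_ne_zero]
  simp

/-- For fixed n the symbol depends on its upper argument only modulo 8 and modulo the odd part of n.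
Hence it is a character in that argument without any appeal to reciprocity. -/
lemma kroneckerSym_congr {a b : ℤ} {n : ℕ} (hn : n ≠ 0) (h8 : a ≡ b [ZMOD 8])
    (h : a ≡ b [ZMOD n]) : kroneckerSym a n = kroneckerSym b n := by
  rw [kroneckerSym_of_ne_zero _ hn, kroneckerSym_of_ne_zero _ hn,
    (ZMod.intCast_eq_intCast_iff a b 8).2 h8]
  congr 1
  apply jacobiSym.mod_left'
  exact h.of_dvd (Int.natCast_dvd_natCast.2 (Nat.ordCompl_dvd n 2))

lemma abs_chi_eight_le (a : ZMod 8) : |ZMod.χ₈ a| ≤ 1 := by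
  revert a; decide

lemma abs_jacobiSym_le (a : ℤ) (b : ℕ) : |jacobiSym a b| ≤ 1 := by
  rcases jacobiSym.trichotomy a b with h | h | h <;> simp [h]

lemma abs_kroneckerSym_le (d : ℤ) (n : ℕ) : |kroneckerSym d n| ≤ 1 := by
  rw [kroneckerSym]
  split_ifs
  · simp
  · simp
  · rw [abs_mul, abs_pow]
    exact mul_le_one₀ (pow_le_one₀ (abs_nonneg _) (abs_chi_eight_le _)) (abs_nonneg _)
      (abs_jacobiSym_le _ _)

lemma norm_kroneckerSym_le (d : ℤ) (n : ℕ) : ‖(kroneckerSym d n : ℂ)‖ ≤ 1 := by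
  rw [Complex.norm_intCast]
  exact_mod_cast abs_kroneckerSym_le d n

lemma kroneckerSym_eq_zero {d : ℤ} {n : ℕ} (hn : n ≠ 0) (h : d.gcd n ≠ 1) :
    kroneckerSym d n = 0 := by
  rw [kroneckerSym_of_ne_zero _ hn]
  obtain ⟨p, hp, hpd⟩ := Nat.exists_prime_and_dvd h
  have hpd1 : (p : ℤ) ∣ d := (Int.natCast_dvd_natCast.2 hpd).trans (Int.gcd_dvd_left ..)
  have hpn : p ∣ n := by
    exact_mod_cast (Int.natCast_dvd_natCast.2 hpd).trans (Int.gcd_dvd_right d (n : ℤ))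
  by_cases h2 : p = 2
  · subst h2
    have : ZMod.χ₈ (d : ZMod 8) = 0 := by
      rw [ZMod.χ₈_int_eq_if_mod_eight, if_pos (by omega)]
    rw [this, zero_pow, zero_mul]
    exact (hp.factorization_pos_of_dvd hn hpn).ne'
  · have ho : p ∣ n / 2 ^ n.factorization 2 := by
      have hcop : p.Coprime (2 ^ n.factorization 2) :=
        Nat.Coprime.pow_right _ ((Nat.coprime_primes hp Nat.prime_two).2 h2)
      refine hcop.dvd_of_dvd_mul_left ?_
      rwa [Nat.ordProj_mul_ordCompl_eq_self]
    have : NeZero (n / 2 ^ n.factorization 2) := ⟨(Nat.ordCompl_pos 2 hn).ne'⟩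
    rw [jacobiSym.eq_zero_iff_not_coprime.2, mul_zero]
    intro h1
    have : p ∣ 1 := by
      rw [← h1]
      exact Int.dvd_gcd hpd1 (by exact_mod_cast ho)
    exact hp.one_lt.ne' (Nat.dvd_one.1 this)

lemma kroneckerSym_sq {d : ℤ} {n : ℕ} (hn : n ≠ 0) (hd : Odd d) (h : d.gcd n = 1) :
    kroneckerSym d n * kroneckerSym d n = 1 := by
  rw [kroneckerSym_of_ne_zero _ hn, mul_mul_mul_comm, ← mul_pow]
  have h1 : ZMod.χ₈ (d : ZMod 8) * ZMod.χ₈ (d : ZMod 8) = 1 := by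
    rw [ZMod.χ₈_int_eq_if_mod_eight, if_neg (by rcases hd with ⟨c, rfl⟩; omega)]
    split_ifs <;> simp
  rw [h1, one_pow, one_mul, ← sq]
  refine jacobiSym.sq_one ?_
  refine Nat.Coprime.coprime_dvd_right (k := d.natAbs) ?_ h
  exact Nat.ordCompl_dvd n 2

lemma kroneckerSym_odd (d : ℤ) {n : ℕ} (hn : Odd n) : kroneckerSym d n = jacobiSym d n := by
  rw [kroneckerSym_of_ne_zero _ hn.pos.ne', Nat.factorization_eq_zero_of_not_dvd
    hn.not_two_dvd_nat]
  simp

lemma jacobiSym_two_sq {n : ℕ} (hn : Odd n) : jacobiSym 2 n ^ 2 = 1 := by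
  refine jacobiSym.sq_one ?_
  exact (Nat.coprime_two_left.2 hn)

end Kronecker

/-! ### The characters m ↦ χ₄(m)^i χ_m(n), and when they are trivial -/

section Characters

open Classical

/-- A periodic completely multiplicative function which vanishes off the residues prime to `q`, as
a Dirichlet character. -/
lemma exists_dirichletCharacter {q : ℕ} [NeZero q] (h : ℕ → ℤ) (h1 : h 1 = 1)
    (hmul : ∀ a b, h (a * b) = h a * h b) (hmod : ∀ a, h (a % q) = h a)
    (h0 : ∀ a, ¬ a.Coprime q → h a = 0) :
    ∃ ψ : DirichletCharacter ℂ q, ∀ a : ℕ, ψ (a : ZMod q) = h a := by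
  refine ⟨⟨⟨⟨fun x => h x.val, ?_⟩, fun x y => ?_⟩, fun x hx => ?_⟩, fun a => ?_⟩
  · simp only [ZMod.val_one_eq_one_mod]
    rw [hmod, h1, Int.cast_one]
  · simp only [ZMod.val_mul]
    rw [hmod, hmul, Int.cast_mul]
  · simp only
    rw [h0, Int.cast_zero]
    rw [← ZMod.isUnit_iff_coprime, ZMod.natCast_zmod_val]
    exact hx
  · change ((h (ZMod.val (a : ZMod q)) : ℤ) : ℂ) = h a
    rw [ZMod.val_natCast, hmod]

/-- The values `χ₄(m)^i χ_m(n)`, restricted to `m` prime to `8 N n`. -/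
noncomputable def discWeight (N n i m : ℕ) : ℤ :=
  if m.Coprime (8 * N * n) then ZMod.χ₄ (m : ZMod 4) ^ i * kroneckerSym m n else 0

lemma discWeight_mod {N n : ℕ} (hn : n ≠ 0) (i m : ℕ) :
    discWeight N n i (m % (8 * N * n)) = discWeight N n i m := by
  have hc : (m % (8 * N * n)).Coprime (8 * N * n) ↔ m.Coprime (8 * N * n) := by
    rw [Nat.Coprime, Nat.Coprime, ← Nat.gcd_rec, Nat.gcd_comm]
  have hz : ((m % (8 * N * n) : ℕ) : ℤ) ≡ m [ZMOD ((8 * N * n : ℕ) : ℤ)] := by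
    rw [Int.natCast_modEq_iff]
    exact Nat.mod_modEq _ _
  have h4 : ((m % (8 * N * n) : ℕ) : ZMod 4) = m := by
    rw [ZMod.natCast_eq_natCast_iff]
    exact (Nat.mod_modEq m (8 * N * n)).of_dvd ⟨2 * N * n, by ring⟩
  have h8 : kroneckerSym ((m % (8 * N * n) : ℕ) : ℤ) n = kroneckerSym m n :=
    kroneckerSym_congr hn (hz.of_dvd ⟨N * n, by push_cast; ring⟩)
      (hz.of_dvd ⟨8 * N, by push_cast; ring⟩)
  simp only [discWeight, hc, h4, h8]

/-- In the modulus, 8 carries χ₄ and χ₈ and forces m odd, N imposes coprimality to the conductor,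
and n carries the Jacobi symbol. -/
lemma exists_discChar {N n : ℕ} (hN : N ≠ 0) (hn : n ≠ 0) (i : ℕ) :
    ∃ ψ : DirichletCharacter ℂ (8 * N * n), ∀ m : ℕ, ψ (m : ZMod (8 * N * n)) =
      discWeight N n i m := by
  have : NeZero (8 * N * n) := ⟨by positivity⟩
  refine exists_dirichletCharacter _ ?_ (fun a b => ?_) (discWeight_mod hn i)
    (fun a ha => if_neg ha)
  · rw [discWeight, if_pos (Nat.coprime_one_left _), Nat.cast_one, Nat.cast_one, map_one, one_pow,
      kroneckerSym_one_left hn, one_mul]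
  · simp only [discWeight, Nat.coprime_mul_iff_left]
    by_cases ha : a.Coprime (8 * N * n)
    · by_cases hb : b.Coprime (8 * N * n)
      · rw [if_pos ⟨ha, hb⟩, if_pos ha, if_pos hb]
        rw [Nat.cast_mul, Nat.cast_mul, map_mul, kroneckerSym_mul_left _ _ hn, mul_pow]
        ring
      · simp [hb]
    · simp [ha]

/-- The character modulo `8 N n` with values `χ₄(m)^i χ_m(n)`. -/
noncomputable def discChar (N n i : ℕ) : DirichletCharacter ℂ (8 * N * n) :=
  -- The fallback value 1 is never reached for nonzero N and n.
  if h : ∃ ψ : DirichletCharacter ℂ (8 * N * n), ∀ m : ℕ, ψ (m : ZMod (8 * N * n)) =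
      discWeight N n i m then h.choose else 1

lemma discChar_apply {N n : ℕ} (hN : N ≠ 0) (hn : n ≠ 0) (i m : ℕ) :
    discChar N n i (m : ZMod (8 * N * n)) = discWeight N n i m := by
  rw [discChar, dif_pos (exists_discChar hN hn i)]
  exact (exists_discChar hN hn i).choose_spec m

lemma odd_of_coprime_eight_mul {N n m : ℕ} (h : m.Coprime (8 * N * n)) : Odd m := by
  rw [← Nat.coprime_two_right]
  exact h.coprime_dvd_right ⟨4 * N * n, by ring⟩

lemma discChar_zero_eq_one {N n : ℕ} (hN : N ≠ 0) (hn : n ≠ 0) (h : IsSquare n) :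
    discChar N n 0 = 1 := by
  have : NeZero (8 * N * n) := ⟨by positivity⟩
  obtain ⟨a, rfl⟩ := h
  have ha : a ≠ 0 := fun h => hn (by simp [h])
  ext u
  have hu : (((u : ZMod (8 * N * (a * a))).val : ℕ) : ZMod (8 * N * (a * a))) = u :=
    ZMod.natCast_zmod_val _
  have hc : (u : ZMod (8 * N * (a * a))).val.Coprime (8 * N * (a * a)) := ZMod.val_coe_unit_coprime u
  rw [MulChar.one_apply_coe, ← hu, discChar_apply hN hn, discWeight, if_pos hc, pow_zero, one_mul,
    kroneckerSym_mul_right _ ha ha, kroneckerSym_sq ha, Int.cast_one]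
  · exact_mod_cast odd_of_coprime_eight_mul hc
  · refine Nat.Coprime.coprime_dvd_right ?_ hc
    exact ⟨8 * N * a, by rw [Int.natAbs_natCast]; ring⟩

lemma discChar_ne_one {N n i m : ℕ} (hN : N ≠ 0) (hn : n ≠ 0) (hm : m.Coprime (8 * N * n))
    (h : ZMod.χ₄ (m : ZMod 4) ^ i * kroneckerSym m n = -1) : discChar N n i ≠ 1 := by
  intro h1
  have h2 := discChar_apply hN hn i m
  rw [h1, discWeight, if_pos hm, h, MulChar.one_apply ((ZMod.isUnit_iff_coprime _ _).2 hm)] at h2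
  norm_num at h2

/-- There is an `m` prime to `q`, congruent to `a` modulo the `p`-part of `q` and to `1` modulo the
rest. -/
lemma exists_modEq_ordProj {q p : ℕ} (hq : q ≠ 0) (hp : p.Prime) {a : ℕ}
    (ha : ¬ p ∣ a) : ∃ m : ℕ, m ≡ a [MOD p ^ q.factorization p] ∧
      m ≡ 1 [MOD q / p ^ q.factorization p] ∧ m.Coprime q := by
  have hcop : (p ^ q.factorization p).Coprime (q / p ^ q.factorization p) :=
    Nat.Coprime.pow_left _ (Nat.coprime_ordCompl hp hq)
  obtain ⟨m, h1, h2⟩ := Nat.chineseRemainder hcop a 1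
  refine ⟨m, h1, h2, ?_⟩
  rw [← Nat.ordProj_mul_ordCompl_eq_self q p, Nat.coprime_mul_iff_right]
  constructor
  · rw [Nat.Coprime, h1.gcd_eq]
    exact Nat.Coprime.pow_right _ ((Nat.Prime.coprime_iff_not_dvd hp).2 ha).symm
  · rw [Nat.Coprime, h2.gcd_eq, Nat.gcd_one_left]

/-- Since 8 divides the 2-part of 8Nn, the class of m modulo 8 can be prescribed while the Jacobi
symbol at the odd part of n is kept equal to 1. -/
lemma exists_modEq_eight {N n : ℕ} (hN : N ≠ 0) (hn : n ≠ 0) {a : ℕ} (ha : Odd a) :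
    ∃ m : ℕ, m % 8 = a % 8 ∧ m ≡ 1 [MOD n / 2 ^ n.factorization 2] ∧ m.Coprime (8 * N * n) := by
  have hq : 8 * N * n ≠ 0 := by positivity
  obtain ⟨m, h1, h2, h3⟩ := exists_modEq_ordProj hq Nat.prime_two
    ha.not_two_dvd_nat
  refine ⟨m, ?_, ?_, h3⟩
  · refine h1.of_dvd (show 2 ^ 3 ∣ _ from pow_dvd_pow 2 ?_)
    exact (Nat.prime_two.pow_dvd_iff_le_factorization hq).1 ⟨N * n, by ring⟩
  · refine h2.of_dvd ?_
    rw [Nat.ordCompl_mul]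
    exact Dvd.intro_left _ rfl

lemma jacobiSym_eq_one_of_modEq {m o : ℕ} (h : m ≡ 1 [MOD o]) : jacobiSym m o = 1 := by
  rw [jacobiSym.mod_left' (b := o) (a₁ := m) (a₂ := 1) (by exact_mod_cast (Int.natCast_modEq_iff.2 h)),
    jacobiSym.one_left]

/-- Both χ₄ and χ₈ are -1 at 3, while at 5 only χ₈ is. So m ≡ 3 mod 8 is a witness when n has even
2-adic valuation, and m ≡ 5 otherwise. Consequently the χ₄-twist never produces a pole. -/
lemma discChar_one_ne_one {N n : ℕ} (hN : N ≠ 0) (hn : n ≠ 0) : discChar N n 1 ≠ 1 := by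
  by_cases he : Even (n.factorization 2)
  · obtain ⟨m, h1, h2, h3⟩ := exists_modEq_eight hN hn (a := 3) (by decide)
    refine discChar_ne_one hN hn h3 ?_
    have h8 : ZMod.χ₈ ((m : ℤ) : ZMod 8) = -1 := by
      rw [Int.cast_natCast, ZMod.χ₈_nat_eq_if_mod_eight, if_neg (by omega), if_neg (by omega)]
    have h4 : ZMod.χ₄ (m : ZMod 4) = -1 := by
      rw [ZMod.χ₄_nat_eq_if_mod_four, if_neg (by omega), if_neg (by omega)]
    rw [kroneckerSym_of_ne_zero _ hn, jacobiSym_eq_one_of_modEq h2, h8, h4, he.neg_one_pow]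
    norm_num
  · obtain ⟨m, h1, h2, h3⟩ := exists_modEq_eight hN hn (a := 5) (by decide)
    refine discChar_ne_one hN hn h3 ?_
    have h8 : ZMod.χ₈ ((m : ℤ) : ZMod 8) = -1 := by
      rw [Int.cast_natCast, ZMod.χ₈_nat_eq_if_mod_eight, if_neg (by omega), if_neg (by omega)]
    have h4 : ZMod.χ₄ (m : ZMod 4) = 1 := by
      rw [ZMod.χ₄_nat_eq_if_mod_four, if_neg (by omega), if_pos (by omega)]
    rw [kroneckerSym_of_ne_zero _ hn, jacobiSym_eq_one_of_modEq h2, h8, h4,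
      (Nat.not_even_iff_odd.1 he).neg_one_pow]
    norm_num

lemma isSquare_of_even_factorization {n : ℕ} (hn : n ≠ 0)
    (h : ∀ p, p.Prime → Even (n.factorization p)) : IsSquare n := by
  obtain ⟨a, b, hab, ha⟩ := Nat.sq_mul_squarefree n
  have ha0 : a ≠ 0 := ha.ne_zero
  have hb0 : b ≠ 0 := by rintro rfl; simp at hab; exact hn hab.symm
  suffices a = 1 by
    subst this
    exact ⟨b, by rw [← hab]; ring⟩
  by_contra ha1
  obtain ⟨p, hp, hpa⟩ := Nat.exists_prime_and_dvd ha1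
  have h1 := h p hp
  rw [← hab, Nat.factorization_mul (pow_ne_zero _ hb0) ha0, Finsupp.add_apply,
    Nat.factorization_pow, Finsupp.smul_apply, smul_eq_mul] at h1
  have h2 := ha.natFactorization_le_one p
  have h3 := hp.factorization_pos_of_dvd ha0 hpa
  rw [show a.factorization p = 1 by omega] at h1
  rcases h1 with ⟨c, hc⟩
  omega

/-- Some prime p has odd exponent in n. If 2 does, take m ≡ 5 mod 8; otherwise take m a nonresidue
modulo an odd such p and m ≡ 1 away from p. -/
lemma discChar_zero_ne_one {N n : ℕ} (hN : N ≠ 0) (hn : n ≠ 0) (h : ¬ IsSquare n) :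
    discChar N n 0 ≠ 1 := by
  by_cases he : Even (n.factorization 2)
  · obtain ⟨p, hp, hpo⟩ : ∃ p, p.Prime ∧ ¬ Even (n.factorization p) := by
      by_contra! hcon
      exact h (isSquare_of_even_factorization hn hcon)
    have hp2 : p ≠ 2 := by rintro rfl; exact hpo he
    have : Fact p.Prime := ⟨hp⟩
    have hpn : p ∣ n := by
      by_contra hpn
      exact hpo (by rw [Nat.factorization_eq_zero_of_not_dvd hpn]; exact Even.zero)
    obtain ⟨x, hx⟩ := FiniteField.exists_nonsquare (F := ZMod p)
      (by rwa [ZMod.ringChar_zmod_n])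
    have hx0 : x ≠ 0 := by rintro rfl; exact hx (IsSquare.zero)
    have hq : 8 * N * n ≠ 0 := by positivity
    have ha : ¬ p ∣ x.val := by
      rwa [← ZMod.natCast_eq_zero_iff, ZMod.natCast_zmod_val]
    obtain ⟨m, h1, h2, h3⟩ := exists_modEq_ordProj hq hp ha
    refine discChar_ne_one hN hn h3 ?_
    have hfac : 0 < n.factorization p := hp.factorization_pos_of_dvd hn hpn
    have hle : n.factorization p ≤ (8 * N * n).factorization p := by
      rw [Nat.factorization_mul (by positivity) hn, Finsupp.add_apply]
      omega
    have hmp : m ≡ x.val [MOD p] :=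
      h1.of_dvd (dvd_pow_self p (by omega))
    set o := n / 2 ^ n.factorization 2 with ho
    have ho0 : o ≠ 0 := (Nat.ordCompl_pos 2 hn).ne'
    have hofac : o.factorization p = n.factorization p := by
      rw [ho, Nat.factorization_ordCompl, Finsupp.erase_ne hp2]
    have hmo : m ≡ 1 [MOD o / p ^ o.factorization p] := by
      refine h2.of_dvd ?_
      rw [Nat.ordCompl_mul]
      refine Dvd.dvd.mul_left ?_ _
      exact Nat.ordCompl_dvd_ordCompl_of_dvd (Nat.ordCompl_dvd n 2) p
    have hleg : jacobiSym m p = -1 := by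
      rw [← jacobiSym.legendreSym.to_jacobiSym, legendreSym.eq_neg_one_iff]
      rwa [Int.cast_natCast, (ZMod.natCast_eq_natCast_iff m x.val p).2 hmp, ZMod.natCast_zmod_val]
    have : NeZero (o / p ^ o.factorization p) := ⟨(Nat.ordCompl_pos p ho0).ne'⟩
    have : NeZero (p ^ o.factorization p) := ⟨pow_ne_zero _ hp.ne_zero⟩
    rw [pow_zero, one_mul, kroneckerSym_of_ne_zero _ hn, ← ho,
      ← Nat.ordProj_mul_ordCompl_eq_self o p, jacobiSym.mul_right, jacobiSym.pow_right,
      jacobiSym_eq_one_of_modEq hmo, hleg, hofac, (Nat.not_even_iff_odd.1 hpo).neg_one_pow]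
    have hodd : Odd m := odd_of_coprime_eight_mul h3
    have h8 : ZMod.χ₈ ((m : ℤ) : ZMod 8) ^ 2 = 1 := by
      rw [ZMod.χ₈_int_eq_if_mod_eight, if_neg (by rcases hodd with ⟨c, rfl⟩; omega)]
      split_ifs <;> simp
    obtain ⟨c, hc⟩ := he
    rw [hc, ← two_mul, pow_mul, h8, one_pow]
    norm_num
  · obtain ⟨m, h1, h2, h3⟩ := exists_modEq_eight hN hn (a := 5) (by decide)
    refine discChar_ne_one hN hn h3 ?_
    have h8 : ZMod.χ₈ ((m : ℤ) : ZMod 8) = -1 := by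
      rw [Int.cast_natCast, ZMod.χ₈_nat_eq_if_mod_eight, if_neg (by omega), if_neg (by omega)]
    rw [kroneckerSym_of_ne_zero _ hn, jacobiSym_eq_one_of_modEq h2, h8,
      (Nat.not_even_iff_odd.1 he).neg_one_pow]
    norm_num

end Characters

end EllipticTwists

namespace EllipticTwists

/-! ### Character sums over fundamental discriminants -/

section Discriminants

open Classical

/-- The values `χ_d(n)`, restricted to the positive fundamental discriminants `d` prime to `N`. -/
noncomputable def discCoeff (N n d : ℕ) : ℂ :=
  if d ∈ Discriminants N then (kroneckerSym d n : ℂ) else 0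

lemma discWeight_eq_zero_of_even {N n i m : ℕ} (hm : ¬ Odd m) : discWeight N n i m = 0 :=
  if_neg fun h => hm (odd_of_coprime_eight_mul h)

lemma chi_four_eq_one {m : ℕ} (hm : m % 4 = 1) : ZMod.χ₄ (m : ZMod 4) = 1 := by
  rw [ZMod.χ₄_nat_eq_if_mod_four, if_neg (by omega), if_pos hm]

lemma chi_four_eq_neg_one {m : ℕ} (hm : m % 4 = 3) : ZMod.χ₄ (m : ZMod 4) = -1 := by
  rw [ZMod.χ₄_nat_eq_if_mod_four, if_neg (by omega), if_neg (by omega)]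

lemma discWeight_of_odd {N n m : ℕ} (hn : n ≠ 0) (i : ℕ) (hm : Odd m) :
    discWeight N n i m = ZMod.χ₄ (m : ZMod 4) ^ i *
      if m.Coprime N then kroneckerSym m n else 0 := by
  rw [discWeight]
  have h8 : m.Coprime 8 := by
    rw [show 8 = 2 ^ 3 by norm_num]
    exact Nat.Coprime.pow_right _ (Nat.coprime_two_right.2 hm)
  by_cases hN : m.Coprime N
  · by_cases hmn : m.Coprime n
    · rw [if_pos ((h8.mul_right hN).mul_right hmn), if_pos hN]
    · rw [if_neg (fun h => hmn (Nat.Coprime.coprime_mul_left_right h)), if_pos hN,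
        kroneckerSym_eq_zero hn (by exact_mod_cast hmn), mul_zero]
  · rw [if_neg hN, mul_zero, if_neg]
    exact fun h => hN (h.coprime_dvd_right ⟨8 * n, by ring⟩)

lemma mem_discriminants_of_mod_four {N m : ℕ} (hm : m % 4 = 1) :
    m ∈ Discriminants N ↔ Squarefree m ∧ m.Coprime N := by
  have : 0 < m := by omega
  simp only [Discriminants, Set.mem_ofPred_eq, IsFundamentalDiscriminant, Int.squarefree_natCast]
  constructor
  · rintro ⟨_, h | ⟨a, ha, -⟩, h3⟩
    · exact ⟨h.2, h3⟩
    · omega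
  · rintro ⟨h1, h2⟩
    exact ⟨this, Or.inl ⟨by omega, h1⟩, h2⟩

lemma mem_discriminants_four_mul {N m : ℕ} (hm : m % 4 = 3) :
    4 * m ∈ Discriminants N ↔ Squarefree m ∧ (4 * m).Coprime N := by
  have : 0 < m := by omega
  simp only [Discriminants, Set.mem_ofPred_eq, IsFundamentalDiscriminant]
  constructor
  · rintro ⟨_, h | ⟨a, ha, -, hsq⟩, h3⟩
    · push_cast at h; omega
    · have : a = m := by push_cast at ha; omega
      rw [this, Int.squarefree_natCast] at hsq
      exact ⟨hsq, h3⟩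
  · rintro ⟨h1, h2⟩
    exact ⟨by omega, Or.inr ⟨m, by push_cast; ring, by omega, Int.squarefree_natCast.2 h1⟩, h2⟩

lemma squarefree_two_mul_iff {m : ℕ} (hm : Odd m) : Squarefree (2 * m) ↔ Squarefree m := by
  rw [Nat.squarefree_mul (Nat.coprime_two_left.2 hm)]
  simp [Nat.prime_two.prime.squarefree]

lemma mem_discriminants_eight_mul {N m : ℕ} (hm : Odd m) :
    8 * m ∈ Discriminants N ↔ Squarefree m ∧ (8 * m).Coprime N := by
  have : 0 < m := hm.pos
  simp only [Discriminants, Set.mem_ofPred_eq, IsFundamentalDiscriminant]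
  constructor
  · rintro ⟨_, h | ⟨a, ha, -, hsq⟩, h3⟩
    · push_cast at h; omega
    · have : a = ((2 * m : ℕ) : ℤ) := by push_cast at ha ⊢; omega
      rw [this, Int.squarefree_natCast, squarefree_two_mul_iff hm] at hsq
      exact ⟨hsq, h3⟩
  · rintro ⟨h1, h2⟩
    refine ⟨by omega, Or.inr ⟨((2 * m : ℕ) : ℤ), by push_cast; ring, ?_, Int.squarefree_natCast.2
      ((squarefree_two_mul_iff hm).2 h1)⟩, h2⟩
    obtain ⟨c, rfl⟩ := hm
    omega

/-- The coefficients of the part of the sum over `d ≡ 1 mod 4`. -/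
noncomputable def oddPart (N n m : ℕ) : ℂ :=
  2⁻¹ * (squarefreeCoeff (discChar N n 0) m + squarefreeCoeff (discChar N n 1) m)

/-- The coefficients of the part of the sum over `d = 4 m` with `m ≡ 3 mod 4`. -/
noncomputable def fourPart (N n m : ℕ) : ℂ :=
  if Odd (N * n) then
    2⁻¹ * (squarefreeCoeff (discChar N n 0) m - squarefreeCoeff (discChar N n 1) m) else 0

/-- The coefficients of the part of the sum over `d = 8 m` with `m` odd. -/
noncomputable def eightPart (N n m : ℕ) : ℂ :=
  if Odd (N * n) then jacobiSym 2 n * squarefreeCoeff (discChar N n 0) m else 0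

lemma squarefreeCoeff_discChar {N n : ℕ} (hN : N ≠ 0) (hn : n ≠ 0) (i m : ℕ) :
    squarefreeCoeff (discChar N n i) m = if Squarefree m then (discWeight N n i m : ℂ) else 0 := by
  rw [squarefreeCoeff, discChar_apply hN hn]

/-- On odd m, (1 + χ₄) / 2 is the indicator of m ≡ 1 mod 4. Requiring m prime to n changes nothing,
as χ_m(n) = 0 otherwise. -/
lemma oddPart_eq {N n : ℕ} (hN : N ≠ 0) (hn : n ≠ 0) (m : ℕ) :
    oddPart N n m = if m % 4 = 1 then discCoeff N n m else 0 := by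
  rw [oddPart, squarefreeCoeff_discChar hN hn, squarefreeCoeff_discChar hN hn]
  by_cases hodd : Odd m
  · rw [discWeight_of_odd hn _ hodd, discWeight_of_odd hn _ hodd]
    by_cases hm : m % 4 = 1
    · rw [if_pos hm, discCoeff, chi_four_eq_one hm]
      simp only [mem_discriminants_of_mod_four hm]
      by_cases h1 : Squarefree m <;> by_cases h2 : m.Coprime N <;> simp [h1, h2]
      ring
    · rw [if_neg hm, chi_four_eq_neg_one (by rcases hodd with ⟨c, rfl⟩; omega)]
      split_ifs <;> simp
  · have h4 : ¬ m % 4 = 1 := by rw [Nat.odd_iff] at hodd; omega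
    rw [discWeight_eq_zero_of_even hodd, discWeight_eq_zero_of_even hodd]
    simp [h4]

lemma kroneckerSym_eq_zero_of_even {d : ℤ} {n : ℕ} (hn : n ≠ 0) (hd : 2 ∣ d) (h2 : 2 ∣ n) :
    kroneckerSym d n = 0 := by
  refine kroneckerSym_eq_zero hn fun h => ?_
  have : 2 ∣ d.gcd n := Int.dvd_gcd hd (by exact_mod_cast h2)
  omega

/-- An even d is excluded when N is even and has χ_d(n) = 0 when n is even; hence the parity
condition in `fourPart` and `eightPart`. -/
lemma discCoeff_eq_zero_of_even {N n d : ℕ} (hn : n ≠ 0) (hd : 2 ∣ d) (h : ¬ Odd (N * n)) :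
    discCoeff N n d = 0 := by
  rw [discCoeff]
  split_ifs with hmem
  · rw [Nat.not_odd_iff_even, Nat.even_mul] at h
    rcases h with h | h
    · have : 2 ∣ d.gcd N := Nat.dvd_gcd hd h.two_dvd
      rw [hmem.2.2] at this
      omega
    · rw [kroneckerSym_eq_zero_of_even hn (by exact_mod_cast hd) h.two_dvd, Int.cast_zero]
  · rfl

lemma fourPart_eq {N n : ℕ} (hN : N ≠ 0) (hn : n ≠ 0) (m : ℕ) :
    fourPart N n m = if m % 4 = 3 then discCoeff N n (4 * m) else 0 := by
  rw [fourPart]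
  by_cases hNn : Odd (N * n)
  swap
  · rw [if_neg hNn, discCoeff_eq_zero_of_even hn ⟨2 * m, by ring⟩ hNn, ite_self]
  rw [if_pos hNn, squarefreeCoeff_discChar hN hn, squarefreeCoeff_discChar hN hn]
  obtain ⟨hNo, hno⟩ := Nat.odd_mul.1 hNn
  by_cases hodd : Odd m
  · rw [discWeight_of_odd hn _ hodd, discWeight_of_odd hn _ hodd]
    by_cases hm : m % 4 = 3
    · have h4 : (4 : ℕ).Coprime N := by
        rw [show 4 = 2 ^ 2 by norm_num]
        exact Nat.Coprime.pow_left _ (Nat.coprime_two_left.2 hNo)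
      have hk : kroneckerSym ((4 * m : ℕ) : ℤ) n = kroneckerSym m n := by
        rw [kroneckerSym_odd _ hno, kroneckerSym_odd _ hno,
          show ((4 * m : ℕ) : ℤ) = 2 ^ 2 * m by push_cast; ring, jacobiSym.mul_left,
          jacobiSym.pow_left, jacobiSym_two_sq hno, one_mul]
      rw [if_pos hm, discCoeff, chi_four_eq_neg_one hm, hk]
      have hmem : 4 * m ∈ Discriminants N ↔ Squarefree m ∧ m.Coprime N := by
        rw [mem_discriminants_four_mul hm, Nat.coprime_mul_iff_left, and_iff_right h4]
      simp only [hmem]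
      by_cases h1 : Squarefree m <;> by_cases h2 : m.Coprime N <;> simp [h1, h2]
      rw [if_pos h2, if_pos h2]
      ring
    · rw [if_neg hm, chi_four_eq_one (by rcases hodd with ⟨c, rfl⟩; omega)]
      split_ifs <;> simp
  · have h4 : ¬ m % 4 = 3 := by rw [Nat.odd_iff] at hodd; omega
    rw [discWeight_eq_zero_of_even hodd, discWeight_eq_zero_of_even hodd]
    simp [h4]

/-- For odd n one has χ_{8m}(n) = (2/n) χ_m(n), and both odd classes of m modulo 4 are allowed, so
χ₄ is not needed. -/
lemma eightPart_eq {N n : ℕ} (hN : N ≠ 0) (hn : n ≠ 0) (m : ℕ) :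
    eightPart N n m = if Odd m then discCoeff N n (8 * m) else 0 := by
  rw [eightPart]
  by_cases hNn : Odd (N * n)
  swap
  · rw [if_neg hNn, discCoeff_eq_zero_of_even hn ⟨4 * m, by ring⟩ hNn, ite_self]
  rw [if_pos hNn, squarefreeCoeff_discChar hN hn]
  obtain ⟨hNo, hno⟩ := Nat.odd_mul.1 hNn
  by_cases hodd : Odd m
  · rw [discWeight_of_odd hn _ hodd]
    have h8 : (8 : ℕ).Coprime N := by
      rw [show 8 = 2 ^ 3 by norm_num]
      exact Nat.Coprime.pow_left _ (Nat.coprime_two_left.2 hNo)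
    have hk : kroneckerSym ((8 * m : ℕ) : ℤ) n = jacobiSym 2 n * kroneckerSym m n := by
      rw [kroneckerSym_odd _ hno, kroneckerSym_odd _ hno,
        show ((8 * m : ℕ) : ℤ) = 2 ^ 2 * (2 * m) by push_cast; ring, jacobiSym.mul_left,
        jacobiSym.pow_left, jacobiSym_two_sq hno, one_mul, jacobiSym.mul_left]
    rw [if_pos hodd, discCoeff, hk]
    have hmem : 8 * m ∈ Discriminants N ↔ Squarefree m ∧ m.Coprime N := by
      rw [mem_discriminants_eight_mul hodd, Nat.coprime_mul_iff_left, and_iff_right h8]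
    simp only [hmem]
    by_cases h1 : Squarefree m <;> by_cases h2 : m.Coprime N <;> simp [h1, h2]
  · rw [discWeight_eq_zero_of_even hodd, if_neg hodd]
    simp

lemma mod_of_mem_discriminants {N d : ℕ} (h : d ∈ Discriminants N) :
    d % 4 = 1 ∨ d % 16 = 12 ∨ d % 16 = 8 := by
  rcases h.2.1 with ⟨h, -⟩ | ⟨a, h1, h2, -⟩ <;> omega

/-- The three shapes of d are disjoint: d ≡ 1 mod 4, d ≡ 12 mod 16 and d ≡ 8 mod 16. -/
lemma discCoeff_eq {N n : ℕ} (hN : N ≠ 0) (hn : n ≠ 0) (d : ℕ) :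
    discCoeff N n d = oddPart N n d + (if 4 ∣ d then fourPart N n (d / 4) else 0) +
      if 8 ∣ d then eightPart N n (d / 8) else 0 := by
  rw [oddPart_eq hN hn, fourPart_eq hN hn, eightPart_eq hN hn]
  by_cases h1 : d % 4 = 1
  · rw [if_pos h1, if_neg (by omega), if_neg (by omega)]; ring
  rw [if_neg h1]
  by_cases h2 : d % 16 = 12
  · rw [if_pos (by omega), if_pos (by omega), if_neg (by omega),
      Nat.mul_div_cancel' (by omega : 4 ∣ d)]
    ring
  by_cases h3 : d % 16 = 8
  · rw [if_pos (by omega), if_neg (by omega), if_pos (by omega),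
      if_pos (Nat.odd_iff.2 (by omega)), Nat.mul_div_cancel' (by omega : 8 ∣ d)]
    ring
  have h0 : discCoeff N n d = 0 :=
    if_neg fun h => by rcases mod_of_mem_discriminants h with h | h | h <;> omega
  have h4 : ∀ c : ℕ, c ∣ d → discCoeff N n (c * (d / c)) = 0 := fun c hc => by
    rw [Nat.mul_div_cancel' hc, h0]
  have ha : (if 4 ∣ d then if d / 4 % 4 = 3 then discCoeff N n (4 * (d / 4)) else 0 else 0) = 0 := by
    split_ifs with hd
    · exact h4 4 hd
    · rfl
    · rfl
  have hb : (if 8 ∣ d then if Odd (d / 8) then discCoeff N n (8 * (d / 8)) else 0 else 0) = 0 := by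
    split_ifs with hd
    · exact h4 8 hd
    · rfl
    · rfl
  rw [h0, ha, hb]
  ring

lemma term_dilate (g : ℕ → ℂ) (w : ℂ) {c : ℕ} (hc : c ≠ 0) (m : ℕ) :
    LSeries.term (fun d => if c ∣ d then g (d / c) else 0) w (c * m) =
      (c : ℂ) ^ (-w) * LSeries.term g w m := by
  rcases eq_or_ne m 0 with rfl | hm
  · simp
  rw [LSeries.term_of_ne_zero (mul_ne_zero hc hm), LSeries.term_of_ne_zero hm,
    if_pos (Dvd.intro _ rfl), Nat.mul_div_cancel_left _ (Nat.pos_of_ne_zero hc), Nat.cast_mul,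
    Complex.natCast_mul_natCast_cpow, Complex.cpow_neg]
  ring

lemma LSeriesHasSum_dilate {g : ℕ → ℂ} {w a : ℂ} {c : ℕ} (hc : c ≠ 0)
    (h : LSeriesHasSum g w a) :
    LSeriesHasSum (fun d => if c ∣ d then g (d / c) else 0) w ((c : ℂ) ^ (-w) * a) := by
  rw [LSeriesHasSum, ← (mul_right_injective₀ hc).hasSum_iff]
  · have h1 : LSeries.term (fun d => if c ∣ d then g (d / c) else 0) w ∘ (fun m => c * m) =
        fun m => (c : ℂ) ^ (-w) * LSeries.term g w m := funext (term_dilate g w hc)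
    rw [h1]
    exact HasSum.mul_left _ h
  · intro d hd
    rcases eq_or_ne d 0 with rfl | hd0
    · simp
    · rw [LSeries.term_of_ne_zero hd0, if_neg, zero_div]
      rintro ⟨m, rfl⟩
      exact hd ⟨m, rfl⟩

/-- The continuation of `(w - 1) ∑_d χ_d(n) d^{-w}`, where `d` runs over the positive fundamental
discriminants prime to `N`. -/
noncomputable def discSeries (N n : ℕ) [NeZero N] [NeZero n] (w : ℂ) : ℂ :=
  2⁻¹ * (squarefreeSeries (discChar N n 0) w + squarefreeSeries (discChar N n 1) w) +
    (4 : ℂ) ^ (-w) * (if Odd (N * n) then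
      2⁻¹ * (squarefreeSeries (discChar N n 0) w - squarefreeSeries (discChar N n 1) w) else 0) +
    (8 : ℂ) ^ (-w) *
      (if Odd (N * n) then jacobiSym 2 n * squarefreeSeries (discChar N n 0) w else 0)

variable (N n : ℕ) [NeZero N] [NeZero n]

lemma LSeriesHasSum_discCoeff {w : ℂ} (hw : 1 < w.re) :
    LSeriesHasSum (discCoeff N n) w ((w - 1)⁻¹ * discSeries N n w) := by
  have hN : N ≠ 0 := NeZero.ne N
  have hn : n ≠ 0 := NeZero.ne n
  have hw1 : w - 1 ≠ 0 := by
    intro h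
    rw [sub_eq_zero.1 h] at hw
    simp at hw
  have h : ∀ i, LSeriesHasSum (squarefreeCoeff (discChar N n i)) w
      ((w - 1)⁻¹ * squarefreeSeries (discChar N n i) w) := fun i => by
    rw [squarefreeSeries_eq _ hw, inv_mul_cancel_left₀ hw1]
    exact (LSeriesSummable_squarefreeCoeff _ hw).LSeriesHasSum
  have hodd : LSeriesHasSum (oddPart N n) w ((w - 1)⁻¹ *
      (2⁻¹ * (squarefreeSeries (discChar N n 0) w + squarefreeSeries (discChar N n 1) w))) := by
    convert ((h 0).add (h 1)).smul 2⁻¹ using 1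
    · funext m
      simp [oddPart]
    · ring
  have hzero : LSeriesHasSum (fun _ => 0) w 0 := by
    have : LSeries.term (fun _ => 0) w = 0 := by
      funext m
      simp [LSeries.term]
    rw [LSeriesHasSum, this]
    exact hasSum_zero
  have hfour : LSeriesHasSum (fourPart N n) w ((w - 1)⁻¹ * (if Odd (N * n) then
      2⁻¹ * (squarefreeSeries (discChar N n 0) w - squarefreeSeries (discChar N n 1) w)
        else 0)) := by
    by_cases ho : Odd (N * n)
    · simp only [if_pos ho]
      convert ((h 0).sub (h 1)).smul 2⁻¹ using 1
      · funext m
        simp [fourPart, if_pos ho]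
      · ring
    · simp only [if_neg ho, mul_zero]
      convert hzero using 1
      funext m
      simp only [fourPart, if_neg ho]
  have height : LSeriesHasSum (eightPart N n) w ((w - 1)⁻¹ *
      (if Odd (N * n) then jacobiSym 2 n * squarefreeSeries (discChar N n 0) w else 0)) := by
    by_cases ho : Odd (N * n)
    · simp only [if_pos ho]
      convert (h 0).smul (jacobiSym 2 n : ℂ) using 1
      · funext m
        simp [eightPart, if_pos ho]
      · ring
    · simp only [if_neg ho, mul_zero]
      convert hzero using 1
      funext m
      simp only [eightPart, if_neg ho]
  convert (hodd.add (LSeriesHasSum_dilate four_ne_zero hfour)).add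
    (LSeriesHasSum_dilate (by norm_num : 8 ≠ 0) height) using 1
  · funext d
    exact discCoeff_eq hN hn d
  · rw [discSeries]
    push_cast
    ring

lemma differentiableAt_discSeries {w : ℂ} (hw : 1 / 2 < w.re) :
    DifferentiableAt ℂ (discSeries N n) w := by
  have h0 := differentiableAt_squarefreeSeries (discChar N n 0) hw
  have h1 := differentiableAt_squarefreeSeries (discChar N n 1) hw
  have h4 : DifferentiableAt ℂ (fun w : ℂ => (4 : ℂ) ^ (-w)) w :=
    (differentiableAt_id.neg).const_cpow (Or.inl (by norm_num))
  have h8 : DifferentiableAt ℂ (fun w : ℂ => (8 : ℂ) ^ (-w)) w :=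
    (differentiableAt_id.neg).const_cpow (Or.inl (by norm_num))
  unfold discSeries
  by_cases ho : Odd (N * n)
  · simp only [if_pos ho]
    exact (((h0.add h1).const_mul _).add (h4.mul ((h0.sub h1).const_mul _))).add
      (h8.mul (h0.const_mul _))
  · simp only [if_neg ho, mul_zero, add_zero]
    exact (h0.add h1).const_mul _

lemma aFactor_eight_mul {m : ℕ} (hm : m ≠ 0) :
    aFactor (8 * m) = if Odd m then 2 / 3 * aFactor m else aFactor m := by
  have h8 : (8 * m).primeFactors = insert 2 m.primeFactors := by
    rw [Nat.primeFactors_mul (by norm_num) hm, show 8 = 2 ^ 3 by norm_num,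
      Nat.primeFactors_prime_pow (by norm_num) Nat.prime_two]
    rfl
  rw [aFactor, aFactor, h8]
  split_ifs with h
  · rw [Finset.prod_insert]
    · norm_num
    · exact fun h2 => h.not_two_dvd_nat (Nat.dvd_of_mem_primeFactors h2)
  · rw [Finset.insert_eq_of_mem]
    exact Nat.mem_primeFactors.2 ⟨Nat.prime_two, (Nat.not_odd_iff_even.1 h).two_dvd, hm⟩

/-- For n a square and Nn odd, the classes contribute 1/2 + 1/8 + 1/8 = 3/4 of a(8Nn) / ζ(2), and
a(8Nn) = (2/3) a(Nn). For Nn even only the first class survives and a(8Nn) = a(Nn). The factor is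
1/2 in both cases. -/
lemma discSeries_one : discSeries N n 1 =
    if IsSquare n then 1 / (2 * riemannZeta 2) * aFactor (N * n) else 0 := by
  have hN : N ≠ 0 := NeZero.ne N
  have hn : n ≠ 0 := NeZero.ne n
  rw [discSeries, squarefreeSeries_one_of_ne_one (discChar_one_ne_one hN hn)]
  by_cases hsq : IsSquare n
  · rw [if_pos hsq, discChar_zero_eq_one hN hn hsq, squarefreeSeries_one_one, mul_assoc 8,
      aFactor_eight_mul (mul_ne_zero hN hn)]
    by_cases ho : Odd (N * n)
    · have hj : jacobiSym 2 n = 1 := by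
        obtain ⟨a, rfl⟩ := hsq
        have hao : Odd a := (Nat.odd_mul.1 (Nat.odd_mul.1 ho).2).1
        have : NeZero a := ⟨hao.pos.ne'⟩
        rw [jacobiSym.mul_right, ← sq, jacobiSym_two_sq hao]
      simp only [if_pos ho, hj, Int.cast_one, Complex.cpow_neg, Complex.cpow_one]
      field_simp
      ring
    · simp only [if_neg ho, mul_zero, add_zero]
      field_simp
  · rw [if_neg hsq, squarefreeSeries_one_of_ne_one (discChar_zero_ne_one hN hn hsq)]
    simp

end Discriminants

/-! ### Bounds for the discriminant series, uniform in n -/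

section DiscriminantBounds

lemma exists_norm_discSeries_le (N : ℕ) [NeZero N] {ε δ : ℝ} (hε : 0 < ε) (hδ : 0 < δ) (R : ℝ) :
    ∃ C, 0 ≤ C ∧ ∀ (n : ℕ) [NeZero n] (w : ℂ), 1 / 2 + δ ≤ w.re → ‖w‖ ≤ R →
      ‖discSeries N n w‖ ≤ C * (n : ℝ) ^ (1 / 4 + ε) := by
  obtain ⟨C, hC, h⟩ := exists_norm_squarefreeSeries_le hε hδ R
  refine ⟨3 * C * (8 * N : ℝ) ^ (1 / 4 + ε), by positivity, fun n _ w hw hR => ?_⟩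
  have h0 := h (8 * N * n) (discChar N n 0) w hw hR
  have h1 := h (8 * N * n) (discChar N n 1) w hw hR
  set B := C * ((8 * N * n : ℕ) : ℝ) ^ (1 / 4 + ε) with hB
  have hB0 : 0 ≤ B := by positivity
  have hpow : ∀ c : ℕ, 1 ≤ c → ‖(c : ℂ) ^ (-w)‖ ≤ 1 := fun c hc => by
    rw [Complex.norm_natCast_cpow_of_pos (by omega)]
    refine Real.rpow_le_one_of_one_le_of_nonpos (by exact_mod_cast hc) ?_
    rw [Complex.neg_re]
    linarith
  have h4 : ‖(4 : ℂ) ^ (-w)‖ ≤ 1 := by exact_mod_cast hpow 4 (by norm_num)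
  have h8 : ‖(8 : ℂ) ^ (-w)‖ ≤ 1 := by exact_mod_cast hpow 8 (by norm_num)
  have ha : ‖2⁻¹ * (squarefreeSeries (discChar N n 0) w + squarefreeSeries (discChar N n 1) w)‖ ≤
      B := by
    rw [norm_mul, norm_inv, Complex.norm_two]
    have := norm_add_le (squarefreeSeries (discChar N n 0) w) (squarefreeSeries (discChar N n 1) w)
    linarith
  have hb : ‖(if Odd (N * n) then 2⁻¹ * (squarefreeSeries (discChar N n 0) w -
      squarefreeSeries (discChar N n 1) w) else 0 : ℂ)‖ ≤ B := by
    split_ifs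
    · rw [norm_mul, norm_inv, Complex.norm_two]
      have := norm_sub_le (squarefreeSeries (discChar N n 0) w)
        (squarefreeSeries (discChar N n 1) w)
      linarith
    · rwa [norm_zero]
  have hc : ‖(if Odd (N * n) then jacobiSym 2 n * squarefreeSeries (discChar N n 0) w
      else 0 : ℂ)‖ ≤ B := by
    split_ifs
    · rw [norm_mul]
      refine (mul_le_of_le_one_left (norm_nonneg _) ?_).trans h0
      rw [Complex.norm_intCast]
      exact_mod_cast abs_jacobiSym_le 2 n
    · rwa [norm_zero]
  have htot : ‖discSeries N n w‖ ≤ 3 * B := by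
    rw [discSeries]
    refine (norm_add₃_le).trans ?_
    have hb' := (norm_mul_le _ _).trans (mul_le_mul h4 hb (norm_nonneg _) zero_le_one)
    have hc' := (norm_mul_le _ _).trans (mul_le_mul h8 hc (norm_nonneg _) zero_le_one)
    linarith
  refine htot.trans (le_of_eq ?_)
  rw [hB, Nat.cast_mul, Nat.cast_mul, Real.mul_rpow (by positivity) (by positivity)]
  push_cast
  ring

/-- The sums `∑_d χ_d(n) d^{-w}` over the positive fundamental discriminants prime to `N`:
continuation to `Re w > 1/2`, residue at `w = 1`, and a bound uniform in `n`. -/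
theorem exists_discSeries {N : ℕ} (hN : N ≠ 0) : ∃ G : ℕ → ℂ → ℂ,
    (∀ n, n ≠ 0 → ∀ w : ℂ, 1 / 2 < w.re → DifferentiableAt ℂ (G n) w) ∧
    (∀ n, n ≠ 0 → ∀ w : ℂ, 1 < w.re →
      HasSum (fun d : Discriminants N => (kroneckerSym (d : ℕ) n : ℂ) / ((d : ℕ) : ℂ) ^ w)
        ((w - 1)⁻¹ * G n w)) ∧
    (∀ n, n ≠ 0 → G n 1 =
      if IsSquare n then 1 / (2 * riemannZeta 2) * aFactor (N * n) else 0) ∧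
    ∀ ε δ R : ℝ, 0 < ε → 0 < δ → ∃ C, 0 ≤ C ∧ ∀ n, n ≠ 0 → ∀ w : ℂ, 1 / 2 + δ ≤ w.re → ‖w‖ ≤ R →
      ‖G n w‖ ≤ C * (n : ℝ) ^ (1 / 4 + ε) := by
  classical
  have : NeZero N := ⟨hN⟩
  refine ⟨fun n w => if h : n ≠ 0 then
    (have : NeZero n := ⟨h⟩; discSeries N n w) else 0, ?_, ?_, ?_, ?_⟩
  · intro n hn w hw
    have : NeZero n := ⟨hn⟩
    simp only [dif_pos hn]
    exact differentiableAt_discSeries N n hw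
  · intro n hn w hw
    have : NeZero n := ⟨hn⟩
    simp only [dif_pos hn]
    have h := LSeriesHasSum_discCoeff N n hw
    rw [LSeriesHasSum, ← (Subtype.val_injective (p := (· ∈ Discriminants N))).hasSum_iff] at h
    · convert h using 1
      funext d
      have hd : (d : ℕ) ≠ 0 := d.2.1.ne'
      rw [Function.comp_apply, LSeries.term_of_ne_zero hd, discCoeff, if_pos d.2]
    · intro d hd
      have hd' : d ∉ Discriminants N := fun h => hd ⟨⟨d, h⟩, rfl⟩
      rcases eq_or_ne d 0 with rfl | hd0
      · simp
      · rw [LSeries.term_of_ne_zero hd0, discCoeff, if_neg hd', zero_div]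
  · intro n hn
    have : NeZero n := ⟨hn⟩
    simp only [dif_pos hn]
    rw [discSeries_one]
  · intro ε δ R hε hδ
    obtain ⟨C, hC, h⟩ := exists_norm_discSeries_le N hε hδ R
    refine ⟨C, hC, fun n hn w hw hR => ?_⟩
    have : NeZero n := ⟨hn⟩
    simp only [dif_pos hn]
    exact h n w hw hR

end DiscriminantBounds

end EllipticTwists

namespace EllipticTwists

/-! ### Sums of holomorphic functions of several variables -/

section SeveralVariables

open Metric

variable {V : Type*} [NormedAddCommGroup V] [NormedSpace ℂ V]

/-- Cauchy's estimate for the Fréchet derivative. -/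
lemma norm_fderiv_le_of_forall_ball_norm_le {f : V → ℂ} {x : V} {r B : ℝ} (hr : 0 < r)
    (hf : ∀ y ∈ ball x r, DifferentiableAt ℂ f y) (hB : ∀ y ∈ ball x r, ‖f y‖ ≤ B) :
    ‖fderiv ℂ f x‖ ≤ B * (2 / r) := by
  have hB0 : 0 ≤ B := (norm_nonneg _).trans (hB x (mem_ball_self hr))
  refine ContinuousLinearMap.opNorm_le_bound _ (by positivity) fun v => ?_
  rcases eq_or_ne v 0 with rfl | hv
  · simp
  have hv0 : 0 < ‖v‖ := norm_pos_iff.2 hv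
  -- With this radius the disc t ↦ x + t v stays inside the ball, and the one-variable Cauchy
  -- estimate applies on that complex line.
  set ρ : ℝ := r / 2 / ‖v‖ with hρ
  have hρ0 : 0 < ρ := by positivity
  have hmem : ∀ t ∈ closedBall (0 : ℂ) ρ, x + t • v ∈ ball x r := by
    intro t ht
    rw [mem_closedBall_zero_iff] at ht
    rw [mem_ball_iff_norm, add_sub_cancel_left, norm_smul]
    calc ‖t‖ * ‖v‖ ≤ ρ * ‖v‖ := by gcongr
      _ = r / 2 := by rw [hρ, div_mul_cancel₀ _ hv0.ne']
      _ < r := by linarith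
  have hline : ∀ t : ℂ, HasDerivAt (fun t : ℂ => x + t • v) v t := fun t => by
    simpa using ((hasDerivAt_id t).smul_const v).const_add x
  have hg : ∀ t ∈ closedBall (0 : ℂ) ρ,
      HasDerivAt (fun t : ℂ => f (x + t • v)) (fderiv ℂ f (x + t • v) v) t := fun t ht =>
    (hf _ (hmem t ht)).hasFDerivAt.comp_hasDerivAt t (hline t)
  have hd : DiffContOnCl ℂ (fun t : ℂ => f (x + t • v)) (ball 0 ρ) := by
    refine DifferentiableOn.diffContOnCl fun t ht => ?_
    rw [closure_ball _ hρ0.ne'] at ht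
    exact (hg t ht).differentiableAt.differentiableWithinAt
  have h := Complex.norm_deriv_le_of_forall_mem_sphere_norm_le hρ0 hd
    (fun t ht => hB _ (hmem t (sphere_subset_closedBall ht)))
  have h0 := (hg 0 (mem_closedBall_self hρ0.le)).deriv
  rw [zero_smul, add_zero] at h0
  rw [h0] at h
  refine h.trans (le_of_eq ?_)
  rw [hρ]
  field_simp

/-- A series of holomorphic functions, dominated by a convergent series of constants, has a
holomorphic sum. -/
lemma differentiableAt_tsum_of_summable_norm {ι : Type*} {f : ι → V → ℂ} {u : ι → ℝ} {x : V}
    {r : ℝ} (hr : 0 < r) (hu : Summable u)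
    (hf : ∀ i, ∀ y ∈ ball x r, DifferentiableAt ℂ (f i) y)
    (hB : ∀ i, ∀ y ∈ ball x r, ‖f i y‖ ≤ u i) :
    DifferentiableAt ℂ (fun y => ∑' i, f i y) x := by
  -- On the half ball every point keeps room r / 2 for Cauchy's estimate, so the derivatives are
  -- dominated by a multiple of the same series u.
  have hsub : ∀ y ∈ ball x (r / 2), ball y (r / 2) ⊆ ball x r := fun y hy =>
    ball_subset_ball' (by rw [mem_ball] at hy; linarith)
  have hr2 : 0 < r / 2 := by positivity
  refine (hasFDerivAt_tsum_of_isPreconnected (𝕜 := ℂ) (u := fun i => u i * (2 / (r / 2)))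
    (f' := fun i y => fderiv ℂ (f i) y) (s := ball x (r / 2)) (x₀ := x) (hu.mul_right _)
    isOpen_ball (convex_ball x _).isPreconnected (fun i y hy => ?_) (fun i y hy => ?_)
    (mem_ball_self hr2) ?_ (mem_ball_self hr2)).differentiableAt
  · exact (hf i y (hsub y hy (mem_ball_self hr2))).hasFDerivAt
  · exact norm_fderiv_le_of_forall_ball_norm_le hr2 (fun z hz => hf i z (hsub y hy hz))
      (fun z hz => hB i z (hsub y hy hz))
  · exact Summable.of_norm_bounded hu fun i => hB i x (mem_ball_self hr)

end SeveralVariables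

/-! ### Products of series -/

section ProductSeries

lemma summable_norm_prod_and_tsum_prod {k : ℕ} (f : Fin k → ℕ → ℂ)
    (hf : ∀ j, Summable fun m => ‖f j m‖) :
    (Summable fun n : Fin k → ℕ => ‖∏ j, f j (n j)‖) ∧
      ∑' n : Fin k → ℕ, ∏ j, f j (n j) = ∏ j, ∑' m, f j m := by
  induction k with
  | zero => exact ⟨Summable.of_finite, by simp⟩
  | succ k ih =>
    obtain ⟨h1, h2⟩ := ih (fun j => f j.succ) (fun j => hf j.succ)
    have he : ∀ x : ℕ × (Fin k → ℕ),
        ∏ j, f j (Fin.consEquiv (fun _ : Fin (k + 1) => ℕ) x j) =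
          f 0 x.1 * ∏ j, f j.succ (x.2 j) := fun x => by
      rw [Fin.prod_univ_succ]
      simp [Fin.consEquiv]
    constructor
    · rw [← (Fin.consEquiv (fun _ : Fin (k + 1) => ℕ)).summable_iff]
      refine (summable_mul_of_summable_norm (hf 0) h1).norm.congr fun x => ?_
      rw [Function.comp_apply, he]
    · rw [← (Fin.consEquiv (fun _ : Fin (k + 1) => ℕ)).tsum_eq, tsum_congr he,
        ← tsum_mul_tsum_of_summable_norm (hf 0) h1, h2, Fin.prod_univ_succ]

end ProductSeries

/-! ### The conductor -/

section Conductor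

/-- Every factor is a power of a nonzero norm. The argument does not need the product to have finite
support, since `finprod` is 1 otherwise. -/
lemma ellConductor_ne_zero (E : WeierstrassCurve ℚ) : ellConductor E ≠ 0 := by
  rw [ellConductor]
  refine finprod_induction (p := fun n : ℕ => n ≠ 0) one_ne_zero (fun a b => mul_ne_zero)
    fun v => pow_ne_zero _ ?_
  rw [Ne, Ideal.absNorm_eq_zero_iff]
  exact v.ne_bot

end Conductor

end EllipticTwists

namespace EllipticTwists

/-! ### The multiple Dirichlet series -/

section MultipleDirichletSeries

open Filter Topology

variable (E : WeierstrassCurve ℚ)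

lemma summable_norm_term_lam {s : ℂ} (hs : 1 < s.re) :
    Summable fun m => ‖LSeries.term (lam E) s m‖ := by
  refine (summable_norm_lam_mul_rpow E hs).of_nonneg_of_le (fun _ => norm_nonneg _) fun m => ?_
  rw [LSeries.norm_term_eq]
  split_ifs
  · positivity
  · rw [Real.rpow_neg (Nat.cast_nonneg m), div_eq_mul_inv]

lemma term_twistCoeff (d : ℤ) (s : ℂ) (m : ℕ) :
    LSeries.term (twistCoeff E d) s m = LSeries.term (lam E) s m * kroneckerSym d m := by
  rcases eq_or_ne m 0 with rfl | hm
  · simp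
  · rw [LSeries.term_of_ne_zero hm, LSeries.term_of_ne_zero hm, twistCoeff]
    ring

lemma norm_term_twistCoeff_le (d : ℤ) (s : ℂ) (m : ℕ) :
    ‖LSeries.term (twistCoeff E d) s m‖ ≤ ‖LSeries.term (lam E) s m‖ := by
  rw [term_twistCoeff, norm_mul]
  exact mul_le_of_le_one_right (norm_nonneg _) (norm_kroneckerSym_le _ _)

lemma summable_norm_term_twistCoeff (d : ℤ) {s : ℂ} (hs : 1 < s.re) :
    Summable fun m => ‖LSeries.term (twistCoeff E d) s m‖ :=
  (summable_norm_term_lam E hs).of_nonneg_of_le (fun _ => norm_nonneg _)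
    (norm_term_twistCoeff_le E d s)

lemma norm_twistedL_le (d : ℤ) {s : ℂ} (hs : 1 < s.re) :
    ‖twistedL E d s‖ ≤ ∑' m, ‖LSeries.term (lam E) s m‖ :=
  (norm_tsum_le_tsum_norm (summable_norm_term_twistCoeff E d hs)).trans
    ((summable_norm_term_twistCoeff E d hs).tsum_le_tsum (norm_term_twistCoeff_le E d s)
      (summable_norm_term_lam E hs))

lemma summable_discriminants_rpow (N : ℕ) {σ : ℝ} (hσ : 1 < σ) :
    Summable fun d : Discriminants N => ((d : ℕ) : ℝ) ^ (-σ) :=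
  (Real.summable_nat_rpow.2 (by linarith : -σ < -1)).comp_injective Subtype.val_injective

lemma norm_natCast_cpow_inv {d : ℕ} (hd : 0 < d) (w : ℂ) :
    ‖((d : ℂ) ^ w)⁻¹‖ = (d : ℝ) ^ (-w.re) := by
  rw [norm_inv, Complex.norm_natCast_cpow_of_pos hd, Real.rpow_neg (Nat.cast_nonneg d)]

lemma summable_norm_mdsTerm (M : ℕ) {k : ℕ} {s : Fin k → ℂ} {w : ℂ} (hs : ∀ j, 1 < (s j).re)
    (hw : 1 < w.re) :
    Summable fun d : Discriminants (ellConductor E) => ‖mdsTerm E M s w d‖ := by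
  refine ((summable_discriminants_rpow _ hw).mul_left
    (∏ j, ∑' m, ‖LSeries.term (lam E) (s j) m‖)).of_nonneg_of_le (fun _ => norm_nonneg _)
    fun d => ?_
  rw [mdsTerm, div_eq_mul_inv, norm_mul, norm_natCast_cpow_inv d.2.1, norm_mul, norm_prod]
  gcongr
  refine (mul_le_of_le_one_left (by positivity) (norm_kroneckerSym_le _ _)).trans ?_
  exact Finset.prod_le_prod (fun _ _ => norm_nonneg _) fun j _ => norm_twistedL_le E _ (hs j)

/-- The product `∏ λ_E(n_j) n_j^{-s_j}`. -/
noncomputable def tupleTerm {k : ℕ} (s : Fin k → ℂ) (n : Fin k → ℕ) : ℂ :=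
  ∏ j, LSeries.term (lam E) (s j) (n j)

/-- Because `LSeries.term` is 0 at 0, sums over positive tuples can run over all tuples. -/
lemma tupleTerm_eq_zero {k : ℕ} (s : Fin k → ℂ) {n : Fin k → ℕ} (hn : ¬ ∀ j, 0 < n j) :
    tupleTerm E s n = 0 := by
  push Not at hn
  obtain ⟨j, hj⟩ := hn
  refine Finset.prod_eq_zero (Finset.mem_univ j) ?_
  rw [Nat.le_zero.1 hj, LSeries.term_zero]

lemma tupleTerm_eq {k : ℕ} (s : Fin k → ℂ) {n : Fin k → ℕ} (hn : ∀ j, 0 < n j) :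
    tupleTerm E s n = (∏ j, lam E (n j)) / ∏ j, (n j : ℂ) ^ s j := by
  rw [tupleTerm, ← Finset.prod_div_distrib]
  exact Finset.prod_congr rfl fun j _ => LSeries.term_of_ne_zero (hn j).ne' _ _

lemma mul_prod_ne_zero {M : ℕ} (hM : 0 < M) {k : ℕ} {n : Fin k → ℕ} (hn : ∀ j, 0 < n j) :
    M * ∏ j, n j ≠ 0 :=
  mul_ne_zero hM.ne' (Finset.prod_ne_zero_iff.2 fun j _ => (hn j).ne')

lemma summable_norm_tupleTerm {k : ℕ} {s : Fin k → ℂ} (hs : ∀ j, 1 < (s j).re) :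
    Summable fun n : Fin k → ℕ => ‖tupleTerm E s n‖ :=
  (summable_norm_prod_and_tsum_prod _ fun j => summable_norm_term_lam E (hs j)).1

lemma kroneckerSym_mul_prod (d : ℤ) {M : ℕ} (hM : 0 < M) {k : ℕ} {n : Fin k → ℕ}
    (hn : ∀ j, 0 < n j) :
    kroneckerSym d (M * ∏ j, n j) = kroneckerSym d M * ∏ j, kroneckerSym d (n j) := by
  have h : ∀ t : Finset (Fin k), kroneckerSym d (∏ j ∈ t, n j) = ∏ j ∈ t, kroneckerSym d (n j) := by
    intro t
    induction t using Finset.cons_induction with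
    | empty => simp [kroneckerSym_one_right]
    | cons a t ha ih =>
      rw [Finset.prod_cons, Finset.prod_cons, kroneckerSym_mul_right _ (hn a).ne'
        (Finset.prod_ne_zero_iff.2 fun j _ => (hn j).ne'), ih]
  rw [kroneckerSym_mul_right _ hM.ne' (Finset.prod_ne_zero_iff.2 fun j _ => (hn j).ne'), h]

lemma mdsTerm_eq_tsum {M : ℕ} (hM : 0 < M) {k : ℕ} {s : Fin k → ℂ} (hs : ∀ j, 1 < (s j).re)
    (w : ℂ) (d : ℕ) :
    mdsTerm E M s w d =
      ∑' n : Fin k → ℕ, tupleTerm E s n * (kroneckerSym d (M * ∏ j, n j) / (d : ℂ) ^ w) := by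
  have h := (summable_norm_prod_and_tsum_prod _
    fun j => summable_norm_term_twistCoeff E d (hs j)).2
  rw [mdsTerm]
  simp only [twistedL, LSeries]
  rw [← h, ← tsum_mul_left, ← tsum_div_const]
  refine tsum_congr fun n => ?_
  by_cases hn : ∀ j, 0 < n j
  · simp only [term_twistCoeff]
    rw [Finset.prod_mul_distrib, kroneckerSym_mul_prod _ hM hn, tupleTerm]
    push_cast
    ring
  · have h0 : ∏ j, LSeries.term (twistCoeff E d) (s j) (n j) = 0 := by
      simp only [term_twistCoeff]
      rw [Finset.prod_mul_distrib]
      rw [← tupleTerm, tupleTerm_eq_zero E s hn, zero_mul]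
    rw [h0, tupleTerm_eq_zero E s hn]
    ring

lemma tsum_tupleTerm_comm (M N : ℕ) {k : ℕ} {s : Fin k → ℂ} {w : ℂ} (hs : ∀ j, 1 < (s j).re)
    (hw : 1 < w.re) :
    ∑' d : Discriminants N, ∑' n : Fin k → ℕ,
        tupleTerm E s n * (kroneckerSym (d : ℕ) (M * ∏ j, n j) / ((d : ℕ) : ℂ) ^ w) =
      ∑' n : Fin k → ℕ, tupleTerm E s n * ∑' d : Discriminants N,
        (kroneckerSym (d : ℕ) (M * ∏ j, n j) : ℂ) / ((d : ℕ) : ℂ) ^ w := by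
  have hsum : Summable (Function.uncurry fun (d : Discriminants N) (n : Fin k → ℕ) =>
      tupleTerm E s n * ((kroneckerSym (d : ℕ) (M * ∏ j, n j) : ℂ) / ((d : ℕ) : ℂ) ^ w)) := by
    refine Summable.of_norm_bounded (g := fun x : Discriminants N × (Fin k → ℕ) =>
      ((x.1 : ℕ) : ℝ) ^ (-w.re) * ‖tupleTerm E s x.2‖) ?_ fun x => ?_
    · exact (summable_discriminants_rpow _ hw).mul_of_nonneg (summable_norm_tupleTerm E hs)
        (fun _ => Real.rpow_nonneg (Nat.cast_nonneg _) _) (fun _ => norm_nonneg _)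
    · rw [Function.uncurry, div_eq_mul_inv, norm_mul, norm_mul, norm_natCast_cpow_inv x.1.2.1,
        mul_comm]
      refine mul_le_mul_of_nonneg_right ?_ (norm_nonneg _)
      exact mul_le_of_le_one_left (Real.rpow_nonneg (Nat.cast_nonneg _) _)
        (norm_kroneckerSym_le _ _)
  refine (Summable.tsum_comm hsum).symm.trans ?_
  exact tsum_congr fun n => tsum_mul_left

lemma mds_eq_tsum {M : ℕ} (hM : 0 < M) {k : ℕ} {s : Fin k → ℂ} {w : ℂ} (hs : ∀ j, 1 < (s j).re)
    (hw : 1 < w.re) :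
    mds E M s w = ∑' n : Fin k → ℕ, tupleTerm E s n *
      ∑' d : Discriminants (ellConductor E),
        (kroneckerSym (d : ℕ) (M * ∏ j, n j) : ℂ) / ((d : ℕ) : ℂ) ^ w := by
  rw [← tsum_tupleTerm_comm E M _ hs hw]
  exact tsum_congr fun d => mdsTerm_eq_tsum E hM hs w d

lemma differentiable_term_lam {k : ℕ} (j : Fin k) (m : ℕ) :
    Differentiable ℂ fun x : (Fin k → ℂ) × ℂ => LSeries.term (lam E) (x.1 j) m := by
  rcases eq_or_ne m 0 with rfl | hm
  · simp
  · have hm' : (m : ℂ) ≠ 0 := Nat.cast_ne_zero.2 hm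
    simp only [LSeries.term_of_ne_zero hm]
    have h : Differentiable ℂ fun x : (Fin k → ℂ) × ℂ => (m : ℂ) ^ (-x.1 j) := fun x =>
      DifferentiableAt.const_cpow (by fun_prop) (Or.inl hm')
    simp only [div_eq_mul_inv, ← Complex.cpow_neg]
    exact h.const_mul _

lemma differentiable_tupleTerm {k : ℕ} (n : Fin k → ℕ) :
    Differentiable ℂ fun x : (Fin k → ℂ) × ℂ => tupleTerm E x.1 n := by
  have h : ∀ t : Finset (Fin k), Differentiable ℂ fun x : (Fin k → ℂ) × ℂ =>
      ∏ j ∈ t, LSeries.term (lam E) (x.1 j) (n j) := fun t => by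
    induction t using Finset.cons_induction with
    | empty => simp
    | cons a t ha ih =>
      simp only [Finset.prod_cons]
      exact (differentiable_term_lam E a (n a)).mul ih
  exact h Finset.univ

lemma norm_term_lam_le {s : ℂ} {σ : ℝ} (hs : σ ≤ s.re) (m : ℕ) :
    ‖LSeries.term (lam E) s m‖ ≤ ‖lam E m‖ * (m : ℝ) ^ (-σ) := by
  rw [LSeries.norm_term_eq]
  split_ifs with hm
  · positivity
  · have : 1 ≤ (m : ℝ) := by exact_mod_cast Nat.one_le_iff_ne_zero.2 hm
    rw [div_eq_mul_inv, ← Real.rpow_neg (Nat.cast_nonneg m)]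
    gcongr

/-- Growth of order τ in the product of the n_j is paid for by lowering each exponent σ to σ - τ. -/
lemma norm_tupleTerm_mul_rpow_le {k : ℕ} {s : Fin k → ℂ} {σ τ : ℝ} (hs : ∀ j, σ ≤ (s j).re)
    {M : ℕ} {n : Fin k → ℕ} (hn : ∀ j, 0 < n j) :
    ‖tupleTerm E s n‖ * ((M * ∏ j, n j : ℕ) : ℝ) ^ τ ≤
      (M : ℝ) ^ τ * ‖∏ j, ((‖lam E (n j)‖ * (n j : ℝ) ^ (-(σ - τ)) : ℝ) : ℂ)‖ := by
  have h1 : ‖tupleTerm E s n‖ ≤ ∏ j, (‖lam E (n j)‖ * (n j : ℝ) ^ (-σ)) := by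
    rw [tupleTerm, norm_prod]
    exact Finset.prod_le_prod (fun _ _ => norm_nonneg _) fun j _ => norm_term_lam_le E (hs j) _
  have h2 : ((M * ∏ j, n j : ℕ) : ℝ) ^ τ = (M : ℝ) ^ τ * ∏ j, (n j : ℝ) ^ τ := by
    push_cast
    rw [Real.mul_rpow (Nat.cast_nonneg _) (by positivity),
      ← Real.finsetProd_rpow _ _ fun j _ => Nat.cast_nonneg _]
  have h3 : ‖∏ j, ((‖lam E (n j)‖ * (n j : ℝ) ^ (-(σ - τ)) : ℝ) : ℂ)‖ =
      (∏ j, (‖lam E (n j)‖ * (n j : ℝ) ^ (-σ))) * ∏ j, (n j : ℝ) ^ τ := by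
    rw [norm_prod, ← Finset.prod_mul_distrib]
    refine Finset.prod_congr rfl fun j _ => ?_
    rw [Complex.norm_real, Real.norm_of_nonneg (by positivity), mul_assoc,
      ← Real.rpow_add (by exact_mod_cast hn j)]
    congr 2
    ring
  rw [h2, h3, mul_left_comm]
  gcongr

lemma norm_aFactor_le (m : ℕ) : ‖aFactor m‖ ≤ 1 := by
  rw [aFactor, norm_prod]
  refine Finset.prod_le_one (fun _ _ => norm_nonneg _) fun p _ => ?_
  rw [norm_div, show (p : ℂ) + 1 = ((p + 1 : ℕ) : ℂ) by push_cast; rfl, Complex.norm_natCast,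
    Complex.norm_natCast]
  exact div_le_one_of_le₀ (by exact_mod_cast p.le_succ) (Nat.cast_nonneg _)

lemma residueTerm_eq (M : ℕ) {k : ℕ} (s : Fin k → ℂ) {n : Fin k → ℕ} (hn : ∀ j, 0 < n j) :
    residueTerm E M s n = tupleTerm E s n * aFactor (ellConductor E * (M * ∏ j, n j)) := by
  rw [residueTerm, tupleTerm_eq E s hn,
    show M * ellConductor E * ∏ j, n j = ellConductor E * (M * ∏ j, n j) by ring]
  ring

lemma summable_norm_residueTerm (M : ℕ) {k : ℕ} {s : Fin k → ℂ} (hs : ∀ j, 1 < (s j).re) :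
    Summable fun n : SquareTuples M k => ‖residueTerm E M s n‖ := by
  refine ((summable_norm_tupleTerm E hs).comp_injective
    (Subtype.val_injective (p := (· ∈ SquareTuples M k)))).of_nonneg_of_le
    (fun _ => norm_nonneg _) fun n => ?_
  rw [residueTerm_eq E M s n.2.1, norm_mul]
  exact mul_le_of_le_one_right (norm_nonneg _) (norm_aFactor_le _)

/-- One δ, at most half the distance of the real parts to the boundary, serves both as radius and as
remaining margin. -/
lemma exists_pos_lt_re {k : ℕ} {x : (Fin k → ℂ) × ℂ} (hx : x ∈ continuationRegion k) :
    ∃ δ : ℝ, 0 < δ ∧ ∀ y ∈ Metric.ball x δ, (∀ j, 5 / 4 + δ ≤ (y.1 j).re) ∧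
      1 / 2 + δ ≤ y.2.re ∧ ‖y‖ ≤ ‖x‖ + δ := by
  obtain ⟨δ₁, h1, h2⟩ : ∃ δ : ℝ, 0 < δ ∧ ∀ j, 5 / 4 + 2 * δ ≤ (x.1 j).re := by
    rcases isEmpty_or_nonempty (Fin k) with h | h
    · exact ⟨1, one_pos, fun j => isEmptyElim j⟩
    · obtain ⟨i, hi⟩ := Finite.exists_min fun j => (x.1 j).re
      refine ⟨((x.1 i).re - 5 / 4) / 2, by have := hx.1 i; linarith, fun j => ?_⟩
      have := hi j
      linarith
  have h3 := hx.2
  refine ⟨min δ₁ ((x.2.re - 1 / 2) / 2), lt_min h1 (by linarith), fun y hy => ?_⟩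
  set δ := min δ₁ ((x.2.re - 1 / 2) / 2)
  have hδ1 : δ ≤ δ₁ := min_le_left _ _
  have hδ2 : δ ≤ (x.2.re - 1 / 2) / 2 := min_le_right _ _
  rw [mem_ball_iff_norm] at hy
  refine ⟨fun j => ?_, ?_, ?_⟩
  · have ha : |(y.1 j).re - (x.1 j).re| ≤ ‖y - x‖ := by
      rw [← Complex.sub_re]
      exact (Complex.abs_re_le_norm _).trans ((norm_le_pi_norm (y - x).1 j).trans (norm_fst_le _))
    have := (abs_le.1 ha).1
    have := h2 j
    linarith
  · have ha : |y.2.re - x.2.re| ≤ ‖y - x‖ := by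
      rw [← Complex.sub_re]
      exact (Complex.abs_re_le_norm _).trans (norm_snd_le (y - x))
    have := (abs_le.1 ha).1
    linarith
  · have := norm_le_norm_add_norm_sub' y x
    linarith

/-- The continuation of `(w - 1) A_{E,M}(s_1, …, s_k; w)`: it is holomorphic in the region, and
its value at `w = 1` is `H_{E,M}(S)`. -/
theorem exists_continuation {M : ℕ} (hM : 0 < M) (k : ℕ) : ∃ F : (Fin k → ℂ) × ℂ → ℂ,
    (∀ x ∈ continuationRegion k, DifferentiableAt ℂ F x) ∧
    (∀ x ∈ continuationRegion k, 1 < x.2.re → F x = (x.2 - 1) * mds E M x.1 x.2) ∧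
    ∀ s : Fin k → ℂ, (∀ j, 5 / 4 < (s j).re) → F (s, 1) = residueH E M s := by
  obtain ⟨G, hG1, hG2, hG3, hG4⟩ := exists_discSeries (ellConductor_ne_zero E)
  refine ⟨fun x => ∑' n : Fin k → ℕ, tupleTerm E x.1 n * G (M * ∏ j, n j) x.2, ?_, ?_, ?_⟩
  · intro x hx
    obtain ⟨δ, hδ, hball⟩ := exists_pos_lt_re hx
    -- With ε = δ/2, decay 5/4 + δ against growth 1/4 + δ/2 leaves 1 + δ/2 > 1, enough for absolute
    -- convergence.
    obtain ⟨C, hC, hbound⟩ := hG4 (δ / 2) δ (‖x‖ + δ) (by positivity) hδ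
    have hsum := (summable_norm_prod_and_tsum_prod (k := k)
      (fun _ m => ((‖lam E m‖ * (m : ℝ) ^ (-(5 / 4 + δ - (1 / 4 + δ / 2))) : ℝ) : ℂ))
      fun _ => by
        refine (summable_norm_lam_mul_rpow E
          (by linarith : 1 < 5 / 4 + δ - (1 / 4 + δ / 2))).congr fun m => ?_
        rw [Complex.norm_real, Real.norm_of_nonneg (by positivity)]).1
    refine differentiableAt_tsum_of_summable_norm hδ
      ((hsum.mul_left ((M : ℝ) ^ (1 / 4 + δ / 2))).mul_left C) (fun n y hy => ?_)
      fun n y hy => ?_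
    · obtain ⟨-, h2, -⟩ := hball y hy
      by_cases hn : ∀ j, 0 < n j
      · refine (differentiable_tupleTerm E n y).mul ?_
        exact (hG1 _ (mul_prod_ne_zero hM hn) y.2 (by linarith)).comp y differentiableAt_snd
      · simp [tupleTerm_eq_zero E _ hn]
    · obtain ⟨h1, h2, h3⟩ := hball y hy
      by_cases hn : ∀ j, 0 < n j
      · rw [norm_mul]
        calc ‖tupleTerm E y.1 n‖ * ‖G (M * ∏ j, n j) y.2‖
            ≤ ‖tupleTerm E y.1 n‖ * (C * ((M * ∏ j, n j : ℕ) : ℝ) ^ (1 / 4 + δ / 2)) := by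
              gcongr
              exact hbound _ (mul_prod_ne_zero hM hn) _ h2 ((norm_snd_le y).trans h3)
          _ = C * (‖tupleTerm E y.1 n‖ * ((M * ∏ j, n j : ℕ) : ℝ) ^ (1 / 4 + δ / 2)) := by ring
          _ ≤ _ := mul_le_mul_of_nonneg_left (norm_tupleTerm_mul_rpow_le E h1 hn) hC
      · rw [tupleTerm_eq_zero E _ hn, zero_mul, norm_zero]
        positivity
  · intro x hx hw
    have hw1 : x.2 - 1 ≠ 0 := by
      intro h
      rw [sub_eq_zero.1 h] at hw
      simp at hw
    rw [mds_eq_tsum E hM (fun j => by have := hx.1 j; linarith) hw, ← tsum_mul_left]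
    refine tsum_congr fun n => ?_
    by_cases hn : ∀ j, 0 < n j
    · rw [(hG2 _ (mul_prod_ne_zero hM hn) x.2 hw).tsum_eq, mul_left_comm,
        mul_inv_cancel_left₀ hw1]
    · rw [tupleTerm_eq_zero E _ hn]
      ring
  · intro s hs
    -- Extended by zero, the residue series agrees term by term with the series at w = 1, whose
    -- terms vanish unless M n_1 ⋯ n_k is a square.
    rw [residueH, ← tsum_mul_left, tsum_subtype (SquareTuples M k)
      (fun n => 1 / (2 * riemannZeta 2) * residueTerm E M s n)]
    refine tsum_congr fun n => ?_
    by_cases hn : ∀ j, 0 < n j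
    · simp only
      rw [hG3 _ (mul_prod_ne_zero hM hn)]
      by_cases hsq : IsSquare (M * ∏ j, n j)
      · rw [if_pos hsq, Set.indicator_of_mem (show n ∈ SquareTuples M k from ⟨hn, hsq⟩),
          residueTerm_eq E M s hn]
        ring
      · rw [if_neg hsq, Set.indicator_of_notMem (fun h => hsq h.2), mul_zero]
    · rw [tupleTerm_eq_zero E _ hn, Set.indicator_of_notMem (fun h => hn h.1), zero_mul]

end MultipleDirichletSeries

end EllipticTwists

theorem mainTheorem8 (E : WeierstrassCurve ℚ) [E.IsElliptic] (k M : ℕ) (hk : 0 < k) (hM : 0 < M) :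
    (∀ (s : Fin k → ℂ) (w : ℂ), (∀ j, 1 < (s j).re) → 1 < w.re →
      (∀ d ∈ Discriminants (ellConductor E), ∀ j, LSeriesSummable (twistCoeff E d) (s j)) ∧
      Summable fun d : Discriminants (ellConductor E) => ‖mdsTerm E M s w d‖) ∧
    ∃ A : (Fin k → ℂ) × ℂ → ℂ,
      -- `A` extends the multiple Dirichlet series
      (∀ x ∈ continuationRegion k, 1 < x.2.re → A x = mds E M x.1 x.2) ∧
      -- `A` is holomorphic in the region apart from `w = 1`
      DifferentiableOn ℂ A {x ∈ continuationRegion k | x.2 ≠ 1} ∧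
      -- the singularity along `w = 1` is at most a simple pole
      (∃ F : (Fin k → ℂ) × ℂ → ℂ, DifferentiableOn ℂ F (continuationRegion k) ∧
        ∀ x ∈ continuationRegion k, x.2 ≠ 1 → F x = (x.2 - 1) * A x) ∧
      -- the residue at `w = 1` is `H_{E,M}(S)`, given by an absolutely convergent series
      ∀ s : Fin k → ℂ, (∀ j, 5 / 4 < (s j).re) →
        (Summable fun n : SquareTuples M k => ‖residueTerm E M s n‖) ∧
        Tendsto (fun w => (w - 1) * A (s, w)) (𝓝[≠] 1) (𝓝 (residueH E M s)) := by
  obtain ⟨F, hF1, hF2, hF3⟩ := exists_continuation E hM k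
  have hsub : ∀ {w : ℂ}, 1 < w.re → w - 1 ≠ 0 := fun {w} hw h => by
    rw [sub_eq_zero.1 h] at hw
    simp at hw
  -- The continuation is F / (w - 1); its conventional value 0 on w = 1 plays no role, since the
  -- limit is taken over w ≠ 1.
  refine ⟨fun s w hs hw => ⟨fun d _ j => (summable_norm_term_twistCoeff E d (hs j)).of_norm,
    summable_norm_mdsTerm E M hs hw⟩, fun x => F x / (x.2 - 1), fun x hx hw => ?_,
    fun x hx => ?_, ⟨F, fun x hx => (hF1 x hx).differentiableWithinAt, fun x hx h1 => ?_⟩,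
    fun s hs => ⟨summable_norm_residueTerm E M fun j => by linarith [hs j], ?_⟩⟩
  · simp only
    rw [hF2 x hx hw, mul_div_cancel_left₀ _ (hsub hw)]
  · have hinv : DifferentiableAt ℂ (fun x : (Fin k → ℂ) × ℂ => (x.2 - 1)⁻¹) x :=
      (differentiableAt_inv (sub_ne_zero.2 hx.2)).comp x (differentiableAt_snd.sub_const 1)
    simp only [div_eq_mul_inv]
    exact ((hF1 x hx.1).mul hinv).differentiableWithinAt
  · exact (mul_div_cancel₀ _ (sub_ne_zero.2 h1)).symm
  · have hmem : (s, (1 : ℂ)) ∈ continuationRegion k := ⟨hs, by norm_num⟩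
    have hcont : Tendsto (fun w : ℂ => F (s, w)) (𝓝[≠] 1) (𝓝 (residueH E M s)) := by
      rw [← hF3 s hs]
      have h : ContinuousAt (fun w : ℂ => F (s, w)) 1 :=
        ContinuousAt.comp (f := fun w : ℂ => (s, w)) (hF1 _ hmem).continuousAt (by fun_prop)
      exact h.tendsto.mono_left nhdsWithin_le_nhds
    refine hcont.congr' ?_
    filter_upwards [self_mem_nhdsWithin] with w hw
    exact (mul_div_cancel₀ _ (sub_ne_zero.2 hw)).symm
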